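/- **Theorem (complexity of local low-rank updates of $\mathcal H^2$-matrices).** *Setting.* Let $\mathcal I,\mathcal J$ be finite index sets with cluster trees $\mathcal T_{\mathcal I},\mathcal T_{\mathcal J}$: finite rooted trees whose nodes $t$ carry labels $\hat t$ such that the root has the full index set as label, $\hat t$ is the disjoint union of the labels of the sons of $t$ whenever $t$ has sons. For a node $t_0$, $\mathcal T_{\hat t_0}$ denotes the subtree with root $t_0$. Let $\mathcal T_{\mathcal I\times\mathcal J}$ be a block tree: its nodes are pairs $b=(t,s)$, its root is the pair of the roots, and each $b=(t,s)$ is either a leaf or has the sons $\{t\}\times\operatorname{sons}(s)$ if $t$ is a leaf, $\operatorname{sons}(t)\times\{s\}$ if $s$ is a leaf, and $\operatorname{sons}(t)\times\operatorname{sons}(s)$ otherwise. Its leaves are split into admissible leaves $\mathcal L^+$ and inadmissible leaves $\mathcal L^-$. A cluster basis of rank $k$ is a family $V_t\in\mathbb R^{\hat t\times k}$ with $V_t|_{\hat t'\times k}=V_{t'}E_{t'}$ for all sons $t'$ of $t$, with transfer matrices $E_{t'}\in\mathbb R^{k\times k}$. A matrix $Z\in\mathbb R^{\mathcal I\times\mathcal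 J}$ is an $\mathcal H^2$-matrix for cluster bases $(V_t),(W_s)$ if $Z|_{\hat t\times\hat s}=V_tS_bW_s^*$ with a coupling matrix $S_b\in\mathbb R^{k\times k}$ for all $b=(t,s)\in\mathcal L^+$; it is represented by the leaf matrices and transfer matrices of both bases, the coupling matrices, and the nearfield matrices $Z|_{\hat t\times\hat s}$, $(t,s)\in\mathcal L^-$. *Algorithm.* Let $(t_0,s_0)\in\mathcal T_{\mathcal I\times\mathcal J}$, $X\in\mathbb R^{\hat t_0\times k}$, $Y\in\mathbb R^{\hat s_0\times k}$, let $\widetilde Z$ be $Z$ with $XY^*$ added to the block $\hat t_0\times\hat s_0$, and let target ranks $\varrho_t\le k$ and $\varrho_s\le k$ be given (arbitrary, hence covering every truncation strategy). Put $\widetilde V_t=(V_t\;\;X|_{\hat t\times k})$ for $t\in\mathcal T_{\hat t_0}$, $\widetilde W_s=(W_s\;\;Y|_{\hat s\times k})$ for $s\in\mathcal T_{\hat s_0}$, $\widetilde E_t=\operatorname{diag}(E_t,I)$ for clusters in these subtrees, and $\widetilde S_b=\operatorname{diag}(S_b,I)$. The local update performs the following steps; the column quantities are treated in the same way as the row quantities.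 1. The triangular factors $R_{V,t}$ of thin QR factorizations of $\widetilde V_t$ for all $t\in\mathcal T_{\hat t_0}$ are computed from the leaves upwards: QR factorization of $\widetilde V_t$ if $t$ is a leaf, and of the stacked matrices $R_{V,t'}\widetilde E_{t'}$, $t'\in\operatorname{sons}(t)$, otherwise. Likewise $R_{W,s}$ for $s\in\mathcal T_{\hat s_0}$. 2. The total weight matrices $\widetilde B_t$, $t\in\mathcal T_{\hat t_0}$, are computed from $t_0$ downwards as triangular QR factors of the stacked matrices $R_{W,s}\widetilde S_{(t,s)}^*$ for *all* $s$ with $(t,s)\in\mathcal L^+$ and $\widetilde B_{t^+}\widetilde E_t^*$, where $t^+$ is the father of $t$. For $s\notin\mathcal T_{\hat s_0}$ the triangular factor $R_{W,s}$ of $W_s$, and for $t=t_0$ the weight $\widetilde B_{t_0^+}$ with respect to $V_{t_0^+}$ (absent if $t_0$ is the root), are taken, extended by zero, from weight matrices stored together with the $\mathcal H^2$-matrix. 3. From the leaves upwards, put $\widehat V_t=\widetilde V_t$ if $t$ is a leaf, and let $\widehat V_t$ be the stacked matrices $R_{t'}\widetilde E_{t'}$, $t'\in\operatorname{sons}(t)$,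 otherwise. The columns of $\widehat Q_t$ are the left singular vectors of $\widehat V_t\widetilde B_t^*$ for its at most $\varrho_t$ largest nonzero singular values, filled up by zero columns to $k$ columns, and $R_t=\widehat Q_t^*\widehat V_t$. The matrix $\widehat Q_t$ is the new leaf matrix if $t$ is a leaf, and consists of the new transfer matrices of the sons of $t$ otherwise. 4. $E_{t_0}\gets R_{t_0}\binom{E_{t_0}}{0}$ and $E_{s_0}\gets R_{s_0}\binom{E_{s_0}}{0}$. 5. For $b=(t,s)\in\mathcal L^+$: $S_b\gets R_t\widetilde S_bR_s^*$ if $t\in\mathcal T_{\hat t_0}$ and $s\in\mathcal T_{\hat s_0}$; $S_b\gets R_t\binom{S_b}{0}$ if only $t\in\mathcal T_{\hat t_0}$; $S_b\gets(S_b\;\;0)R_s^*$ if only $s\in\mathcal T_{\hat s_0}$. 6. For $(t,s)\in\mathcal L^-$ with $t\in\mathcal T_{\hat t_0}$, $s\in\mathcal T_{\hat s_0}$, the matrix $X|_{\hat t\times k}Y|_{\hat s\times k}^*$ is added to the nearfield matrix. All other data are left untouched. *Arithmetic operations* are counted as follows: $2mnp$ for multiplying an $m\times n$ by an $n\times p$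 matrix (with or without adding the result to a given matrix), and $c_{\rm qr}\,mn\min\{m,n\}$ and $c_{\rm sv}\,mn\min\{m,n\}$ for the QR and the singular value decomposition of an $m\times n$ matrix. *Assumptions.* (a) Sparsity: for each $t$ there are at most $C_{\rm sp}$ clusters $s$ with $(t,s)\in\mathcal T_{\mathcal I\times\mathcal J}$, and for each $s$ at most $C_{\rm sp}$ clusters $t$. (b) $k^3\,\#\mathcal T_{\hat t_0}\le C_{\rm t}\,k^2\,\#\hat t_0$ and $k^3\,\#\mathcal T_{\hat s_0}\le C_{\rm t}\,k^2\,\#\hat s_0$. (c) The nearfield matrices in the block need only linear storage: the sum of $\#\hat t\,\#\hat s$ over all $(t,s)\in\mathcal L^-$ with $t\in\mathcal T_{\hat t_0}$, $s\in\mathcal T_{\hat s_0}$ is at most $C_{\rm n}\,k\,(\#\hat t_0+\#\hat s_0)$. *Claim.* There is a constant $C$ that depends only on $c_{\rm qr},c_{\rm sv},C_{\rm sp},C_{\rm t},C_{\rm n}$ such that, under (a)–(c), the local update requires at most $$C\,(\#\hat t_0+\#\hat s_0)\,k^2$$ operations (whatever the stored weights are). Its result represents a matrix $Z'\in\mathbb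 R^{\mathcal I\times\mathcal J}$ that is globally an $\mathcal H^2$-matrix for the same block tree and nested cluster bases of rank $k$; the columns of the new basis matrices of the clusters in $\mathcal T_{\hat t_0}$ and $\mathcal T_{\hat s_0}$ are orthonormal up to vanishing columns; $Z'_{ij}=Z_{ij}$ if $i\notin\hat t_0$ and $j\notin\hat s_0$; and $Z'|_{\hat t\times\hat s}=\widetilde Z|_{\hat t\times\hat s}$ for all $(t,s)\in\mathcal L^-$. If the stored weights belong to $Z$ — i.e. they have the same Gram matrices as $V_t$ for $t\notin\mathcal T_{\hat t_0}$, as $W_s$ for $s\notin\mathcal T_{\hat s_0}$, and, for $t=t_0^+$, as the stacked matrix of factors $B_{t,b}$ with $Z|_{\hat t\times\hat s}=V_tB_{t,b}^*$ for all $b=(t^*,s)\in\mathcal L^+$ such that $t^*$ is $t$ or a predecessor of $t$, and similarly for $s_0^+$ — then $$\|Z'-\widetilde Z\|_F^2\;\le\;\sum_{t\in\mathcal T_{\hat t_0}}\varepsilon_t^2+\sum_{s\in\mathcal T_{\hat s_0}}\varepsilon_s^2 .$$ Here $\varepsilon_t$ is the Frobenius error of the best approximation of rank at most $\varrho_t$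 of the matrix $\widetilde Z_t$ composed of all blocks $\widetilde Z|_{\hat t\times\hat s}$ with $(t^*,s)\in\mathcal L^+$ for $t^*=t$ or a predecessor $t^*$ of $t$, and $\varepsilon_s$ is defined analogously for the columns. -/

import Mathlib

open Matrix

set_option linter.unusedSectionVars false

noncomputable section

namespace HTwo

/-! ### Rooted trees, cluster trees and block trees -/

/-- A rooted tree on a finite set `N` of nodes, given by its root and its father map; the root is,
by convention, its own father, and every node reaches the root by iterating the father map. -/
structure RootedTree (N : Type) where
  root : N
  father : N → N
  father_root : father root = root
  reaches_root : ∀ t, ∃ n : ℕ, father^[n] t = root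

namespace RootedTree

variable {N : Type} [Fintype N] [DecidableEq N] (T : RootedTree N)

/-- The set of sons of a node. -/
def sons (t : N) : Finset N :=
  Finset.univ.filter fun u => u ≠ T.root ∧ T.father u = t

open scoped Classical in
/-- The nodes of the subtree with root `t₀`. -/
def subtree (t₀ : N) : Finset N :=
  Finset.univ.filter fun t => ∃ n : ℕ, T.father^[n] t = t₀

open scoped Classical in
/-- The distance of a node to the root. -/
def level (t : N) : ℕ := Nat.find (T.reaches_root t)

theorem mem_sons {t u : N} : u ∈ T.sons t ↔ u ≠ T.root ∧ T.father u = t := by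
  simp [sons]

theorem mem_subtree {t₀ t : N} : t ∈ T.subtree t₀ ↔ ∃ n : ℕ, T.father^[n] t = t₀ := by
  simp [subtree]

theorem self_mem_subtree (t : N) : t ∈ T.subtree t := T.mem_subtree.2 ⟨0, rfl⟩

theorem iterate_root (n : ℕ) : T.father^[n] T.root = T.root :=
  Function.iterate_fixed T.father_root n

theorem son_mem_subtree {t₀ t u : N} (ht : t ∈ T.subtree t₀) (hu : u ∈ T.sons t) :
    u ∈ T.subtree t₀ := by
  obtain ⟨n, hn⟩ := T.mem_subtree.1 ht
  refine T.mem_subtree.2 ⟨n + 1, ?_⟩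
  rw [Function.iterate_succ_apply, (T.mem_sons.1 hu).2, hn]

theorem father_mem_subtree {t₀ t : N} (ht : t ∈ T.subtree t₀) (h : t ≠ t₀) :
    T.father t ∈ T.subtree t₀ := by
  obtain ⟨n, hn⟩ := T.mem_subtree.1 ht
  cases n with
  | zero => exact absurd hn h
  | succ n => exact T.mem_subtree.2 ⟨n, by rw [← hn, Function.iterate_succ_apply]⟩

theorem ne_root_of_mem_subtree {t₀ t : N} (ht : t ∈ T.subtree t₀) (h : t ≠ t₀) :
    t ≠ T.root := by
  rintro rfl
  obtain ⟨n, hn⟩ := T.mem_subtree.1 ht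
  exact h (by rw [← hn, T.iterate_root])

theorem mem_sons_father {t₀ t : N} (ht : t ∈ T.subtree t₀) (h : t ≠ t₀) :
    t ∈ T.sons (T.father t) :=
  T.mem_sons.2 ⟨T.ne_root_of_mem_subtree ht h, rfl⟩

theorem level_father_lt {t : N} (h : t ≠ T.root) : T.level (T.father t) < T.level t := by
  classical
  have hs : T.father^[T.level t] t = T.root := Nat.find_spec (T.reaches_root t)
  cases hl : T.level t with
  | zero => rw [hl] at hs; exact absurd hs h
  | succ n =>
    rw [hl, Function.iterate_succ_apply] at hs
    exact Nat.lt_succ_of_le (Nat.find_min' (T.reaches_root (T.father t)) hs)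

theorem level_father_le (t : N) : T.level (T.father t) ≤ T.level t := by
  by_cases h : t = T.root
  · rw [h, T.father_root]
  · exact (T.level_father_lt h).le

theorem level_iterate_le (n : ℕ) (t : N) : T.level (T.father^[n] t) ≤ T.level t := by
  induction n with
  | zero => exact le_rfl
  | succ n ih =>
    rw [Function.iterate_succ_apply']
    exact (T.level_father_le _).trans ih

theorem card_subtree_lt {t u : N} (hu : u ∈ T.sons t) :
    (T.subtree u).card < (T.subtree t).card := by
  obtain ⟨hr, hf⟩ := T.mem_sons.1 hu
  refine Finset.card_lt_card ((Finset.ssubset_iff_of_subset ?_).2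
    ⟨t, T.self_mem_subtree t, fun ht => ?_⟩)
  · intro v hv
    obtain ⟨n, hn⟩ := T.mem_subtree.1 hv
    exact T.mem_subtree.2 ⟨n + 1, by rw [Function.iterate_succ_apply', hn, hf]⟩
  · obtain ⟨n, hn⟩ := T.mem_subtree.1 ht
    have h1 := T.level_iterate_le n t
    have h2 := T.level_father_lt hr
    rw [hn] at h1
    rw [hf] at h2
    omega

end RootedTree

/-- A cluster tree for the finite index set `ι`: a rooted tree with labels such that the root is
labelled by `ι`, each label is the union of the labels of the sons (if there are any), and the
labels of different sons of one cluster are disjoint. -/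
structure ClusterTree (ι N : Type) [Fintype ι] [DecidableEq ι] [Fintype N] [DecidableEq N]
    extends RootedTree N where
  label : N → Finset ι
  label_root : label root = Finset.univ
  label_eq : ∀ t, (toRootedTree.sons t).Nonempty →
    label t = (toRootedTree.sons t).biUnion label
  label_disjoint : ∀ t, ∀ t₁ ∈ toRootedTree.sons t, ∀ t₂ ∈ toRootedTree.sons t,
    t₁ ≠ t₂ → Disjoint (label t₁) (label t₂)

variable {ι κ N M : Type} [Fintype ι] [DecidableEq ι] [Fintype κ] [DecidableEq κ]
  [Fintype N] [DecidableEq N] [Fintype M] [DecidableEq M]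

/-- The set of sons that a block `b = (t, s)` has if it is subdivided. -/
def splitBlock (TI : ClusterTree ι N) (TJ : ClusterTree κ M) (b : N × M) : Finset (N × M) :=
  if TI.sons b.1 = ∅ then {b.1} ×ˢ TJ.sons b.2
  else if TJ.sons b.2 = ∅ then TI.sons b.1 ×ˢ {b.2}
  else TI.sons b.1 ×ˢ TJ.sons b.2

/-- A block tree for two cluster trees: its root is the pair of the roots, each block is the root
or a son of a block, and the sons of a subdivided block are the prescribed ones. A set of
admissible blocks is singled out among the leaves. -/
structure BlockTree (TI : ClusterTree ι N) (TJ : ClusterTree κ M) where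
  blocks : Finset (N × M)
  sons : N × M → Finset (N × M)
  mem_blocks : ∀ b, b ∈ blocks ↔ b = (TI.root, TJ.root) ∨ ∃ p ∈ blocks, b ∈ sons p
  sons_eq : ∀ b ∈ blocks, (sons b).Nonempty → sons b = splitBlock TI TJ b
  admissible : Finset (N × M)
  admissible_leaf : ∀ b ∈ admissible, b ∈ blocks ∧ sons b = ∅

namespace BlockTree

variable {TI : ClusterTree ι N} {TJ : ClusterTree κ M} (B : BlockTree TI TJ)

/-- The inadmissible leaves. -/
def inadmissible : Finset (N × M) :=
  B.blocks.filter fun b => B.sons b = ∅ ∧ b ∉ B.admissible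

/-- The column clusters `s` such that `(t, s)` is an admissible leaf. -/
def row (t : N) : Finset M := Finset.univ.filter fun s => (t, s) ∈ B.admissible

/-- The row clusters `t` such that `(t, s)` is an admissible leaf. -/
def col (s : M) : Finset N := Finset.univ.filter fun t => (t, s) ∈ B.admissible

/-- The admissible blocks connected to the row cluster `t` or to one of its predecessors. -/
def rowBlocks (t : N) : Finset (N × M) := B.admissible.filter fun b => t ∈ TI.subtree b.1

/-- The admissible blocks connected to the column cluster `s` or to one of its predecessors. -/
def colBlocks (s : M) : Finset (N × M) := B.admissible.filter fun b => s ∈ TJ.subtree b.2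

/-- The block tree is sparse with constant `Csp`. -/
def IsSparse (Csp : ℕ) : Prop :=
  (∀ t, (Finset.univ.filter fun s => (t, s) ∈ B.blocks).card ≤ Csp) ∧
    ∀ s, (Finset.univ.filter fun t => (t, s) ∈ B.blocks).card ≤ Csp

end BlockTree

/-! ### Cluster bases and H²-matrices -/

/-- `V` is a nested cluster basis of rank `k`. Only the rows of `V t` that belong to the label of
`t` are read, i.e. `V t` stands for a matrix with row index set `label t`. -/
def IsClusterBasis (T : ClusterTree ι N) {k : ℕ} (V : N → Matrix ι (Fin k) ℝ) : Prop :=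
  ∃ E : N → Matrix (Fin k) (Fin k) ℝ,
    ∀ t, ∀ u ∈ T.sons t, ∀ i ∈ T.label u, ∀ j, V t i j = (V u * E u) i j

/-- `Z` is an H²-matrix for the block tree `B` and the row and column cluster bases `V`, `W`. -/
def IsHTwoMatrix {TI : ClusterTree ι N} {TJ : ClusterTree κ M} (B : BlockTree TI TJ) {k : ℕ}
    (V : N → Matrix ι (Fin k) ℝ) (W : M → Matrix κ (Fin k) ℝ) (Z : Matrix ι κ ℝ) : Prop :=
  IsClusterBasis TI V ∧ IsClusterBasis TJ W ∧
    ∀ b ∈ B.admissible, ∃ S : Matrix (Fin k) (Fin k) ℝ,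
      ∀ i ∈ TI.label b.1, ∀ j ∈ TJ.label b.2, Z i j = (V b.1 * S * (W b.2)ᵀ) i j

/-- The row index set of the basis matrix stored for `t`: the label of `t` if `t` is a leaf, and
empty otherwise. -/
abbrev ClusterTree.LeafIdx (T : ClusterTree ι N) (t : N) : Type :=
  {i : ι // i ∈ T.label t ∧ T.sons t = ∅}

/-- The nested representation of a cluster basis: basis matrices for the leaf clusters and
transfer matrices for all clusters (the one of the root is never used). -/
structure BasisRep (T : ClusterTree ι N) (k : ℕ) where
  leaf : ∀ t : N, Matrix (T.LeafIdx t) (Fin k) ℝ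
  transfer : N → Matrix (Fin k) (Fin k) ℝ

/-- The basis matrices described by a nested representation, extended by zero rows outside of the
label of the cluster. -/
def BasisRep.basis {T : ClusterTree ι N} {k : ℕ} (V : BasisRep T k) (t : N) :
    Matrix ι (Fin k) ℝ :=
  Matrix.of (fun i j => if h : i ∈ T.label t ∧ T.sons t = ∅ then V.leaf t ⟨i, h⟩ j else 0) +
    ∑ u : T.sons t, V.basis u.1 * V.transfer u.1
termination_by (T.subtree t).card
decreasing_by exact T.card_subtree_lt u.2

/-- The H²-matrix representation: row and column cluster bases in nested representation, coupling
matrices (relevant for admissible leaves) and nearfield matrices (relevant for inadmissible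
leaves). -/
structure HTwoRep {TI : ClusterTree ι N} {TJ : ClusterTree κ M} (B : BlockTree TI TJ)
    (k : ℕ) where
  row : BasisRep TI k
  col : BasisRep TJ k
  coupling : N → M → Matrix (Fin k) (Fin k) ℝ
  near : ∀ t s, Matrix (TI.label t) (TJ.label s) ℝ

/-- `G` is a representation of the matrix `Z`. -/
def HTwoRep.Represents {TI : ClusterTree ι N} {TJ : ClusterTree κ M} {B : BlockTree TI TJ}
    {k : ℕ} (G : HTwoRep B k) (Z : Matrix ι κ ℝ) : Prop :=
  (∀ b ∈ B.admissible, ∀ i ∈ TI.label b.1, ∀ j ∈ TJ.label b.2,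
    Z i j = (G.row.basis b.1 * G.coupling b.1 b.2 * (G.col.basis b.2)ᵀ) i j) ∧
  ∀ b ∈ B.inadmissible, ∀ (i : TI.label b.1) (j : TJ.label b.2), Z i j = G.near b.1 b.2 i j

/-! ### Computations with a count of arithmetic operations -/

/-- A computation: its result together with the number of arithmetic operations. -/
structure Counted (α : Type) where
  val : α
  ops : ℕ

instance : Monad Counted where
  pure a := ⟨a, 0⟩
  bind x f := ⟨(f x.val).val, x.ops + (f x.val).ops⟩

/-- Carrying out a finite family of independent computations. -/
def Counted.forAll {A : Type} [Fintype A] {β : A → Type} (f : ∀ a, Counted (β a)) :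
    Counted (∀ a, β a) :=
  ⟨fun a => (f a).val, ∑ a, (f a).ops⟩

section Sweeps

variable (T : RootedTree N) (t₀ : N)

/-- The value of a recursion from the leaves to the root of a subtree. -/
def sweepUpVal {α : N → Type}
    (step : ∀ t, t ∈ T.subtree t₀ → (∀ u : T.sons t, α u.1) → Counted (α t))
    (t : N) (ht : t ∈ T.subtree t₀) : α t :=
  (step t ht fun u => sweepUpVal step u.1 (T.son_mem_subtree ht u.2)).val
termination_by (T.subtree t).card
decreasing_by exact T.card_subtree_lt u.2

/-- A recursion from the leaves to the root of the subtree with root `t₀`: each cluster is visited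
once, after its sons, and the results are kept. -/
def sweepUp {α : N → Type}
    (step : ∀ t, t ∈ T.subtree t₀ → (∀ u : T.sons t, α u.1) → Counted (α t)) :
    Counted (∀ t : T.subtree t₀, α t.1) :=
  ⟨fun t => sweepUpVal T t₀ step t.1 t.2,
    ∑ t : T.subtree t₀, (step t.1 t.2 fun u =>
      sweepUpVal T t₀ step u.1 (T.son_mem_subtree t.2 u.2)).ops⟩

/-- In a recursion from the root to the leaves of a subtree, the value that is handed to `t`: the
initial value if `t` is the root of the subtree, and the result of the father otherwise. -/
def sweepDownArg {α : Type} (init : α) (step : ∀ t, t ∈ T.subtree t₀ → α → Counted α)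
    (t : N) (ht : t ∈ T.subtree t₀) : α :=
  if h : t = t₀ then init
  else (step (T.father t) (T.father_mem_subtree ht h)
    (sweepDownArg init step (T.father t) (T.father_mem_subtree ht h))).val
termination_by T.level t
decreasing_by exact T.level_father_lt (T.ne_root_of_mem_subtree ht h)

/-- A recursion from the root to the leaves of the subtree with root `t₀`: each cluster is visited
once, after its father, and the results are kept. -/
def sweepDown {α : Type} (init : α) (step : ∀ t, t ∈ T.subtree t₀ → α → Counted α) :
    Counted (T.subtree t₀ → α) :=
  ⟨fun t => (step t.1 t.2 (sweepDownArg T t₀ init step t.1 t.2)).val,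
    ∑ t : T.subtree t₀, (step t.1 t.2 (sweepDownArg T t₀ init step t.1 t.2)).ops⟩

end Sweeps

/-- The product of an `m × n` and an `n × p` matrix, with `2 m n p` operations. -/
def Counted.mul {m n p : Type} [Fintype m] [Fintype n] [Fintype p]
    (A : Matrix m n ℝ) (C : Matrix n p ℝ) : Counted (Matrix m p ℝ) :=
  ⟨A * C, 2 * (Fintype.card m * Fintype.card n * Fintype.card p)⟩

/-- Adding the product of an `m × n` and an `n × p` matrix to a matrix, with `2 m n p`
operations. -/
def Counted.addMul {m n p : Type} [Fintype m] [Fintype n] [Fintype p]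
    (D : Matrix m p ℝ) (A : Matrix m n ℝ) (C : Matrix n p ℝ) : Counted (Matrix m p ℝ) :=
  ⟨D + A * C, 2 * (Fintype.card m * Fintype.card n * Fintype.card p)⟩

/-- The operations charged for a QR or a singular value decomposition of an `m × n` matrix. -/
def decompCost (c m n : ℕ) : ℕ := c * (m * n * min m n)

/-- The index set of matrices of doubled rank. -/
abbrev Dbl (k : ℕ) : Type := Fin k ⊕ Fin k

/-- The upper triangular factor `R` of the thin QR decomposition `A = P R` given by the
Gram-Schmidt process; a column of `P` is zero if the corresponding column of `A` depends linearly
on the preceding ones. -/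
def qrFactor {m : Type} [Fintype m] {n : ℕ} (A : Matrix m (Fin n) ℝ) :
    Matrix (Fin n) (Fin n) ℝ :=
  Matrix.of fun i j =>
    inner ℝ (InnerProductSpace.gramSchmidtNormed ℝ (fun l => WithLp.toLp 2 (A.col l)) i)
      (WithLp.toLp 2 (A.col j) : EuclideanSpace ℝ m)

/-- Computing the triangular factor of a QR decomposition. -/
def Counted.qr (cqr : ℕ) {m : Type} [Fintype m] {k : ℕ} (A : Matrix m (Dbl k) ℝ) :
    Counted (Matrix (Dbl k) (Dbl k) ℝ) :=
  ⟨(qrFactor (A.submatrix id finSumFinEquiv.symm)).submatrix finSumFinEquiv finSumFinEquiv,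
    decompCost cqr (Fintype.card m) (k + k)⟩

/-- The matrix of the left singular vectors of `A` that belong to the `r` largest singular values,
i.e. of the eigenvectors of `A Aᵀ` for the `r` largest eigenvalues (Mathlib lists the eigenvalues
in decreasing order). Zero singular values are dropped, and the matrix is filled up with zero
columns to have `k` columns. -/
def leftSingular (k r : ℕ) {m n : Type} [Fintype m] [DecidableEq m] [Fintype n]
    (A : Matrix m n ℝ) : Matrix m (Fin k) ℝ :=
  let hA := isHermitian_mul_conjTranspose_self A
  Matrix.of fun i j =>
    if h : j.1 < Fintype.card m then
      if j.1 < r ∧ hA.eigenvalues₀ ⟨j.1, h⟩ ≠ 0 then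
        hA.eigenvectorBasis (Fintype.equivOfCardEq (Fintype.card_fin _) ⟨j.1, h⟩) i
      else 0
    else 0

/-- Computing the leading left singular vectors by a singular value decomposition. -/
def Counted.svd (csvd k r : ℕ) {m n : Type} [Fintype m] [DecidableEq m] [Fintype n]
    (A : Matrix m n ℝ) : Counted (Matrix m (Fin k) ℝ) :=
  ⟨leftSingular k r A, decompCost csvd (Fintype.card m) (Fintype.card n)⟩

/-! ### The local update -/

/-- Stacking a family of matrices. -/
def stack {a m n : Type} (F : a → Matrix m n ℝ) : Matrix (a × m) n ℝ :=
  Matrix.of fun i j => F i.1 i.2 j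

/-- Extension of a matrix with row index set `s` by zero rows. -/
def zeroExtend {s : Finset ι} {n : Type} (X : Matrix s n ℝ) : Matrix ι n ℝ :=
  Matrix.of fun i j => if h : i ∈ s then X ⟨i, h⟩ j else 0

/-- Extension of a transfer or coupling matrix by the identity. -/
def extendOne {k : ℕ} (E : Matrix (Fin k) (Fin k) ℝ) : Matrix (Dbl k) (Dbl k) ℝ :=
  Matrix.fromBlocks E 0 0 1

/-- Extension of a weight matrix by zero. -/
def extendZero {k : ℕ} (R : Matrix (Fin k) (Fin k) ℝ) : Matrix (Dbl k) (Dbl k) ℝ :=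
  Matrix.fromBlocks R 0 0 0

section OneSided

variable (cqr csvd : ℕ) (T : ClusterTree ι N) {k : ℕ} (V : BasisRep T k) (t₀ : N)
  (X : Matrix (T.label t₀) (Fin k) ℝ)

/-- The leaf matrices of the extended basis `(V t | X)`. -/
def extendedLeaf (t : N) : Matrix (T.LeafIdx t) (Dbl k) ℝ :=
  Matrix.fromCols (V.leaf t) ((zeroExtend X).submatrix Subtype.val id)

/-- The triangular factors of thin QR decompositions of the matrices `(V t | X)` for all clusters
in the subtree with root `t₀`, by recursion. -/
def basisWeights : Counted (T.subtree t₀ → Matrix (Dbl k) (Dbl k) ℝ) :=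
  sweepUp T.toRootedTree t₀ (α := fun _ => Matrix (Dbl k) (Dbl k) ℝ) fun t _ R => do
    let P ← Counted.forAll fun u : T.sons t => Counted.mul (R u) (extendOne (V.transfer u.1))
    Counted.qr cqr (Matrix.fromRows (extendedLeaf T V t₀ X t) (stack P))

/-- The total weight matrices for all clusters in the subtree with root `t₀`. Here `adj t` holds
the clusters `s` with an admissible block `(t, s)`, `S t s` is its coupling matrix, `R s` is the
triangular factor for the extended basis matrix of `s`, and `init` is the (extended) total weight
matrix of the father of `t₀`. -/
def totalWeights (adj : N → Finset M) (S : N → M → Matrix (Fin k) (Fin k) ℝ)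
    (R : M → Matrix (Dbl k) (Dbl k) ℝ) (init : Matrix (Dbl k) (Dbl k) ℝ) :
    Counted (T.subtree t₀ → Matrix (Dbl k) (Dbl k) ℝ) :=
  sweepDown T.toRootedTree t₀ init fun t _ Bf => do
    let P ← Counted.forAll fun s : adj t => Counted.mul (R s.1) (extendOne (S t s.1))ᵀ
    let H ← Counted.mul Bf (extendOne (V.transfer t))ᵀ
    Counted.qr cqr (Matrix.fromRows (stack P) H)

/-- The row index set of the local matrix of `t`: the label of `t` if `t` is a leaf, otherwise `k`
rows for each son of `t`. -/
abbrev LocalRow (k : ℕ) (t : N) : Type := T.LeafIdx t ⊕ (T.sons t × Fin k)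

/-- The new orthogonal nested basis on the subtree with root `t₀`, for given total weight matrices
`Bw` and target ranks `rk`. For each cluster the result consists of the matrix of the local basis
(the basis matrix of a leaf, the stacked transfer matrices of the sons otherwise) and of the
matrix `(Q t)ᵀ (V t | X)` of the change of basis. -/
def newBasis (Bw : T.subtree t₀ → Matrix (Dbl k) (Dbl k) ℝ) (rk : N → ℕ) :
    Counted (∀ t : T.subtree t₀,
      Matrix (LocalRow T k t.1) (Fin k) ℝ × Matrix (Fin k) (Dbl k) ℝ) :=
  sweepUp T.toRootedTree t₀
    (α := fun t => Matrix (LocalRow T k t) (Fin k) ℝ × Matrix (Fin k) (Dbl k) ℝ)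
    fun t ht sub => do
      let P ← Counted.forAll fun u : T.sons t =>
        Counted.mul (sub u).2 (extendOne (V.transfer u.1))
      let Vhat := Matrix.fromRows (extendedLeaf T V t₀ X t) (stack P)
      let A ← Counted.mul Vhat (Bw ⟨t, ht⟩)ᵀ
      let Q ← Counted.svd csvd k (rk t) A
      let R ← Counted.mul Qᵀ Vhat
      pure (Q, R)

/-- The global basis in which the basis of the subtree with root `t₀` is replaced by the new one:
leaf matrices and transfer matrices inside of the subtree are the new ones, and only the transfer
matrix of `t₀` has to be recomputed. -/
def replaceBasis
    (Q : ∀ t : T.subtree t₀, Matrix (LocalRow T k t.1) (Fin k) ℝ × Matrix (Fin k) (Dbl k) ℝ) :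
    Counted (BasisRep T k) := do
  let E ← Counted.mul (Q ⟨t₀, T.self_mem_subtree t₀⟩).2
    (Matrix.fromRows (V.transfer t₀) (0 : Matrix (Fin k) (Fin k) ℝ))
  pure
    { leaf := fun t =>
        if h : t ∈ T.subtree t₀ then (Q ⟨t, h⟩).1.toRows₁ else V.leaf t
      transfer := fun t =>
        if h₀ : t = t₀ then E
        else if h : t ∈ T.subtree t₀ then
          Matrix.of fun a c => (Q ⟨T.father t, T.father_mem_subtree h h₀⟩).1
            (Sum.inr (⟨t, T.mem_sons_father h h₀⟩, a)) c
        else V.transfer t }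

end OneSided

/-- The weight matrices kept together with an H²-matrix: triangular factors of QR decompositions
of the basis matrices, and total weight matrices, for the row and the column clusters. -/
structure StoredWeights (N M : Type) (k : ℕ) where
  rowBasis : N → Matrix (Fin k) (Fin k) ℝ
  colBasis : M → Matrix (Fin k) (Fin k) ℝ
  rowTotal : N → Matrix (Fin k) (Fin k) ℝ
  colTotal : M → Matrix (Fin k) (Fin k) ℝ

/-- `R` is the total weight matrix for the basis matrix `V` of a cluster with label `rows`, where
`blocks` are the admissible blocks connected to the cluster or to one of its predecessors and
`cols b` is the column index set of `b`: with factorizations `Z|_b = V (F b)ᵀ` of these blocks,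
`R` is the triangular factor of a QR decomposition of the stacked matrix of all `F b`, up to an
orthogonal transformation, i.e. it has the same Gram matrix. -/
def IsTotalWeight {β : Type} {k : ℕ} (V : Matrix ι (Fin k) ℝ) (rows : Finset ι)
    (blocks : Finset β) (cols : β → Finset κ) (Z : Matrix ι κ ℝ)
    (R : Matrix (Fin k) (Fin k) ℝ) : Prop :=
  ∃ F : β → Matrix κ (Fin k) ℝ,
    (∀ b ∈ blocks, ∀ i ∈ rows, ∀ j ∈ cols b, Z i j = (V * (F b)ᵀ) i j) ∧
    ∀ a c, (Rᵀ * R) a c = ∑ b ∈ blocks, ∑ j ∈ cols b, F b j a * F b j c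

/-- The stored weights that an update of the block `(t₀, s₀)` uses, i.e. those of the clusters
outside of the two subtrees, belong to the matrix `Z` represented by `G`. -/
structure StoredWeights.Valid {TI : ClusterTree ι N} {TJ : ClusterTree κ M}
    {B : BlockTree TI TJ} {k : ℕ} (w : StoredWeights N M k) (G : HTwoRep B k)
    (Z : Matrix ι κ ℝ) (t₀ : N) (s₀ : M) : Prop where
  rowBasis : ∀ t, t ∉ TI.subtree t₀ →
    (w.rowBasis t)ᵀ * w.rowBasis t = (G.row.basis t)ᵀ * G.row.basis t
  colBasis : ∀ s, s ∉ TJ.subtree s₀ →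
    (w.colBasis s)ᵀ * w.colBasis s = (G.col.basis s)ᵀ * G.col.basis s
  rowTotal : t₀ ≠ TI.root →
    IsTotalWeight (G.row.basis (TI.father t₀)) (TI.label (TI.father t₀))
      (B.rowBlocks (TI.father t₀)) (fun b => TJ.label b.2) Z (w.rowTotal (TI.father t₀))
  colTotal : s₀ ≠ TJ.root →
    IsTotalWeight (G.col.basis (TJ.father s₀)) (TJ.label (TJ.father s₀))
      (B.colBlocks (TJ.father s₀)) (fun b => TI.label b.1) Zᵀ (w.colTotal (TJ.father s₀))

section Update

variable (cqr csvd : ℕ) {TI : ClusterTree ι N} {TJ : ClusterTree κ M} {B : BlockTree TI TJ}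
  {k : ℕ} (G : HTwoRep B k) (w : StoredWeights N M k) (t₀ : N) (s₀ : M)
  (X : Matrix (TI.label t₀) (Fin k) ℝ) (Y : Matrix (TJ.label s₀) (Fin k) ℝ)
  (rkI : N → ℕ) (rkJ : M → ℕ)

/-- The new coupling matrix of the block `(t, s)`, for given matrices `RI`, `RJ` of the change of
the row and the column basis. -/
def newCoupling (RI : TI.subtree t₀ → Matrix (Fin k) (Dbl k) ℝ)
    (RJ : TJ.subtree s₀ → Matrix (Fin k) (Dbl k) ℝ) (t : N) (s : M) :
    Counted (Matrix (Fin k) (Fin k) ℝ) :=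
  if (t, s) ∈ B.admissible then
    if ht : t ∈ TI.subtree t₀ then
      if hs : s ∈ TJ.subtree s₀ then do
        let P ← Counted.mul (RI ⟨t, ht⟩) (extendOne (G.coupling t s))
        Counted.mul P (RJ ⟨s, hs⟩)ᵀ
      else Counted.mul (RI ⟨t, ht⟩) (Matrix.fromRows (G.coupling t s) 0)
    else
      if hs : s ∈ TJ.subtree s₀ then
        Counted.mul (Matrix.fromCols (G.coupling t s) 0) (RJ ⟨s, hs⟩)ᵀ
      else pure (G.coupling t s)
  else pure (G.coupling t s)

/-- The new nearfield matrix of the block `(t, s)`. -/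
def newNear (t : N) (s : M) : Counted (Matrix (TI.label t) (TJ.label s) ℝ) :=
  if (t, s) ∈ B.inadmissible ∧ t ∈ TI.subtree t₀ ∧ s ∈ TJ.subtree s₀ then
    Counted.addMul (G.near t s) ((zeroExtend X).submatrix Subtype.val id)
      ((zeroExtend Y).submatrix Subtype.val id)ᵀ
  else pure (G.near t s)

/-- The local low-rank update: an H²-matrix representation for the same block tree and the same
rank that approximates the matrix represented by `G` with `X Yᵀ` added to the block
`(t₀, s₀)`. -/
def localUpdate : Counted (HTwoRep B k) := do
  let RV ← basisWeights cqr TI G.row t₀ X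
  let RW ← basisWeights cqr TJ G.col s₀ Y
  let BV ← totalWeights cqr TI G.row t₀ B.row G.coupling
    (fun s => if h : s ∈ TJ.subtree s₀ then RW ⟨s, h⟩ else extendZero (w.colBasis s))
    (if t₀ = TI.root then 0 else extendZero (w.rowTotal (TI.father t₀)))
  let BW ← totalWeights cqr TJ G.col s₀ B.col (fun s t => (G.coupling t s)ᵀ)
    (fun t => if h : t ∈ TI.subtree t₀ then RV ⟨t, h⟩ else extendZero (w.rowBasis t))
    (if s₀ = TJ.root then 0 else extendZero (w.colTotal (TJ.father s₀)))
  let QV ← newBasis csvd TI G.row t₀ X BV rkI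
  let QW ← newBasis csvd TJ G.col s₀ Y BW rkJ
  let V ← replaceBasis TI G.row t₀ QV
  let W ← replaceBasis TJ G.col s₀ QW
  let S ← Counted.forAll fun t : N => Counted.forAll fun s : M =>
    newCoupling G t₀ s₀ (fun t => (QV t).2) (fun s => (QW s).2) t s
  let F ← Counted.forAll fun t : N => Counted.forAll fun s : M => newNear G t₀ s₀ X Y t s
  pure { row := V, col := W, coupling := S, near := F }

end Update

/-- The columns of `Q` are orthonormal, up to columns that vanish. -/
def HasOrthonormalColumns {m : Type} [Fintype m] {k : ℕ} (Q : Matrix m (Fin k) ℝ) : Prop :=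
  ∃ r : Fin k → ℝ, (∀ j, r j = 0 ∨ r j = 1) ∧ Qᵀ * Q = Matrix.diagonal r

end HTwo

end

/-!
All basis matrices are extended by zero rows to the full index set, so that products of matrices of
different clusters make sense; `ind s` restricts to an index set `s`.

Let `V'_t` be the new basis of a cluster `t` in the subtree of `t₀` and `Π_t = V'_t V'_tᵀ`. Because
singular vectors for vanishing singular values are dropped, the columns of `V'_t` are orthonormal up
to vanishing columns, hence `Π_t` is an orthogonal projection, and the recursively computed matrices
satisfy `R_t = V'_tᵀ (V_t | X)` (`newRep_orthonormal_and_localR`). If `U_t` combines the new bases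
of the sons of `t` and `Q_t` is the matrix of singular vectors, then `V'_t = U_t Q_t`, and the
local errors `K_t = U_t (1 - Q_t Q_tᵀ) U_tᵀ` telescope: `ind t - Π_t` is the sum of `K_r` over all
descendants `r` of `t` (`totalError_eq_sub`). With `J_t` the sum of `K_r` over those descendants of
`t` that lie in the subtree of `t₀`, this means `V'_t R_t = (1 - J_t) (V_t | X)` in the subtree, and
correspondingly `V'_t = (1 - J_t) V_t` for the clusters outside of it, whose bases change only
through the transfer matrix of `t₀` (`newRep_basis_of_notMem`). Consequently, if `Z̃_b` is the
restriction of the exact sum `Z̃` to an admissible block `b = (t, s)`, the block of the result is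
`(1 - J_t) Z̃_b (1 - J_s)` (`updated_block`).

The blocks containing a given position form a chain in the block tree, so a leaf that meets the
updated block has both clusters in the subtrees. This gives the representation of the sum by the
extended bases (`ind_mul_add_lowRank`), the exactness of the nearfield, and the consistency of the
leafwise definition of the result (`BlockTree.exists_matrix`).

Since `J_t` and `J_s` are orthogonal projections, the squared error of a block is at most
`tr (J_t Z̃_b Z̃_bᵀ) + tr (J_s Z̃_bᵀ Z̃_b)`. Summation over all blocks and exchanging the sums leaves,
for every cluster `r` of the subtree, `tr (K_r G_r)`, where `G_r` is the sum of `Z̃ (ind s) Z̃ᵀ` over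
the blocks `(t, s)` connected to `r` or a predecessor (`exists_updated_matrix`). On the label of
`r`, and for valid stored weights, the matrix `G_r` equals `(V_r | X) B_rᵀ B_r (V_r | X)ᵀ` with the total weight `B_r`
(`totalWeights_gram_blocks`), so the Eckart-Young estimate
(`trace_sub_leftSingular_le`, proved by Ky Fan's argument for weighted sums of eigenvalues) bounds
`tr (K_r G_r)` by the error of any rank `rk r` approximation (`trace_localError_le`).

The operation count charges every cluster `O(k³)` per son and per admissible block and `O(k²)` per
index of a leaf. The number of sons in a subtree is less than the number of its clusters, the leaf
labels are disjoint, and sparsity bounds the number of blocks (`localUpdate_ops_le`).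
-/

noncomputable section

namespace HTwo

/-! ### Gram matrices of triangular factors -/

/-- The Gram-Schmidt process represents every column in terms of the orthonormal vectors, also if
the columns are linearly dependent. -/
theorem qrFactor_gram {m : Type} [Fintype m] {n : ℕ} (A : Matrix m (Fin n) ℝ) :
    (qrFactor A)ᵀ * qrFactor A = Aᵀ * A := by
  let a : Fin n → EuclideanSpace ℝ m := fun l => WithLp.toLp 2 (A.col l)
  let g := InnerProductSpace.gramSchmidtNormed ℝ a
  have horth : ∀ i l, i ≠ l → inner ℝ (g i) (g l) = 0 := by
    intro i l hil
    simp only [g, InnerProductSpace.gramSchmidtNormed, inner_smul_left, inner_smul_right,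
      InnerProductSpace.gramSchmidt_orthogonal ℝ a hil, mul_zero]
  have hself : ∀ i, inner ℝ (g i) (g i) • g i = g i := by
    intro i
    by_cases h : g i = 0
    · simp [h]
    · rw [real_inner_self_eq_norm_sq, InnerProductSpace.gramSchmidtNormed_unit_length' h]
      simp
  have hexp : ∀ x ∈ Submodule.span ℝ (Set.range g), ∑ i, inner ℝ (g i) x • g i = x := by
    intro x hx
    induction hx using Submodule.span_induction with
    | mem x hx =>
      obtain ⟨l, rfl⟩ := hx
      rw [Finset.sum_eq_single l, hself l]
      · intro i _ hil
        rw [horth i l hil, zero_smul]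
      · simp
    | zero => simp
    | add x y _ _ hx hy =>
      simp only [inner_add_right, add_smul, Finset.sum_add_distrib]
      rw [hx, hy]
    | smul c x _ hx =>
      simp only [inner_smul_right, mul_smul]
      rw [← Finset.smul_sum, hx]
  ext j l
  have hj : a j ∈ Submodule.span ℝ (Set.range g) := by
    rw [InnerProductSpace.span_gramSchmidtNormed_range, InnerProductSpace.span_gramSchmidt]
    exact Submodule.subset_span ⟨j, rfl⟩
  have h := congrArg (fun x => inner ℝ x (a l)) (hexp _ hj)
  simp only [sum_inner, inner_smul_left] at h
  have h2 : inner ℝ (a j) (a l) = (Aᵀ * A) j l := by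
    simp [a, EuclideanSpace.inner_eq_star_dotProduct, Matrix.mul_apply, dotProduct, mul_comm]
  rw [← h2, ← h]
  simp [Matrix.mul_apply, qrFactor, g, a]

theorem qr_val_gram (cqr : ℕ) {m : Type} [Fintype m] {k : ℕ} (A : Matrix m (Dbl k) ℝ) :
    (Counted.qr cqr A).valᵀ * (Counted.qr cqr A).val = Aᵀ * A := by
  simp only [Counted.qr, Matrix.transpose_submatrix]
  rw [Matrix.submatrix_mul_equiv, qrFactor_gram]
  ext i j
  simp [Matrix.mul_apply]

/-! ### Best approximation by leading singular vectors -/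

section Singular

variable {m n : Type} [Fintype m] [DecidableEq m] [Fintype n]

/-- The orthonormal basis of the eigenvectors of `A Aᵀ`, in decreasing order of eigenvalues. -/
def singularBasis (A : Matrix m n ℝ) :
    OrthonormalBasis (Fin (Fintype.card m)) ℝ (EuclideanSpace ℝ m) :=
  (isHermitian_mul_conjTranspose_self A).eigenvectorBasis.reindex
    (Fintype.equivOfCardEq (Fintype.card_fin _)).symm

/-- The squares of the singular values of `A` in decreasing order. -/
def singularSq (A : Matrix m n ℝ) : Fin (Fintype.card m) → ℝ :=
  (isHermitian_mul_conjTranspose_self A).eigenvalues₀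

theorem leftSingular_apply (k r : ℕ) (A : Matrix m n ℝ) (i : m) (j : Fin k) :
    leftSingular k r A i j = if h : j.1 < Fintype.card m then
      if j.1 < r ∧ singularSq A ⟨j.1, h⟩ ≠ 0 then singularBasis A ⟨j.1, h⟩ i else 0 else 0 := by
  simp [leftSingular, singularBasis, singularSq]

theorem singularSq_antitone (A : Matrix m n ℝ) : Antitone (singularSq A) :=
  Matrix.IsHermitian.eigenvalues₀_antitone _

theorem mulVec_singularBasis (A : Matrix m n ℝ) (i : Fin (Fintype.card m)) :
    (A * Aᵀ) *ᵥ ⇑(singularBasis A i) = singularSq A i • ⇑(singularBasis A i) := by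
  have h := (isHermitian_mul_conjTranspose_self A).mulVec_eigenvectorBasis
    (Fintype.equivOfCardEq (Fintype.card_fin _) i)
  simpa [singularBasis, singularSq, Matrix.IsHermitian.eigenvalues] using h

theorem singularSq_nonneg (A : Matrix m n ℝ) (i : Fin (Fintype.card m)) :
    0 ≤ singularSq A i := by
  have h := (Matrix.posSemidef_self_mul_conjTranspose A).eigenvalues_nonneg
    (Fintype.equivOfCardEq (Fintype.card_fin _) i)
  simpa [singularSq, Matrix.IsHermitian.eigenvalues] using h

/-- The quadratic form of `A Aᵀ` in terms of its spectral decomposition. -/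
theorem dotProduct_gram_mulVec (A : Matrix m n ℝ) (x : EuclideanSpace ℝ m) :
    (⇑x) ⬝ᵥ ((A * Aᵀ) *ᵥ ⇑x) = ∑ i, singularSq A i * inner ℝ (singularBasis A i) x ^ 2 := by
  have h := (singularBasis A).sum_inner_mul_inner x (WithLp.toLp 2 ((A * Aᵀ) *ᵥ ⇑x))
  have h1 : inner ℝ x (WithLp.toLp 2 ((A * Aᵀ) *ᵥ ⇑x)) = (⇑x) ⬝ᵥ ((A * Aᵀ) *ᵥ ⇑x) := by
    rw [EuclideanSpace.inner_eq_star_dotProduct, dotProduct_comm]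
    simp
  rw [← h1, ← h]
  refine Finset.sum_congr rfl fun i _ => ?_
  have h2 : inner ℝ (singularBasis A i) (WithLp.toLp 2 ((A * Aᵀ) *ᵥ ⇑x)) =
      singularSq A i * inner ℝ (singularBasis A i) x := by
    simp only [EuclideanSpace.inner_eq_star_dotProduct, star_trivial]
    rw [dotProduct_comm, Matrix.dotProduct_mulVec, ← Matrix.mulVec_transpose,
      Matrix.transpose_mul, Matrix.transpose_transpose, mulVec_singularBasis, smul_dotProduct,
      dotProduct_comm, smul_eq_mul]
  rw [h2, real_inner_comm x]
  ring

theorem leftSingular_gram (k r : ℕ) (A : Matrix m n ℝ) :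
    ∃ d : Fin k → ℝ, (∀ j, d j = 0 ∨ d j = 1) ∧
      (leftSingular k r A)ᵀ * leftSingular k r A = Matrix.diagonal d := by
  classical
  refine ⟨fun j => if h : j.1 < Fintype.card m then
      if j.1 < r ∧ singularSq A ⟨j.1, h⟩ ≠ 0 then 1 else 0 else 0, fun j => ?_, ?_⟩
  · dsimp only
    split_ifs <;> simp
  · ext a b
    rw [Matrix.mul_apply]
    simp only [Matrix.transpose_apply, leftSingular_apply]
    have hin : ∀ i j, ∑ x, singularBasis A i x * singularBasis A j x = if i = j then 1 else 0 := by
      intro i j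
      rw [← orthonormal_iff_ite.1 (singularBasis A).orthonormal i j]
      simp [EuclideanSpace.inner_eq_star_dotProduct, dotProduct, mul_comm]
    by_cases hab : a = b
    · subst hab
      rw [Matrix.diagonal_apply_eq]
      split_ifs with h1 h2
      · rw [hin, if_pos rfl]
      · simp
      · simp
    · rw [Matrix.diagonal_apply_ne _ hab]
      split_ifs with h1 h2 h3 h4 <;> try simp
      rw [hin, if_neg]
      intro h
      exact hab (Fin.ext (Fin.mk.inj_iff.1 h))

/-- Left singular vectors for nonzero singular values lie in the range of the matrix. -/
theorem mul_leftSingular_of_mul_eq (k r : ℕ) (A : Matrix m n ℝ) {D : Matrix m m ℝ}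
    (hD : D * A = A) : D * leftSingular k r A = leftSingular k r A := by
  ext i j
  have hcol : (D * leftSingular k r A) i j = (D *ᵥ fun x => leftSingular k r A x j) i := rfl
  rw [hcol]
  simp only [leftSingular_apply]
  split_ifs with h1 h2
  · have h3 : D *ᵥ ⇑(singularBasis A ⟨j.1, h1⟩) = ⇑(singularBasis A ⟨j.1, h1⟩) := by
      have h4 := mulVec_singularBasis A ⟨j.1, h1⟩
      have h5 : D *ᵥ ((A * Aᵀ) *ᵥ ⇑(singularBasis A ⟨j.1, h1⟩)) =
          (A * Aᵀ) *ᵥ ⇑(singularBasis A ⟨j.1, h1⟩) := by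
        rw [Matrix.mulVec_mulVec, ← Matrix.mul_assoc, hD]
      rw [h4, Matrix.mulVec_smul] at h5
      exact smul_right_injective _ h2.2 h5
    exact congrFun h3 i
  · simp [Matrix.mulVec, dotProduct]
  · simp [Matrix.mulVec, dotProduct]

/-- The trace captured by the leading `r` left singular vectors is the sum of the `r` largest
squared singular values. -/
theorem trace_leftSingular {k r : ℕ} (hr : r ≤ k) (A : Matrix m n ℝ) :
    (leftSingular k r A * (leftSingular k r A)ᵀ * (A * Aᵀ)).trace =
      ∑ i, if i.1 < r then singularSq A i else 0 := by
  rw [Matrix.mul_assoc, Matrix.trace_mul_comm, Matrix.trace]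
  have hdiag : ∀ j : Fin k,
      ((leftSingular k r A)ᵀ * (A * Aᵀ) * leftSingular k r A) j j =
        if h : j.1 < Fintype.card m then
          if j.1 < r then singularSq A ⟨j.1, h⟩ else 0 else 0 := by
    intro j
    have h0 : ((leftSingular k r A)ᵀ * (A * Aᵀ) * leftSingular k r A) j j =
        (fun x => leftSingular k r A x j) ⬝ᵥ ((A * Aᵀ) *ᵥ fun x => leftSingular k r A x j) := by
      rw [Matrix.mul_assoc]; rfl
    rw [h0]
    simp only [leftSingular_apply]
    split_ifs with h1 h2 h3 h4
    · rw [mulVec_singularBasis, dotProduct_smul]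
      have := orthonormal_iff_ite.1 (singularBasis A).orthonormal ⟨j.1, h1⟩ ⟨j.1, h1⟩
      rw [EuclideanSpace.inner_eq_star_dotProduct, if_pos rfl] at this
      simp only [star_trivial] at this
      rw [this]; simp
    · exact absurd h2.1 h3
    · have : singularSq A ⟨j.1, h1⟩ = 0 := by
        by_contra h
        exact h2 ⟨h4, h⟩
      simp [dotProduct, this]
    · simp [dotProduct]
    · simp [dotProduct]
  simp only [Matrix.diag_apply, hdiag]
  let f : ℕ → ℝ := fun j => if h : j < Fintype.card m then
    if j < r then singularSq A ⟨j, h⟩ else 0 else 0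
  have h1 : ∀ i : Fin (Fintype.card m), (if i.1 < r then singularSq A i else 0) = f i.1 := by
    intro i; simp [f]
  simp only [h1]
  rw [Fin.sum_univ_eq_sum_range f k, Fin.sum_univ_eq_sum_range f (Fintype.card m)]
  have h2 : ∀ N, ∑ i ∈ Finset.range N, f i =
      ∑ i ∈ Finset.range N with i < Fintype.card m ∧ i < r, f i := by
    intro N
    rw [Finset.sum_filter]
    refine Finset.sum_congr rfl fun i _ => ?_
    split_ifs with h
    · rfl
    · simp only [f]
      split_ifs <;> tauto
  rw [h2 k, h2 (Fintype.card m)]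
  refine Finset.sum_congr ?_ fun _ _ => rfl
  ext i
  simp only [Finset.mem_filter, Finset.mem_range]
  omega

/-- A weighted sum of decreasing numbers with weights at most one and total weight at most `r` is
at most the sum of the first `r` numbers. -/
theorem sum_mul_le_sum_first {p r : ℕ} {l w : Fin p → ℝ} (hl : Antitone l) (hl0 : ∀ i, 0 ≤ l i)
    (hw0 : ∀ i, 0 ≤ w i) (hw1 : ∀ i, w i ≤ 1) (hw : ∑ i, w i ≤ r) :
    ∑ i, l i * w i ≤ ∑ i, if i.1 < r then l i else 0 := by
  by_cases hr : r < p
  · -- Compare with the threshold `l r`: each `(l i - l r) * (w i - [i < r])` is nonpositive.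
    let c := l ⟨r, hr⟩
    have hc : 0 ≤ c := hl0 _
    have h1 : ∀ i, (l i - c) * (w i - if i.1 < r then 1 else 0) ≤ 0 := by
      intro i
      split_ifs with h
      · exact mul_nonpos_of_nonneg_of_nonpos (sub_nonneg.2 (hl (Fin.le_def.2 h.le)))
          (sub_nonpos.2 (hw1 i))
      · refine mul_nonpos_of_nonpos_of_nonneg (sub_nonpos.2 (hl (Fin.le_def.2 (not_lt.1 h)))) ?_
        simpa using hw0 i
    have h2 : ∑ i : Fin p, (if i.1 < r then (1 : ℝ) else 0) = r := by
      rw [Fin.sum_univ_eq_sum_range (fun i => if i < r then (1 : ℝ) else 0), ← Finset.sum_filter]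
      have : (Finset.range p).filter (· < r) = Finset.range r := by
        ext i; simp only [Finset.mem_filter, Finset.mem_range]; omega
      simp [this]
    have h3 : ∑ i, (l i - c) * (w i - if i.1 < r then 1 else 0) ≤ 0 :=
      Finset.sum_nonpos fun i _ => h1 i
    have h4 : ∑ i, (l i - c) * (w i - if i.1 < r then 1 else 0) =
        ∑ i, l i * w i - (∑ i, if i.1 < r then l i else 0) - c * (∑ i, w i - r) := by
      rw [← h2, ← Finset.sum_sub_distrib, ← Finset.sum_sub_distrib (f := w), Finset.mul_sum,
        ← Finset.sum_sub_distrib]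
      refine Finset.sum_congr rfl fun i _ => ?_
      split_ifs <;> ring
    have h5 : c * (∑ i, w i - r) ≤ 0 := mul_nonpos_of_nonneg_of_nonpos hc (sub_nonpos.2 hw)
    linarith
  · refine Finset.sum_le_sum fun i _ => ?_
    rw [if_pos (lt_of_lt_of_le i.2 (not_lt.1 hr))]
    exact mul_le_of_le_one_right (hl0 i) (hw1 i)

/-- The Eckart-Young estimate: no matrix of rank at most `r` approximates `A'` better than the
projection to the leading `r` left singular vectors of `A`, if `A` and `A'` have the same left Gram
matrix. -/
theorem trace_sub_leftSingular_le {n' : Type} [Fintype n'] {k r : ℕ} (hr : r ≤ k)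
    (A : Matrix m n ℝ) (A' P : Matrix m n' ℝ) (hA : A' * A'ᵀ = A * Aᵀ) (hP : P.rank ≤ r) :
    ((1 - leftSingular k r A * (leftSingular k r A)ᵀ) * (A * Aᵀ)).trace ≤
      ∑ i, ∑ j, (A' i j - P i j) ^ 2 := by
  classical
  rw [Matrix.sub_mul, Matrix.one_mul, Matrix.trace_sub, trace_leftSingular hr]
  let a : n' → EuclideanSpace ℝ m := fun j => WithLp.toLp 2 (A'.col j)
  let p : n' → EuclideanSpace ℝ m := fun j => WithLp.toLp 2 (P.col j)
  -- Replace `P` by the orthogonal projection of `A'` to the column space `S` of `P`.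
  let S : Submodule ℝ (EuclideanSpace ℝ m) := Submodule.span ℝ (Set.range p)
  have hS : Module.finrank ℝ S ≤ r := by
    refine le_trans (le_of_eq ?_) hP
    rw [Matrix.rank_eq_finrank_span_cols]
    let e := (WithLp.linearEquiv 2 ℝ (m → ℝ)).symm
    have : S = (Submodule.span ℝ (Set.range P.col)).map e.toLinearMap := by
      rw [Submodule.map_span, ← Set.range_comp]
      rfl
    rw [this]
    exact LinearEquiv.finrank_map_eq e _
  let o := stdOrthonormalBasis ℝ S
  have ho : Orthonormal ℝ fun l => (o l : EuclideanSpace ℝ m) :=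
    o.orthonormal.comp_linearIsometry S.subtypeₗᵢ
  have hexp : ∀ j, p j = ∑ l, inner ℝ (o l : EuclideanSpace ℝ m) (p j) •
      (o l : EuclideanSpace ℝ m) := by
    intro j
    have h := congrArg Subtype.val
      (o.sum_repr' ⟨p j, Submodule.subset_span ⟨j, rfl⟩⟩)
    simpa using h.symm
  have hip : ∀ j x, inner ℝ x (p j) = ∑ l, inner ℝ (o l : EuclideanSpace ℝ m) (p j) *
      inner ℝ (o l : EuclideanSpace ℝ m) x := by
    intro j x
    conv_lhs => rw [hexp j]
    simp only [inner_sum, inner_smul_right, real_inner_comm x]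
  have hdist : ∀ j, ‖a j‖ ^ 2 - ∑ l, inner ℝ (o l : EuclideanSpace ℝ m) (a j) ^ 2 ≤
      ‖a j - p j‖ ^ 2 := by
    intro j
    have h : 0 ≤ ∑ l, (inner ℝ (o l : EuclideanSpace ℝ m) (a j) -
        inner ℝ (o l : EuclideanSpace ℝ m) (p j)) ^ 2 :=
      Finset.sum_nonneg fun _ _ => sq_nonneg _
    have h2 : ∑ l, (inner ℝ (o l : EuclideanSpace ℝ m) (a j) -
        inner ℝ (o l : EuclideanSpace ℝ m) (p j)) ^ 2 =
        ∑ l, inner ℝ (o l : EuclideanSpace ℝ m) (a j) ^ 2 - 2 * inner ℝ (a j) (p j) +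
          ‖p j‖ ^ 2 := by
      rw [← real_inner_self_eq_norm_sq, hip j (a j), hip j (p j), Finset.mul_sum,
        ← Finset.sum_sub_distrib, ← Finset.sum_add_distrib]
      exact Finset.sum_congr rfl fun l _ => by ring
    rw [norm_sub_sq_real]
    linarith
  have hsq : ∑ i, ∑ j, (A' i j - P i j) ^ 2 = ∑ j, ‖a j - p j‖ ^ 2 := by
    rw [Finset.sum_comm]
    refine Finset.sum_congr rfl fun j _ => ?_
    rw [EuclideanSpace.real_norm_sq_eq]
    rfl
  have htr : ∑ j, ‖a j‖ ^ 2 = (A * Aᵀ).trace := by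
    rw [← hA, Matrix.trace, Finset.sum_congr rfl fun j _ => EuclideanSpace.real_norm_sq_eq (a j),
      Finset.sum_comm]
    refine Finset.sum_congr rfl fun i _ => ?_
    simp [a, Matrix.mul_apply, sq]
  have hquad : ∀ x : EuclideanSpace ℝ m, ∑ j, inner ℝ x (a j) ^ 2 =
      ∑ i, singularSq A i * inner ℝ (singularBasis A i) x ^ 2 := by
    intro x
    rw [← dotProduct_gram_mulVec, ← hA, ← Matrix.mulVec_mulVec, Matrix.dotProduct_mulVec,
      ← Matrix.mulVec_transpose, dotProduct]
    refine Finset.sum_congr rfl fun j _ => ?_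
    simp [a, EuclideanSpace.inner_eq_star_dotProduct, Matrix.mulVec, dotProduct, sq]
  -- The weights of the eigenvalues are the squared norms of the projections of the eigenvectors
  -- to `S`; they are at most one and sum up to the dimension of `S`.
  have hw0 : ∀ i, 0 ≤ ∑ l, inner ℝ (o l : EuclideanSpace ℝ m) (singularBasis A i) ^ 2 :=
    fun i => Finset.sum_nonneg fun _ _ => sq_nonneg _
  have hw1 : ∀ i, ∑ l, inner ℝ (o l : EuclideanSpace ℝ m) (singularBasis A i) ^ 2 ≤ 1 := by
    intro i
    have h := ho.sum_inner_products_le (singularBasis A i) (s := Finset.univ)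
    simpa using h
  have hw : ∑ i, ∑ l, inner ℝ (o l : EuclideanSpace ℝ m) (singularBasis A i) ^ 2 ≤ r := by
    rw [Finset.sum_comm]
    have h : ∀ l, ∑ i, inner ℝ (o l : EuclideanSpace ℝ m) (singularBasis A i) ^ 2 = 1 := by
      intro l
      have h := (singularBasis A).sum_sq_norm_inner_left (o l : EuclideanSpace ℝ m)
      rw [ho.1 l] at h
      simpa using h
    simp only [h]
    simpa using hS
  have hky := sum_mul_le_sum_first (singularSq_antitone A) (singularSq_nonneg A) hw0 hw1 hw
  have hcap : ∑ j, ∑ l, inner ℝ (o l : EuclideanSpace ℝ m) (a j) ^ 2 =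
      ∑ i, singularSq A i * ∑ l, inner ℝ (o l : EuclideanSpace ℝ m) (singularBasis A i) ^ 2 := by
    rw [Finset.sum_comm]
    simp only [hquad, Finset.mul_sum]
    rw [Finset.sum_comm]
    simp only [real_inner_comm]
  have hfin := Finset.sum_le_sum fun j (_ : j ∈ Finset.univ) => hdist j
  rw [Finset.sum_sub_distrib, htr, hcap, ← hsq] at hfin
  linarith

end Singular

/-! ### Subtrees and labels -/

namespace RootedTree

variable {N : Type} [Fintype N] [DecidableEq N] (T : RootedTree N)

theorem sons_induction {p : N → Prop} (h : ∀ t, (∀ u ∈ T.sons t, p u) → p t) (t : N) : p t := by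
  suffices H : ∀ n t, (T.subtree t).card = n → p t from H _ t rfl
  intro n
  induction n using Nat.strong_induction_on with
  | _ n ih =>
    intro t ht
    exact h t fun u hu => ih _ (ht ▸ T.card_subtree_lt hu) u rfl

theorem subtree_induction {t₀ : N} {p : N → Prop} (h₀ : p t₀)
    (h : ∀ t ∈ T.subtree t₀, t ≠ t₀ → p (T.father t) → p t) {t : N} (ht : t ∈ T.subtree t₀) :
    p t := by
  obtain ⟨n, hn⟩ := T.mem_subtree.1 ht
  induction n generalizing t with
  | zero => exact (show t = t₀ from hn) ▸ h₀
  | succ n ih =>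
    by_cases htt : t = t₀
    · exact htt ▸ h₀
    · exact h t ht htt (ih (T.father_mem_subtree ht htt) (by rw [← hn, Function.iterate_succ_apply]))

theorem mem_subtree_trans {a b c : N} (hab : a ∈ T.subtree b) (hbc : b ∈ T.subtree c) :
    a ∈ T.subtree c := by
  obtain ⟨n, hn⟩ := T.mem_subtree.1 hab
  obtain ⟨m, hm⟩ := T.mem_subtree.1 hbc
  exact T.mem_subtree.2 ⟨m + n, by rw [Function.iterate_add_apply, hn, hm]⟩

theorem level_le_of_mem_subtree {a b : N} (h : a ∈ T.subtree b) : T.level b ≤ T.level a := by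
  obtain ⟨n, hn⟩ := T.mem_subtree.1 h
  exact hn ▸ T.level_iterate_le n a

theorem level_lt_of_mem_sons {t u : N} (hu : u ∈ T.sons t) : T.level t < T.level u := by
  obtain ⟨hr, hf⟩ := T.mem_sons.1 hu
  exact hf ▸ T.level_father_lt hr

theorem mem_subtree_of_mem_sons {t u : N} (hu : u ∈ T.sons t) : u ∈ T.subtree t :=
  T.son_mem_subtree (T.self_mem_subtree t) hu

theorem ne_of_mem_sons {t₀ t u : N} (ht : t ∈ T.subtree t₀) (hu : u ∈ T.sons t) : u ≠ t₀ := by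
  rintro rfl
  exact absurd (T.level_le_of_mem_subtree ht) (not_le.2 (T.level_lt_of_mem_sons hu))

/-- A son of a cluster outside of a subtree lies in the subtree only if it is its root. -/
theorem eq_of_mem_sons {t₀ t u : N} (ht : t ∉ T.subtree t₀) (hu : u ∈ T.sons t)
    (h : u ∈ T.subtree t₀) : u = t₀ := by
  by_contra hne
  exact ht ((T.mem_sons.1 hu).2 ▸ T.father_mem_subtree h hne)

theorem subtree_eq (t : N) : T.subtree t = insert t ((T.sons t).biUnion T.subtree) := by
  ext r
  simp only [Finset.mem_insert, Finset.mem_biUnion]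
  constructor
  · intro h
    refine T.subtree_induction (p := fun r => r = t ∨ ∃ u ∈ T.sons t, r ∈ T.subtree u)
      (Or.inl rfl) ?_ h
    rintro r hr hrt (h | ⟨u, hu, h⟩)
    · exact Or.inr ⟨r, h ▸ T.mem_sons_father hr hrt, T.self_mem_subtree r⟩
    · exact Or.inr ⟨u, hu, T.mem_subtree_trans
        (T.mem_subtree_of_mem_sons (T.mem_sons_father hr hrt)) h⟩
  · rintro (rfl | ⟨u, hu, h⟩)
    · exact T.self_mem_subtree r
    · exact T.mem_subtree_trans h (T.mem_subtree_of_mem_sons hu)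

/-- A subtree is the disjoint union of its root and of the subtrees of the sons. -/
theorem sum_subtree {α : Type} [AddCommMonoid α] (f : N → α) (t : N) :
    ∑ r ∈ T.subtree t, f r = f t + ∑ u ∈ T.sons t, ∑ r ∈ T.subtree u, f r := by
  rw [T.subtree_eq, Finset.sum_insert, Finset.sum_biUnion]
  · intro u hu v hv huv
    rw [Function.onFun, Finset.disjoint_left]
    intro r hru hrv
    have key : ∀ {u v : N} (n m : ℕ), u ∈ T.sons t → v ∈ T.sons t → u ≠ v → n ≤ m →
        T.father^[n] r = u → T.father^[m] r = v → False := by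
      intro u v n m hu hv huv hnm hn hm
      obtain ⟨d, rfl⟩ := Nat.exists_eq_add_of_le hnm
      rw [add_comm, Function.iterate_add_apply, hn] at hm
      cases d with
      | zero => exact huv hm
      | succ d =>
        rw [Function.iterate_succ_apply, (T.mem_sons.1 hu).2] at hm
        have h1 := T.level_iterate_le d t
        rw [hm] at h1
        exact absurd h1 (not_le.2 (T.level_lt_of_mem_sons hv))
    obtain ⟨n, hn⟩ := T.mem_subtree.1 hru
    obtain ⟨m, hm⟩ := T.mem_subtree.1 hrv
    rcases le_total n m with h | h
    · exact key n m hu hv huv h hn hm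
    · exact key m n hv hu huv.symm h hm hn
  · simp only [Finset.mem_biUnion, not_exists, not_and]
    intro u hu h
    exact absurd (T.level_le_of_mem_subtree h) (not_le.2 (T.level_lt_of_mem_sons hu))

theorem sum_card_sons (t : N) : ∑ r ∈ T.subtree t, (T.sons r).card + 1 = (T.subtree t).card := by
  induction t using T.sons_induction with
  | h t ih =>
    rw [T.sum_subtree, Finset.card_eq_sum_ones (T.subtree t), T.sum_subtree (fun _ => 1),
      add_comm _ 1, add_right_inj, Finset.card_eq_sum_ones, ← Finset.sum_add_distrib]
    refine Finset.sum_congr rfl fun u hu => ?_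
    rw [add_comm, ih u hu, Finset.card_eq_sum_ones]

theorem mem_subtree_iff_father {t u : N} (ht : t ≠ T.root) :
    t ∈ T.subtree u ↔ t = u ∨ T.father t ∈ T.subtree u := by
  constructor
  · intro h
    by_cases htu : t = u
    · exact Or.inl htu
    · exact Or.inr (T.father_mem_subtree h htu)
  · rintro (rfl | h)
    · exact T.self_mem_subtree t
    · exact T.mem_subtree_trans (T.mem_subtree_of_mem_sons (T.mem_sons.2 ⟨ht, rfl⟩)) h

theorem father_notMem_subtree {t : N} (ht : t ≠ T.root) : T.father t ∉ T.subtree t := fun h =>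
  absurd (T.level_le_of_mem_subtree h) (not_le.2 (T.level_father_lt ht))

theorem root_mem_subtree {u : N} : T.root ∈ T.subtree u ↔ u = T.root := by
  rw [mem_subtree]
  simp only [iterate_root, exists_const]
  exact eq_comm

end RootedTree

variable {ι κ N M : Type} [Fintype ι] [DecidableEq ι] [Fintype κ] [DecidableEq κ]
  [Fintype N] [DecidableEq N] [Fintype M] [DecidableEq M]

namespace ClusterTree

variable (T : ClusterTree ι N)

theorem label_son_subset {t u : N} (hu : u ∈ T.sons t) : T.label u ⊆ T.label t := by
  rw [T.label_eq t ⟨u, hu⟩]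
  exact Finset.subset_biUnion_of_mem T.label hu

theorem label_subset {t r : N} (h : r ∈ T.subtree t) : T.label r ⊆ T.label t := by
  refine T.subtree_induction (p := fun r => T.label r ⊆ T.label t) (Finset.Subset.refl _) ?_ h
  exact fun r hr hrt ih => (T.label_son_subset (T.mem_sons_father hr hrt)).trans ih

/-- The labels of the leaves of a subtree are disjoint. -/
theorem sum_card_leafIdx_le (t : N) :
    ∑ r ∈ T.subtree t, Fintype.card (T.LeafIdx r) ≤ (T.label t).card := by
  induction t using T.sons_induction with
  | h t ih =>
    rw [T.sum_subtree]
    by_cases hs : T.sons t = ∅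
    · have h0 : ∑ u ∈ T.sons t, ∑ r ∈ T.subtree u, Fintype.card (T.LeafIdx r) = 0 :=
        Finset.sum_eq_zero fun u hu => absurd hu (by simp [hs])
      rw [h0, add_zero, Fintype.card_subtype]
      exact Finset.card_le_card fun i hi => (Finset.mem_filter.1 hi).2.1
    · have h0 : Fintype.card (T.LeafIdx t) = 0 := by
        rw [Fintype.card_eq_zero_iff]
        exact ⟨fun i => hs i.2.2⟩
      rw [h0, zero_add, T.label_eq t (Finset.nonempty_iff_ne_empty.2 hs),
        Finset.card_biUnion fun u hu v hv huv => T.label_disjoint t u hu v hv huv]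
      exact Finset.sum_le_sum ih

end ClusterTree

/-! ### Leaves of the block tree -/

section Blocks

variable {TI : ClusterTree ι N} {TJ : ClusterTree κ M}

theorem splitBlock_cases {b c : N × M} (h : c ∈ splitBlock TI TJ b) :
    (c.1 = b.1 ∧ TI.sons b.1 = ∅ ∧ c.2 ∈ TJ.sons b.2) ∨
    (c.1 ∈ TI.sons b.1 ∧ c.2 = b.2 ∧ TJ.sons b.2 = ∅) ∨
    (c.1 ∈ TI.sons b.1 ∧ c.2 ∈ TJ.sons b.2) := by
  unfold splitBlock at h
  split_ifs at h with h1 h2 <;> simp only [Finset.mem_product, Finset.mem_singleton] at h <;> tauto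

namespace BlockTree

variable (B : BlockTree TI TJ)

/-- `c` is a son of the block `p` that contains the position `(i, j)`. -/
def StepAt (i : ι) (j : κ) (p c : N × M) : Prop :=
  p ∈ B.blocks ∧ c ∈ B.sons p ∧ i ∈ TI.label c.1 ∧ j ∈ TJ.label c.2

theorem StepAt.mem_splitBlock {B : BlockTree TI TJ} {i : ι} {j : κ} {p c : N × M}
    (h : B.StepAt i j p c) : c ∈ splitBlock TI TJ p :=
  B.sons_eq p h.1 ⟨c, h.2.1⟩ ▸ h.2.1

theorem stepAt_rightUnique (i : ι) (j : κ) : Relator.RightUnique (B.StepAt i j) := by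
  intro p c d hc hd
  have h1 : ∀ t, ∀ u ∈ TI.sons t, ∀ v ∈ TI.sons t, i ∈ TI.label u → i ∈ TI.label v → u = v := by
    intro t u hu v hv hiu hiv
    by_contra huv
    exact Finset.disjoint_left.1 (TI.label_disjoint t u hu v hv huv) hiu hiv
  have h2 : ∀ t, ∀ u ∈ TJ.sons t, ∀ v ∈ TJ.sons t, j ∈ TJ.label u → j ∈ TJ.label v → u = v := by
    intro t u hu v hv hiu hiv
    by_contra huv
    exact Finset.disjoint_left.1 (TJ.label_disjoint t u hu v hv huv) hiu hiv
  have n1 : ∀ {t u}, u ∈ TI.sons t → TI.sons t ≠ ∅ := fun h => Finset.ne_empty_of_mem h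
  have n2 : ∀ {t u}, u ∈ TJ.sons t → TJ.sons t ≠ ∅ := fun h => Finset.ne_empty_of_mem h
  obtain ⟨-, -, hci, hcj⟩ := id hc
  obtain ⟨-, -, hdi, hdj⟩ := id hd
  rcases splitBlock_cases hc.mem_splitBlock with ⟨a, b, c'⟩ | ⟨a, b, c'⟩ | ⟨a, b⟩ <;>
  rcases splitBlock_cases hd.mem_splitBlock with ⟨a', b', c''⟩ | ⟨a', b', c''⟩ | ⟨a', b'⟩ <;>
  first
  | exact absurd ‹TI.sons p.1 = ∅› (n1 ‹_›)
  | exact absurd ‹TJ.sons p.2 = ∅› (n2 ‹_›)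
  | exact Prod.ext (a.trans a'.symm) (h2 _ _ c' _ c'' hcj hdj)
  | exact Prod.ext (h1 _ _ a _ a' hci hdi) (b.trans b'.symm)
  | exact Prod.ext (h1 _ _ a _ a' hci hdi) (h2 _ _ b _ b' hcj hdj)

theorem level_lt_of_mem_sons {p c : N × M} (hp : p ∈ B.blocks) (hc : c ∈ B.sons p) :
    TI.level p.1 + TJ.level p.2 < TI.level c.1 + TJ.level c.2 := by
  rw [B.sons_eq p hp ⟨c, hc⟩] at hc
  rcases splitBlock_cases hc with ⟨a, -, c'⟩ | ⟨a, b, -⟩ | ⟨a, b⟩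
  · rw [a]; have := TJ.level_lt_of_mem_sons c'; omega
  · rw [b]; have := TI.level_lt_of_mem_sons a; omega
  · have := TI.level_lt_of_mem_sons a; have := TJ.level_lt_of_mem_sons b; omega

theorem mem_subtree_of_mem_splitBlock {p c : N × M} (hc : c ∈ splitBlock TI TJ p) :
    c.1 ∈ TI.subtree p.1 ∧ c.2 ∈ TJ.subtree p.2 := by
  rcases splitBlock_cases hc with ⟨a, -, c'⟩ | ⟨a, b, -⟩ | ⟨a, b⟩
  · exact ⟨a ▸ TI.self_mem_subtree _, TJ.mem_subtree_of_mem_sons c'⟩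
  · exact ⟨TI.mem_subtree_of_mem_sons a, b ▸ TJ.self_mem_subtree _⟩
  · exact ⟨TI.mem_subtree_of_mem_sons a, TJ.mem_subtree_of_mem_sons b⟩

theorem reflTransGen_root {i : ι} {j : κ} {b : N × M} (hb : b ∈ B.blocks)
    (hi : i ∈ TI.label b.1) (hj : j ∈ TJ.label b.2) :
    Relation.ReflTransGen (B.StepAt i j) (TI.root, TJ.root) b := by
  suffices H : ∀ n, ∀ b ∈ B.blocks, TI.level b.1 + TJ.level b.2 = n → i ∈ TI.label b.1 →
      j ∈ TJ.label b.2 → Relation.ReflTransGen (B.StepAt i j) (TI.root, TJ.root) b from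
    H _ b hb rfl hi hj
  intro n
  induction n using Nat.strong_induction_on with
  | _ n ih =>
    intro b hb hn hi hj
    rcases (B.mem_blocks b).1 hb with rfl | ⟨p, hp, hbp⟩
    · exact Relation.ReflTransGen.refl
    · have hstep : B.StepAt i j p b := ⟨hp, hbp, hi, hj⟩
      have hsub := mem_subtree_of_mem_splitBlock hstep.mem_splitBlock
      exact (ih _ (hn ▸ B.level_lt_of_mem_sons hp hbp) p hp rfl (TI.label_subset hsub.1 hi)
        (TJ.label_subset hsub.2 hj)).tail hstep

theorem mem_subtree_of_reflTransGen {i : ι} {j : κ} {b c : N × M}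
    (h : Relation.ReflTransGen (B.StepAt i j) b c) :
    c.1 ∈ TI.subtree b.1 ∧ c.2 ∈ TJ.subtree b.2 := by
  induction h with
  | refl => exact ⟨TI.self_mem_subtree _, TJ.self_mem_subtree _⟩
  | tail _ h ih =>
    have h' := mem_subtree_of_mem_splitBlock h.mem_splitBlock
    exact ⟨TI.mem_subtree_trans h'.1 ih.1, TJ.mem_subtree_trans h'.2 ih.2⟩

theorem eq_of_reflTransGen_leaf {i : ι} {j : κ} {b c : N × M} (hb : B.sons b = ∅)
    (h : Relation.ReflTransGen (B.StepAt i j) b c) : c = b := by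
  rcases Relation.ReflTransGen.cases_head h with h | ⟨d, hd, -⟩
  · exact h.symm
  · exact absurd hd.2.1 (by simp [hb])

/-- The blocks that contain a given position form a chain, hence a leaf that meets a block is
one of its descendants. -/
theorem reflTransGen_leaf {i : ι} {j : κ} {b₀ b : N × M} (hb₀ : b₀ ∈ B.blocks) (hb : b ∈ B.blocks)
    (hleaf : B.sons b = ∅) (hi₀ : i ∈ TI.label b₀.1) (hj₀ : j ∈ TJ.label b₀.2)
    (hi : i ∈ TI.label b.1) (hj : j ∈ TJ.label b.2) :
    Relation.ReflTransGen (B.StepAt i j) b₀ b := by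
  rcases Relation.ReflTransGen.total_of_right_unique (B.stepAt_rightUnique i j)
    (B.reflTransGen_root hb₀ hi₀ hj₀) (B.reflTransGen_root hb hi hj) with h | h
  · exact h
  · rw [B.eq_of_reflTransGen_leaf hleaf h]

theorem leaf_unique {i : ι} {j : κ} {b c : N × M} (hb : b ∈ B.blocks) (hc : c ∈ B.blocks)
    (hbl : B.sons b = ∅) (hcl : B.sons c = ∅)
    (hib : i ∈ TI.label b.1) (hjb : j ∈ TJ.label b.2)
    (hic : i ∈ TI.label c.1) (hjc : j ∈ TJ.label c.2) : b = c :=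
  B.eq_of_reflTransGen_leaf hcl (B.reflTransGen_leaf hc hb hbl hic hjc hib hjb)

theorem exists_leaf (i : ι) (j : κ) :
    ∃ b ∈ B.blocks, B.sons b = ∅ ∧ i ∈ TI.label b.1 ∧ j ∈ TJ.label b.2 := by
  suffices H : ∀ n, ∀ b ∈ B.blocks, (TI.subtree b.1).card + (TJ.subtree b.2).card = n →
      i ∈ TI.label b.1 → j ∈ TJ.label b.2 →
      ∃ b ∈ B.blocks, B.sons b = ∅ ∧ i ∈ TI.label b.1 ∧ j ∈ TJ.label b.2 from
    H _ (TI.root, TJ.root) ((B.mem_blocks _).2 (Or.inl rfl)) rfl (by simp [TI.label_root])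
      (by simp [TJ.label_root])
  intro n
  induction n using Nat.strong_induction_on with
  | _ n ih =>
    intro b hb hn hi hj
    by_cases hs : B.sons b = ∅
    · exact ⟨b, hb, hs, hi, hj⟩
    have heq := B.sons_eq b hb (Finset.nonempty_iff_ne_empty.2 hs)
    have hson : ∀ c ∈ splitBlock TI TJ b, c ∈ B.blocks := fun c hc =>
      (B.mem_blocks c).2 (Or.inr ⟨b, hb, heq ▸ hc⟩)
    have h1 : TI.sons b.1 ≠ ∅ → ∃ u ∈ TI.sons b.1, i ∈ TI.label u := by
      intro h
      rw [TI.label_eq b.1 (Finset.nonempty_iff_ne_empty.2 h)] at hi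
      exact Finset.mem_biUnion.1 hi
    have h2 : TJ.sons b.2 ≠ ∅ → ∃ u ∈ TJ.sons b.2, j ∈ TJ.label u := by
      intro h
      rw [TJ.label_eq b.2 (Finset.nonempty_iff_ne_empty.2 h)] at hj
      exact Finset.mem_biUnion.1 hj
    rw [heq] at hs
    by_cases hI : TI.sons b.1 = ∅
    · have hJ : TJ.sons b.2 ≠ ∅ := by
        intro h
        simp [splitBlock, hI, h] at hs
      obtain ⟨v, hv, hjv⟩ := h2 hJ
      refine ih _ ?_ (b.1, v) (hson _ (by simp [splitBlock, hI, hv])) rfl hi hjv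
      have := TJ.card_subtree_lt hv
      dsimp only; omega
    · obtain ⟨u, hu, hiu⟩ := h1 hI
      have hlt := TI.card_subtree_lt hu
      by_cases hJ : TJ.sons b.2 = ∅
      · refine ih _ ?_ (u, b.2) (hson _ (by simp [splitBlock, hJ, hu, hI])) rfl hiu hj
        dsimp only; omega
      · obtain ⟨v, hv, hjv⟩ := h2 hJ
        have := TJ.card_subtree_lt hv
        refine ih _ ?_ (u, v) (hson _ (by simp [splitBlock, hJ, hu, hI, hv])) rfl hiu hjv
        dsimp only; omega

theorem mem_inadmissible {b : N × M} :
    b ∈ B.inadmissible ↔ b ∈ B.blocks ∧ B.sons b = ∅ ∧ b ∉ B.admissible := by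
  simp [inadmissible]

theorem exists_admissible_or_inadmissible (i : ι) (j : κ) :
    (∃ b ∈ B.admissible, i ∈ TI.label b.1 ∧ j ∈ TJ.label b.2) ∨
      ∃ b ∈ B.inadmissible, i ∈ TI.label b.1 ∧ j ∈ TJ.label b.2 := by
  obtain ⟨b, hb, hl, hij⟩ := B.exists_leaf i j
  by_cases h : b ∈ B.admissible
  · exact Or.inl ⟨b, h, hij⟩
  · exact Or.inr ⟨b, B.mem_inadmissible.2 ⟨hb, hl, h⟩, hij⟩

end BlockTree

end Blocks

/-! ### Restriction matrices and Frobenius norms -/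

/-- The diagonal matrix that restricts to the indices in `s`. -/
def ind (s : Finset ι) : Matrix ι ι ℝ := Matrix.diagonal fun i => if i ∈ s then 1 else 0

theorem ind_mul_apply {n : Type} (s : Finset ι) (A : Matrix ι n ℝ) (i : ι) (j : n) :
    (ind s * A) i j = if i ∈ s then A i j else 0 := by
  simp [ind, Matrix.diagonal_mul]

theorem mul_ind_apply {n : Type} (s : Finset ι) (A : Matrix n ι ℝ) (i : n) (j : ι) :
    (A * ind s) i j = if j ∈ s then A i j else 0 := by
  simp [ind, Matrix.mul_diagonal]

theorem ind_transpose (s : Finset ι) : (ind s)ᵀ = ind s := Matrix.diagonal_transpose _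

theorem ind_mul_ind_of_subset {s t : Finset ι} (h : s ⊆ t) : ind t * ind s = ind s := by
  ext i j
  rw [ind_mul_apply]
  by_cases hij : i = j
  · subst hij
    simp only [ind, Matrix.diagonal_apply_eq]
    split_ifs with h1 h2 <;> first | rfl | exact absurd (h ‹_›) ‹_›
  · simp [ind, Matrix.diagonal_apply_ne _ hij]

theorem ind_mul_self (s : Finset ι) : ind s * ind s = ind s :=
  ind_mul_ind_of_subset (Finset.Subset.refl s)

theorem ind_mul_of_subset {n : Type} {s t : Finset ι} (h : s ⊆ t) {A : Matrix ι n ℝ}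
    (hA : ind s * A = A) : ind t * A = A := by
  rw [← hA, ← Matrix.mul_assoc, ind_mul_ind_of_subset h]

theorem transpose_mul_of_disjoint {n n' : Type} {s t : Finset ι} (h : Disjoint s t)
    {A : Matrix ι n ℝ} {C : Matrix ι n' ℝ} (hA : ind s * A = A) (hC : ind t * C = C) :
    Aᵀ * C = 0 := by
  rw [← hA, ← hC]
  ext a c
  rw [Matrix.mul_apply]
  refine Finset.sum_eq_zero fun i _ => ?_
  rw [Matrix.transpose_apply, ind_mul_apply, ind_mul_apply]
  split_ifs with h1 h2
  · exact absurd h2 (Finset.disjoint_left.1 h h1)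
  · simp
  · simp
  · simp

theorem apply_eq_zero_of_ind_mul {n : Type} {s : Finset ι} {A : Matrix ι n ℝ}
    (hA : ind s * A = A) {i : ι} (hi : i ∉ s) (j : n) : A i j = 0 := by
  rw [← hA, ind_mul_apply, if_neg hi]

/-- The square of the Frobenius norm. -/
def frobSq {m n : Type} [Fintype m] [Fintype n] (A : Matrix m n ℝ) : ℝ := ∑ i, ∑ j, A i j ^ 2

section Frob

variable {m n : Type} [Fintype m] [Fintype n]

theorem frobSq_eq_trace (A : Matrix m n ℝ) : frobSq A = (A * Aᵀ).trace := by
  simp [frobSq, Matrix.trace, Matrix.mul_apply, sq]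

theorem frobSq_nonneg (A : Matrix m n ℝ) : 0 ≤ frobSq A :=
  Finset.sum_nonneg fun _ _ => Finset.sum_nonneg fun _ _ => sq_nonneg _

theorem frobSq_add_of_transpose_mul_eq_zero (A C : Matrix m n ℝ) (h : Aᵀ * C = 0) :
    frobSq (A + C) = frobSq A + frobSq C := by
  have h1 : (A * Cᵀ).trace = 0 := by
    rw [Matrix.trace_mul_comm, ← Matrix.trace_transpose, Matrix.transpose_mul,
      Matrix.transpose_transpose, h, Matrix.trace_zero]
  have h2 : (C * Aᵀ).trace = 0 := by rw [Matrix.trace_mul_comm, h, Matrix.trace_zero]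
  simp only [frobSq_eq_trace, Matrix.transpose_add, Matrix.add_mul, Matrix.mul_add,
    Matrix.trace_add, h1, h2]
  ring

/-- The error caused by orthogonal projections from both sides is at most the sum of the errors
of the two one-sided projections. -/
theorem frobSq_two_sided_le [DecidableEq m] [DecidableEq n] (J : Matrix m m ℝ) (L : Matrix n n ℝ)
    (hJt : Jᵀ = J) (hJ : J * J = J) (hLt : Lᵀ = L) (hL : L * L = L) (Y : Matrix m n ℝ) :
    frobSq ((1 - J) * Y * (1 - L) - Y) ≤ (J * (Y * Yᵀ)).trace + (L * (Yᵀ * Y)).trace := by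
  have hJ1 : J * (1 - J) = 0 := by rw [Matrix.mul_sub, Matrix.mul_one, hJ, sub_self]
  have e1 : frobSq ((1 - J) * Y * (1 - L) - Y) = frobSq (J * Y) + frobSq ((1 - J) * (Y * L)) := by
    rw [← frobSq_add_of_transpose_mul_eq_zero]
    · have : (1 - J) * Y * (1 - L) - Y = -(J * Y + (1 - J) * (Y * L)) := by
        simp only [Matrix.sub_mul, Matrix.mul_sub, Matrix.one_mul, Matrix.mul_one,
          Matrix.mul_assoc]
        abel
      rw [this]
      simp only [frobSq, Matrix.neg_apply, neg_sq]
    · rw [Matrix.transpose_mul, hJt, Matrix.mul_assoc, ← Matrix.mul_assoc J, hJ1,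
        Matrix.zero_mul, Matrix.mul_zero]
  have e2 : frobSq (Y * L) = frobSq (J * (Y * L)) + frobSq ((1 - J) * (Y * L)) := by
    rw [← frobSq_add_of_transpose_mul_eq_zero]
    · rw [← Matrix.add_mul, add_sub_cancel, Matrix.one_mul]
    · rw [Matrix.transpose_mul, hJt, Matrix.mul_assoc, ← Matrix.mul_assoc J, hJ1,
        Matrix.zero_mul, Matrix.mul_zero]
  have e3 : frobSq (J * Y) = (J * (Y * Yᵀ)).trace := by
    rw [frobSq_eq_trace, Matrix.transpose_mul, hJt, Matrix.trace_mul_comm, Matrix.mul_assoc,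
      ← Matrix.mul_assoc J J, hJ, Matrix.trace_mul_comm, Matrix.mul_assoc]
  have e4 : frobSq (Y * L) = (L * (Yᵀ * Y)).trace := by
    rw [frobSq_eq_trace, Matrix.transpose_mul, hLt, Matrix.mul_assoc, ← Matrix.mul_assoc L L, hL,
      Matrix.trace_mul_comm, Matrix.mul_assoc]
  have := frobSq_nonneg (J * (Y * L))
  linarith

/-- A matrix whose columns are orthonormal up to vanishing columns is not changed by dropping the
vanishing columns. -/
theorem mul_diagonal_of_gram [DecidableEq n] {U : Matrix m n ℝ} {d : n → ℝ}
    (hd : ∀ j, d j = 0 ∨ d j = 1) (h : Uᵀ * U = Matrix.diagonal d) :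
    U * Matrix.diagonal d = U := by
  ext i j
  rw [Matrix.mul_diagonal]
  rcases hd j with h0 | h1
  · have h2 : ∑ x, U x j ^ 2 = 0 := by
      have := congrFun (congrFun h j) j
      rw [Matrix.diagonal_apply_eq, h0, Matrix.mul_apply] at this
      simpa [sq] using this
    have h3 := (Finset.sum_eq_zero_iff_of_nonneg fun x _ => sq_nonneg (U x j)).1 h2 i
      (Finset.mem_univ i)
    rw [pow_eq_zero_iff two_ne_zero] at h3
    rw [h3, zero_mul]
  · rw [h1, mul_one]

/-- The transpose of a matrix with orthonormal columns, up to vanishing ones, is a contraction. -/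
theorem frobSq_transpose_mul_le [DecidableEq n] {p : Type} [Fintype p] {U : Matrix m n ℝ}
    {d : n → ℝ} (hd : ∀ j, d j = 0 ∨ d j = 1) (h : Uᵀ * U = Matrix.diagonal d)
    (A : Matrix m p ℝ) : frobSq (Uᵀ * A) ≤ frobSq A := by
  have hU := mul_diagonal_of_gram hd h
  have hUU : Uᵀ * U * Uᵀ = Uᵀ := by
    rw [h, ← Matrix.transpose_inj, Matrix.transpose_mul, Matrix.transpose_transpose,
      Matrix.diagonal_transpose, hU]
  have e1 : frobSq (U * (Uᵀ * A)) = frobSq (Uᵀ * A) := by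
    rw [frobSq_eq_trace, frobSq_eq_trace, Matrix.transpose_mul U, Matrix.trace_mul_comm,
      Matrix.mul_assoc, ← Matrix.mul_assoc Uᵀ U, ← Matrix.mul_assoc (Uᵀ * U), hUU,
      Matrix.trace_mul_comm]
  have e2 : frobSq A = frobSq (U * (Uᵀ * A)) + frobSq (A - U * (Uᵀ * A)) := by
    rw [← frobSq_add_of_transpose_mul_eq_zero]
    · rw [add_sub_cancel]
    · rw [Matrix.transpose_mul, Matrix.mul_assoc, Matrix.mul_sub, ← Matrix.mul_assoc Uᵀ U,
        ← Matrix.mul_assoc (Uᵀ * U), hUU, sub_self, Matrix.mul_zero]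
  have := frobSq_nonneg (A - U * (Uᵀ * A))
  linarith

end Frob

/-! ### Nested bases -/

section Bases

variable (T : ClusterTree ι N)

/-- The matrix that embeds the rows stored for `t`, if `t` is a leaf, into the full index set. -/
def leafIncl (t : N) : Matrix ι (T.LeafIdx t) ℝ := Matrix.of fun i x => if i = x.1 then 1 else 0

theorem leafIncl_mul_apply {n : Type} (t : N) (A : Matrix (T.LeafIdx t) n ℝ) (i : ι) (j : n) :
    (leafIncl T t * A) i j =
      if h : i ∈ T.label t ∧ T.sons t = ∅ then A ⟨i, h⟩ j else 0 := by
  rw [Matrix.mul_apply]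
  simp only [leafIncl, Matrix.of_apply, ite_mul, one_mul, zero_mul]
  split_ifs with h
  · rw [Finset.sum_eq_single ⟨i, h⟩]
    · simp
    · intro x _ hx
      rw [if_neg]
      rintro rfl
      exact hx rfl
    · simp
  · refine Finset.sum_eq_zero fun x _ => if_neg ?_
    rintro rfl
    exact h x.2

theorem leafIncl_gram (t : N) : (leafIncl T t)ᵀ * leafIncl T t = 1 := by
  ext x y
  rw [Matrix.mul_apply]
  simp [leafIncl, Matrix.one_apply, Subtype.ext_iff, eq_comm]

theorem ind_mul_leafIncl (t : N) : ind (T.label t) * leafIncl T t = leafIncl T t := by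
  ext i x
  rw [ind_mul_apply]
  split_ifs with h
  · rfl
  · simp only [leafIncl, Matrix.of_apply]
    rw [if_neg]
    rintro rfl
    exact h x.2.1

theorem leafIncl_eq_zero {t u : N} (hu : u ∈ T.sons t) : leafIncl T t = 0 := by
  ext i x
  exact absurd hu (by simp [x.2.2])

theorem ind_label (t : N) :
    ind (T.label t) = leafIncl T t * (leafIncl T t)ᵀ + ∑ u : T.sons t, ind (T.label u.1) := by
  by_cases hs : T.sons t = ∅
  · have : IsEmpty (T.sons t) := ⟨fun u => by simpa [hs] using u.2⟩
    rw [Finset.univ_eq_empty, Finset.sum_empty, add_zero]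
    ext i j
    rw [leafIncl_mul_apply]
    by_cases hij : i = j
    · subst hij
      simp [hs, ind, leafIncl]
    · rw [ind, Matrix.diagonal_apply_ne _ hij]
      split_ifs
      · simp [leafIncl, Ne.symm hij]
      · rfl
  · obtain ⟨v, hv⟩ := Finset.nonempty_iff_ne_empty.2 hs
    rw [leafIncl_eq_zero T hv, Matrix.zero_mul, zero_add]
    ext i j
    rw [Matrix.sum_apply]
    by_cases hij : i = j
    · subst hij
      simp only [ind, Matrix.diagonal_apply_eq]
      rw [T.label_eq t ⟨v, hv⟩]
      split_ifs with h
      · obtain ⟨u, hu, hiu⟩ := Finset.mem_biUnion.1 h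
        rw [Finset.sum_eq_single ⟨u, hu⟩]
        · simp [hiu]
        · intro w _ hw
          refine if_neg fun hiw => ?_
          exact Finset.disjoint_left.1 (T.label_disjoint t u hu w.1 w.2
            fun h => hw (Subtype.ext h.symm)) hiu hiw
        · simp
      · refine (Finset.sum_eq_zero fun u _ => if_neg fun hiu => h ?_).symm
        exact Finset.mem_biUnion.2 ⟨u.1, u.2, hiu⟩
    · simp [ind, Matrix.diagonal_apply_ne _ hij]

/-- The basis of the functions on the label of `t` composed of the unit vectors, if `t` is a leaf,
and of the bases `Φ u` of the sons otherwise. -/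
def sonsBasis {p : Type} (Φ : N → Matrix ι p ℝ) (t : N) :
    Matrix ι (T.LeafIdx t ⊕ (T.sons t × p)) ℝ :=
  Matrix.fromCols (leafIncl T t) (Matrix.of fun i a => Φ a.1.1 i a.2)

section Sons

variable {p q : Type} [Fintype p] {Φ : N → Matrix ι p ℝ}

theorem sonsBasis_mul (t : N) (A : Matrix (T.LeafIdx t) q ℝ) (F : T.sons t → Matrix p q ℝ) :
    sonsBasis T Φ t * Matrix.fromRows A (stack F) =
      leafIncl T t * A + ∑ u : T.sons t, Φ u.1 * F u := by
  rw [sonsBasis, Matrix.fromCols_mul_fromRows]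
  congr 1
  ext i j
  simp [Matrix.mul_apply, Matrix.sum_apply, stack, Fintype.sum_prod_type]

theorem sonsBasis_transpose_mul (t : N) (A : Matrix ι q ℝ) :
    (sonsBasis T Φ t)ᵀ * A = Matrix.fromRows ((leafIncl T t)ᵀ * A)
      (stack fun u : T.sons t => (Φ u.1)ᵀ * A) := by
  ext (x | x) j
  · simp [sonsBasis, Matrix.mul_apply]
  · simp [sonsBasis, Matrix.mul_apply, stack]

theorem sonsBasis_mul_transpose (t : N) :
    sonsBasis T Φ t * (sonsBasis T Φ t)ᵀ =
      leafIncl T t * (leafIncl T t)ᵀ + ∑ u : T.sons t, Φ u.1 * (Φ u.1)ᵀ := by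
  conv_lhs => rw [← Matrix.mul_one (sonsBasis T Φ t)ᵀ]
  rw [sonsBasis_transpose_mul, sonsBasis_mul]
  simp only [Matrix.mul_one]

theorem son_transpose_mul_son (hΦ : ∀ t, ind (T.label t) * Φ t = Φ t)
    {Ψ : N → Matrix ι q ℝ} (hΨ : ∀ t, ind (T.label t) * Ψ t = Ψ t) {t : N} {u v : T.sons t}
    (huv : u ≠ v) : (Φ u.1)ᵀ * Ψ v.1 = 0 :=
  transpose_mul_of_disjoint (T.label_disjoint t u.1 u.2 v.1 v.2 fun h => huv (Subtype.ext h))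
    (hΦ _) (hΨ _)

/-- The part of a nested sum that belongs to one son. -/
theorem son_transpose_mul_sum (hΦ : ∀ t, ind (T.label t) * Φ t = Φ t)
    {Ψ : N → Matrix ι q ℝ} (hΨ : ∀ t, ind (T.label t) * Ψ t = Ψ t) {t : N} (u : T.sons t)
    (A : Matrix (T.LeafIdx t) q ℝ) :
    (Φ u.1)ᵀ * (leafIncl T t * A + ∑ v : T.sons t, Ψ v.1) = (Φ u.1)ᵀ * Ψ u.1 := by
  rw [Matrix.mul_add, leafIncl_eq_zero T u.2, Matrix.zero_mul, Matrix.mul_zero, zero_add,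
    Matrix.mul_sum, Finset.sum_eq_single u]
  · exact fun v _ hv => son_transpose_mul_son T hΦ hΨ (Ne.symm hv)
  · simp

theorem leafIncl_transpose_mul_sum {Ψ : N → Matrix ι q ℝ} (t : N)
    (A : Matrix (T.LeafIdx t) q ℝ) :
    (leafIncl T t)ᵀ * (leafIncl T t * A + ∑ v : T.sons t, Ψ v.1) = A := by
  rw [Matrix.mul_add, ← Matrix.mul_assoc, leafIncl_gram, Matrix.one_mul, Matrix.mul_sum,
    Finset.sum_eq_zero, add_zero]
  intro v _
  rw [leafIncl_eq_zero T v.2, Matrix.transpose_zero, Matrix.zero_mul]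

theorem sum_sons_gram (hΦ : ∀ t, ind (T.label t) * Φ t = Φ t) (t : N)
    (A : Matrix (T.LeafIdx t) p ℝ) :
    (leafIncl T t * A + ∑ v : T.sons t, Φ v.1)ᵀ * (leafIncl T t * A + ∑ v : T.sons t, Φ v.1) =
      Aᵀ * A + ∑ u : T.sons t, (Φ u.1)ᵀ * Φ u.1 := by
  conv_lhs => rw [Matrix.transpose_add, Matrix.add_mul, Matrix.transpose_mul, Matrix.mul_assoc,
    leafIncl_transpose_mul_sum, Matrix.transpose_sum, Matrix.sum_mul]
  congr 1
  exact Finset.sum_congr rfl fun u _ => son_transpose_mul_sum T hΦ hΦ u A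

theorem sonsBasis_gram [DecidableEq p] (hΦ : ∀ t, ind (T.label t) * Φ t = Φ t) {t : N}
    {d : T.sons t → p → ℝ}
    (h : ∀ u : T.sons t, (Φ u.1)ᵀ * Φ u.1 = Matrix.diagonal (d u)) :
    (sonsBasis T Φ t)ᵀ * sonsBasis T Φ t =
      Matrix.diagonal (Sum.elim (fun _ => 1) fun a => d a.1 a.2) := by
  have h1 : ∀ u : T.sons t, leafIncl T t = 0 := fun u => leafIncl_eq_zero T u.2
  ext (x | ⟨u, a⟩) (y | ⟨v, c⟩)
  · have := congrFun (congrFun (leafIncl_gram T t) x) y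
    rw [Matrix.mul_apply] at this ⊢
    simp only [sonsBasis, Matrix.transpose_apply, Matrix.fromCols_apply_inl] at this ⊢
    rw [this]
    simp [Matrix.diagonal_apply, Matrix.one_apply]
  · simp [sonsBasis, Matrix.mul_apply, h1 v]
  · simp [sonsBasis, Matrix.mul_apply, h1 u]
  · have h2 : ((sonsBasis T Φ t)ᵀ * sonsBasis T Φ t) (Sum.inr (u, a)) (Sum.inr (v, c)) =
        ((Φ u.1)ᵀ * Φ v.1) a c := by
      simp [sonsBasis, Matrix.mul_apply]
    rw [h2]
    by_cases huv : u = v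
    · subst huv
      rw [h u]
      simp [Matrix.diagonal_apply]
    · rw [son_transpose_mul_son T hΦ hΦ huv]
      simp [huv]

theorem ind_mul_sonsBasis (hΦ : ∀ t, ind (T.label t) * Φ t = Φ t) (t : N) :
    ind (T.label t) * sonsBasis T Φ t = sonsBasis T Φ t := by
  ext i (x | ⟨u, a⟩)
  · rw [ind_mul_apply]
    have := congrFun (congrFun (ind_mul_leafIncl T t) i) x
    rw [ind_mul_apply] at this
    simpa [sonsBasis] using this
  · rw [ind_mul_apply]
    have := congrFun (congrFun (ind_mul_of_subset (T.label_son_subset u.2) (hΦ u.1)) i) a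
    rw [ind_mul_apply] at this
    simpa [sonsBasis] using this

end Sons

variable {T} {k : ℕ} (V : BasisRep T k)

theorem basis_eq (t : N) : V.basis t =
    leafIncl T t * V.leaf t + ∑ u : T.sons t, V.basis u.1 * V.transfer u.1 := by
  rw [BasisRep.basis]
  congr 1
  ext i j
  rw [leafIncl_mul_apply]
  simp

theorem ind_mul_basis (t : N) : ind (T.label t) * V.basis t = V.basis t := by
  induction t using T.sons_induction with
  | h t ih =>
    rw [basis_eq, Matrix.mul_add, ← Matrix.mul_assoc, ind_mul_leafIncl, Matrix.mul_sum]
    congr 1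
    refine Finset.sum_congr rfl fun u _ => ?_
    rw [← Matrix.mul_assoc, ind_mul_of_subset (T.label_son_subset u.2) (ih u.1 u.2)]

theorem ind_mul_sum_sons {q : Type} {Ψ : N → Matrix ι q ℝ}
    (hΨ : ∀ t, ind (T.label t) * Ψ t = Ψ t) {t : N} (u : T.sons t)
    (A : Matrix (T.LeafIdx t) q ℝ) :
    ind (T.label u.1) * (leafIncl T t * A + ∑ v : T.sons t, Ψ v.1) = Ψ u.1 := by
  have h := son_transpose_mul_sum T (Φ := fun t => ind (T.label t)) (fun t => ind_mul_self _) hΨ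
    u A
  simpa only [ind_transpose, hΨ] using h

theorem ind_mul_basis_father {t u : N} (hu : u ∈ T.sons t) :
    ind (T.label u) * V.basis t = V.basis u * V.transfer u := by
  rw [basis_eq V t]
  refine ind_mul_sum_sons (Ψ := fun u => V.basis u * V.transfer u) (fun u => ?_) ⟨u, hu⟩ _
  rw [← Matrix.mul_assoc, ind_mul_basis]

theorem isClusterBasis_basis : IsClusterBasis T V.basis := by
  refine ⟨V.transfer, fun t u hu i hi j => ?_⟩
  have h := congrFun (congrFun (ind_mul_basis_father V hu) i) j
  rwa [ind_mul_apply, if_pos hi] at h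

/-! ### The extended basis -/

variable (t₀ : N) (X : Matrix (T.label t₀) (Fin k) ℝ)

/-- The extended basis matrices: `(V t | X)` in the subtree with root `t₀`, and `(V t | 0)` outside
of it. -/
def extBasis (t : N) : Matrix ι (Dbl k) ℝ :=
  Matrix.fromCols (V.basis t) (if t ∈ T.subtree t₀ then ind (T.label t) * zeroExtend X else 0)

theorem mul_fromCols {m n p q : Type} [Fintype n] (A : Matrix m n ℝ) (C : Matrix n p ℝ)
    (D : Matrix n q ℝ) : A * Matrix.fromCols C D = Matrix.fromCols (A * C) (A * D) := by
  ext i (j | j) <;> simp [Matrix.mul_apply]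

theorem ind_mul_extBasis (t : N) :
    ind (T.label t) * extBasis V t₀ X t = extBasis V t₀ X t := by
  rw [extBasis, mul_fromCols, ind_mul_basis]
  congr 1
  split_ifs
  · rw [← Matrix.mul_assoc, ind_mul_self]
  · rw [Matrix.mul_zero]

theorem fromCols_mul_extendOne {m : Type} (A C : Matrix m (Fin k) ℝ)
    (E : Matrix (Fin k) (Fin k) ℝ) :
    Matrix.fromCols A C * extendOne E = Matrix.fromCols (A * E) C := by
  rw [extendOne, Matrix.fromCols_mul_fromBlocks]
  simp

theorem extBasis_eq {t : N} (ht : t ∈ T.subtree t₀) : extBasis V t₀ X t =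
    leafIncl T t * extendedLeaf T V t₀ X t +
      ∑ u : T.sons t, extBasis V t₀ X u.1 * extendOne (V.transfer u.1) := by
  have h1 : ∀ u : T.sons t, extBasis V t₀ X u.1 * extendOne (V.transfer u.1) =
      Matrix.fromCols (V.basis u.1 * V.transfer u.1) (ind (T.label u.1) * zeroExtend X) := by
    intro u
    rw [extBasis, if_pos (T.son_mem_subtree ht u.2), fromCols_mul_extendOne]
  simp only [h1]
  rw [extBasis, if_pos ht, extendedLeaf, mul_fromCols, basis_eq V t, ind_label T t]
  ext i (j | j)
  · simp [Matrix.sum_apply]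
  · have h2 : (leafIncl T t)ᵀ * zeroExtend X =
        ((zeroExtend X).submatrix Subtype.val id : Matrix (T.LeafIdx t) (Fin k) ℝ) := by
      ext x c
      simp [Matrix.mul_apply, leafIncl]
    simp [Matrix.sum_apply, Matrix.add_mul, Matrix.sum_mul, Matrix.mul_assoc, h2]

theorem basisWeights_val (cqr : ℕ) (t : T.subtree t₀) :
    (basisWeights cqr T V t₀ X).val t = (Counted.qr cqr (Matrix.fromRows
      (extendedLeaf T V t₀ X t.1) (stack fun u : T.sons t.1 =>
        (basisWeights cqr T V t₀ X).val ⟨u.1, T.son_mem_subtree t.2 u.2⟩ *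
          extendOne (V.transfer u.1)))).val := by
  conv_lhs => rw [basisWeights, sweepUp]
  dsimp only
  rw [sweepUpVal]
  rfl

theorem stack_gram {a m n : Type} [Fintype a] [Fintype m] (F : a → Matrix m n ℝ) :
    (stack F)ᵀ * stack F = ∑ u, (F u)ᵀ * F u := by
  ext i j
  simp [Matrix.mul_apply, stack, Matrix.sum_apply, Fintype.sum_prod_type]

theorem fromRows_gram {m m' n : Type} [Fintype m] [Fintype m'] (A : Matrix m n ℝ)
    (C : Matrix m' n ℝ) : (Matrix.fromRows A C)ᵀ * Matrix.fromRows A C = Aᵀ * A + Cᵀ * C := by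
  rw [Matrix.transpose_fromRows, Matrix.fromCols_mul_fromRows]

theorem basisWeights_gram (cqr : ℕ) {t : N} (ht : t ∈ T.subtree t₀) :
    ((basisWeights cqr T V t₀ X).val ⟨t, ht⟩)ᵀ * (basisWeights cqr T V t₀ X).val ⟨t, ht⟩ =
      (extBasis V t₀ X t)ᵀ * extBasis V t₀ X t := by
  induction t using T.sons_induction with
  | h t ih =>
    rw [basisWeights_val, qr_val_gram, fromRows_gram, stack_gram, extBasis_eq V t₀ X ht,
      sum_sons_gram T (Φ := fun u => extBasis V t₀ X u * extendOne (V.transfer u))]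
    · congr 1
      refine Finset.sum_congr rfl fun u _ => ?_
      simp only [Matrix.transpose_mul, Matrix.mul_assoc]
      rw [← Matrix.mul_assoc _ _ (extendOne (V.transfer u.1)), ih u.1 u.2, Matrix.mul_assoc]
    · intro u
      rw [← Matrix.mul_assoc, ind_mul_extBasis]

end Bases

/-! ### The truncated basis -/

section Truncation

variable (csvd : ℕ) {T : ClusterTree ι N} {k : ℕ} (V : BasisRep T k) (t₀ : N)
  (X : Matrix (T.label t₀) (Fin k) ℝ) (Bw : T.subtree t₀ → Matrix (Dbl k) (Dbl k) ℝ) (rk : N → ℕ)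

/-- The nested representation of the truncated basis. -/
abbrev newRep : BasisRep T k := (replaceBasis T V t₀ (newBasis csvd T V t₀ X Bw rk).val).val

/-- The local basis matrix `Q t`. -/
abbrev localQ (t : T.subtree t₀) : Matrix (LocalRow T k t.1) (Fin k) ℝ :=
  ((newBasis csvd T V t₀ X Bw rk).val t).1

/-- The matrix `R t` of the change of basis. -/
abbrev localR (t : T.subtree t₀) : Matrix (Fin k) (Dbl k) ℝ :=
  ((newBasis csvd T V t₀ X Bw rk).val t).2

/-- The extended basis of `t` in terms of the new bases of its sons. -/
def localVhat (t : T.subtree t₀) : Matrix (LocalRow T k t.1) (Dbl k) ℝ :=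
  Matrix.fromRows (extendedLeaf T V t₀ X t.1) (stack fun u : T.sons t.1 =>
    localR csvd V t₀ X Bw rk ⟨u.1, T.son_mem_subtree t.2 u.2⟩ * extendOne (V.transfer u.1))

theorem newBasis_val (t : T.subtree t₀) :
    (newBasis csvd T V t₀ X Bw rk).val t =
      (leftSingular k (rk t.1) (localVhat csvd V t₀ X Bw rk t * (Bw t)ᵀ),
        (leftSingular k (rk t.1) (localVhat csvd V t₀ X Bw rk t * (Bw t)ᵀ))ᵀ *
          localVhat csvd V t₀ X Bw rk t) := by
  conv_lhs => rw [newBasis, sweepUp]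
  dsimp only
  rw [sweepUpVal]
  rfl

theorem localQ_eq (t : T.subtree t₀) : localQ csvd V t₀ X Bw rk t =
    leftSingular k (rk t.1) (localVhat csvd V t₀ X Bw rk t * (Bw t)ᵀ) :=
  congrArg Prod.fst (newBasis_val csvd V t₀ X Bw rk t)

theorem localR_eq (t : T.subtree t₀) : localR csvd V t₀ X Bw rk t =
    (localQ csvd V t₀ X Bw rk t)ᵀ * localVhat csvd V t₀ X Bw rk t := by
  rw [localQ_eq]
  exact congrArg Prod.snd (newBasis_val csvd V t₀ X Bw rk t)

/-- The composed new bases of the sons. -/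
abbrev newSons (t : N) : Matrix ι (LocalRow T k t) ℝ :=
  sonsBasis T (newRep csvd V t₀ X Bw rk).basis t

theorem newRep_basis_eq {t : N} (ht : t ∈ T.subtree t₀) :
    (newRep csvd V t₀ X Bw rk).basis t =
      newSons csvd V t₀ X Bw rk t * localQ csvd V t₀ X Bw rk ⟨t, ht⟩ := by
  have h : localQ csvd V t₀ X Bw rk ⟨t, ht⟩ =
      Matrix.fromRows ((newRep csvd V t₀ X Bw rk).leaf t)
        (stack fun u : T.sons t => (newRep csvd V t₀ X Bw rk).transfer u.1) := by
    ext (x | ⟨⟨u, hu⟩, a⟩) c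
    · have h1 : (newRep csvd V t₀ X Bw rk).leaf t =
          (localQ csvd V t₀ X Bw rk ⟨t, ht⟩).toRows₁ := dif_pos ht
      rw [h1]
      rfl
    · have hut := T.ne_of_mem_sons ht hu
      have hu₀ := T.son_mem_subtree ht hu
      have h1 : (newRep csvd V t₀ X Bw rk).transfer u = Matrix.of fun a c =>
          (localQ csvd V t₀ X Bw rk ⟨T.father u, T.father_mem_subtree hu₀ hut⟩)
            (Sum.inr (⟨u, T.mem_sons_father hu₀ hut⟩, a)) c :=
        (dif_neg hut).trans (dif_pos hu₀)
      obtain rfl := (T.mem_sons.1 hu).2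
      simp [stack, h1]
  rw [basis_eq, h, sonsBasis_mul]

/-- The joint induction over the truncated bases: their columns, and those of the combined bases of
the sons, are orthonormal up to vanishing columns, and the computed matrices `R t` and `localVhat`
are the coefficients of the extended basis in these bases. -/
theorem newRep_orthonormal_and_localR {t : N} (ht : t ∈ T.subtree t₀) :
    (∃ d : Fin k → ℝ, (∀ j, d j = 0 ∨ d j = 1) ∧
      ((newRep csvd V t₀ X Bw rk).basis t)ᵀ * (newRep csvd V t₀ X Bw rk).basis t =
        Matrix.diagonal d) ∧
    ((newRep csvd V t₀ X Bw rk).basis t)ᵀ * extBasis V t₀ X t =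
      localR csvd V t₀ X Bw rk ⟨t, ht⟩ ∧
    (∃ d : LocalRow T k t → ℝ, (∀ j, d j = 0 ∨ d j = 1) ∧
      (newSons csvd V t₀ X Bw rk t)ᵀ * newSons csvd V t₀ X Bw rk t = Matrix.diagonal d) ∧
    (newSons csvd V t₀ X Bw rk t)ᵀ * extBasis V t₀ X t =
      localVhat csvd V t₀ X Bw rk ⟨t, ht⟩ := by
  induction t using T.sons_induction with
  | h t ih =>
    have hsup := ind_mul_basis (newRep csvd V t₀ X Bw rk)
    have hs : ∀ u : T.sons t, u.1 ∈ T.subtree t₀ := fun u => T.son_mem_subtree ht u.2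
    choose d hd using fun u : T.sons t => (ih u.1 u.2 (hs u)).1
    have hR := fun u : T.sons t => (ih u.1 u.2 (hs u)).2.1
    have hgram := sonsBasis_gram T hsup fun u => (hd u).2
    have hδ : ∀ j : LocalRow T k t,
        (Sum.elim (fun _ => 1) fun a => d a.1 a.2 : LocalRow T k t → ℝ) j = 0 ∨
        (Sum.elim (fun _ => 1) fun a => d a.1 a.2 : LocalRow T k t → ℝ) j = 1 := by
      rintro (x | ⟨u, a⟩)
      · exact Or.inr rfl
      · exact (hd u).1 a
    have hV : (newSons csvd V t₀ X Bw rk t)ᵀ * extBasis V t₀ X t =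
        localVhat csvd V t₀ X Bw rk ⟨t, ht⟩ := by
      have hsupE : ∀ u, ind (T.label u) * (extBasis V t₀ X u * extendOne (V.transfer u)) =
          extBasis V t₀ X u * extendOne (V.transfer u) := by
        intro u
        rw [← Matrix.mul_assoc, ind_mul_extBasis]
      rw [sonsBasis_transpose_mul, localVhat, extBasis_eq V t₀ X ht]
      congr 1
      · exact leafIncl_transpose_mul_sum T
          (Ψ := fun u => extBasis V t₀ X u * extendOne (V.transfer u)) t _
      · congr 1
        funext u
        rw [son_transpose_mul_sum T hsup
          (Ψ := fun u => extBasis V t₀ X u * extendOne (V.transfer u)) hsupE u,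
          ← Matrix.mul_assoc, hR u]
    -- The rows of `localVhat` that belong to vanishing columns of the bases of the sons vanish,
    -- hence so do those rows of the left singular vectors.
    have hQ : (newSons csvd V t₀ X Bw rk t)ᵀ * newSons csvd V t₀ X Bw rk t *
        localQ csvd V t₀ X Bw rk ⟨t, ht⟩ = localQ csvd V t₀ X Bw rk ⟨t, ht⟩ := by
      have hU := mul_diagonal_of_gram hδ hgram
      rw [← hgram] at hU
      have hU' := congrArg Matrix.transpose hU
      simp only [Matrix.transpose_mul, Matrix.transpose_transpose] at hU'
      rw [localQ_eq]
      refine mul_leftSingular_of_mul_eq _ _ _ ?_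
      rw [← Matrix.mul_assoc, ← hV, ← Matrix.mul_assoc, hU']
    refine ⟨?_, ?_, ⟨_, hδ, hgram⟩, hV⟩
    · obtain ⟨e, he, h⟩ := leftSingular_gram k (rk t)
        (localVhat csvd V t₀ X Bw rk ⟨t, ht⟩ * (Bw ⟨t, ht⟩)ᵀ)
      refine ⟨e, he, ?_⟩
      rw [newRep_basis_eq csvd V t₀ X Bw rk ht, Matrix.transpose_mul, Matrix.mul_assoc,
        ← Matrix.mul_assoc _ (newSons csvd V t₀ X Bw rk t), hQ, localQ_eq, h]
    · rw [newRep_basis_eq csvd V t₀ X Bw rk ht, Matrix.transpose_mul, Matrix.mul_assoc, hV,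
        localR_eq]

/-- The projection error committed locally in the cluster `t`; it is zero outside of the subtree
with root `t₀`. -/
def localError (t : N) : Matrix ι ι ℝ :=
  if ht : t ∈ T.subtree t₀ then
    newSons csvd V t₀ X Bw rk t *
      (1 - localQ csvd V t₀ X Bw rk ⟨t, ht⟩ * (localQ csvd V t₀ X Bw rk ⟨t, ht⟩)ᵀ) *
      (newSons csvd V t₀ X Bw rk t)ᵀ
  else 0

/-- The total projection error in the cluster `t`: the sum of the local errors of its descendants.
Only those in the subtree with root `t₀` contribute. -/
def totalError (t : N) : Matrix ι ι ℝ := ∑ r ∈ T.subtree t, localError csvd V t₀ X Bw rk r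

theorem localError_transpose (t : N) :
    (localError csvd V t₀ X Bw rk t)ᵀ = localError csvd V t₀ X Bw rk t := by
  unfold localError
  split_ifs
  · simp only [Matrix.transpose_mul, Matrix.transpose_sub, Matrix.transpose_one,
      Matrix.transpose_transpose, Matrix.mul_assoc]
  · exact Matrix.transpose_zero

theorem ind_mul_localError (t : N) :
    ind (T.label t) * localError csvd V t₀ X Bw rk t = localError csvd V t₀ X Bw rk t := by
  unfold localError
  split_ifs
  · simp only [← Matrix.mul_assoc]
    rw [ind_mul_sonsBasis T (ind_mul_basis _)]
  · exact Matrix.mul_zero _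

theorem ind_root_mul_localError (t : N) :
    ind (T.label t₀) * localError csvd V t₀ X Bw rk t = localError csvd V t₀ X Bw rk t := by
  by_cases ht : t ∈ T.subtree t₀
  · exact ind_mul_of_subset (T.label_subset ht) (ind_mul_localError _ _ _ _ _ _ _)
  · rw [localError, dif_neg ht, Matrix.mul_zero]

theorem totalError_transpose (t : N) :
    (totalError csvd V t₀ X Bw rk t)ᵀ = totalError csvd V t₀ X Bw rk t := by
  simp only [totalError, Matrix.transpose_sum, localError_transpose]

theorem ind_mul_totalError (t : N) :
    ind (T.label t) * totalError csvd V t₀ X Bw rk t = totalError csvd V t₀ X Bw rk t := by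
  rw [totalError, Matrix.mul_sum]
  exact Finset.sum_congr rfl fun r hr =>
    ind_mul_of_subset (T.label_subset hr) (ind_mul_localError _ _ _ _ _ _ _)

theorem totalError_mul_ind (t : N) :
    totalError csvd V t₀ X Bw rk t * ind (T.label t) = totalError csvd V t₀ X Bw rk t := by
  rw [← Matrix.transpose_inj, Matrix.transpose_mul, ind_transpose, totalError_transpose,
    ind_mul_totalError]

theorem ind_root_mul_totalError (t : N) :
    ind (T.label t₀) * totalError csvd V t₀ X Bw rk t = totalError csvd V t₀ X Bw rk t := by
  rw [totalError, Matrix.mul_sum]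
  exact Finset.sum_congr rfl fun r _ => ind_root_mul_localError _ _ _ _ _ _ r

theorem totalError_eq (t : N) : totalError csvd V t₀ X Bw rk t =
    localError csvd V t₀ X Bw rk t + ∑ u : T.sons t, totalError csvd V t₀ X Bw rk u.1 := by
  rw [totalError, T.sum_subtree, Finset.sum_coe_sort (T.sons t) (totalError csvd V t₀ X Bw rk)]
  rfl

/-- Within the subtree, the sum of the local errors telescopes to the error of the projection to
the range of the new basis. -/
theorem totalError_eq_sub {t : N} (ht : t ∈ T.subtree t₀) : totalError csvd V t₀ X Bw rk t =
    ind (T.label t) - (newRep csvd V t₀ X Bw rk).basis t *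
      ((newRep csvd V t₀ X Bw rk).basis t)ᵀ := by
  induction t using T.sons_induction with
  | h t ih =>
    have h1 : ∑ u : T.sons t, totalError csvd V t₀ X Bw rk u.1 =
        ∑ u : T.sons t, (ind (T.label u.1) - (newRep csvd V t₀ X Bw rk).basis u.1 *
          ((newRep csvd V t₀ X Bw rk).basis u.1)ᵀ) :=
      Finset.sum_congr rfl fun u _ => ih u.1 u.2 (T.son_mem_subtree ht u.2)
    have h2 := sonsBasis_mul_transpose T (Φ := (newRep csvd V t₀ X Bw rk).basis) t
    rw [totalError_eq, h1, Finset.sum_sub_distrib, ind_label T t, localError, dif_pos ht,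
      newRep_basis_eq csvd V t₀ X Bw rk ht, Matrix.mul_sub, Matrix.mul_one, Matrix.sub_mul, h2,
      Matrix.transpose_mul]
    simp only [Matrix.mul_assoc]
    abel

/-- The total error is an orthogonal projection: outside of the subtree it is a sum of projections
to functions with disjoint supports. -/
theorem totalError_mul_self (t : N) :
    totalError csvd V t₀ X Bw rk t * totalError csvd V t₀ X Bw rk t =
      totalError csvd V t₀ X Bw rk t := by
  induction t using T.sons_induction with
  | h t ih =>
    by_cases ht : t ∈ T.subtree t₀
    · obtain ⟨⟨d, hd, hgram⟩, -⟩ := newRep_orthonormal_and_localR csvd V t₀ X Bw rk ht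
      have h1 : (newRep csvd V t₀ X Bw rk).basis t * ((newRep csvd V t₀ X Bw rk).basis t)ᵀ *
          ((newRep csvd V t₀ X Bw rk).basis t * ((newRep csvd V t₀ X Bw rk).basis t)ᵀ) =
          (newRep csvd V t₀ X Bw rk).basis t * ((newRep csvd V t₀ X Bw rk).basis t)ᵀ := by
        rw [Matrix.mul_assoc, ← Matrix.mul_assoc _ ((newRep csvd V t₀ X Bw rk).basis t),
          hgram, ← Matrix.mul_assoc, mul_diagonal_of_gram hd hgram]
      have h2 : ind (T.label t) * ((newRep csvd V t₀ X Bw rk).basis t *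
          ((newRep csvd V t₀ X Bw rk).basis t)ᵀ) = (newRep csvd V t₀ X Bw rk).basis t *
          ((newRep csvd V t₀ X Bw rk).basis t)ᵀ := by
        rw [← Matrix.mul_assoc, ind_mul_basis]
      conv_lhs =>
        enter [1]
        rw [totalError_eq_sub csvd V t₀ X Bw rk ht]
      rw [Matrix.sub_mul, ind_mul_totalError, totalError_eq_sub csvd V t₀ X Bw rk ht,
        Matrix.mul_sub, h1, sub_eq_self]
      rw [sub_eq_zero, ← Matrix.transpose_inj, Matrix.transpose_mul, ind_transpose]
      simp only [Matrix.transpose_mul, Matrix.transpose_transpose]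
      exact h2
    · have h0 : localError csvd V t₀ X Bw rk t = 0 := dif_neg ht
      rw [totalError_eq, h0, zero_add, Matrix.sum_mul]
      refine Finset.sum_congr rfl fun u _ => ?_
      rw [Matrix.mul_sum, Finset.sum_eq_single u, ih u.1 u.2]
      · intro v _ hv
        have h := son_transpose_mul_son T (ind_mul_totalError csvd V t₀ X Bw rk)
          (ind_mul_totalError csvd V t₀ X Bw rk) (Ne.symm hv)
        rwa [totalError_transpose] at h
      · simp

/-- The matrix of the change from the extended to the new basis, for all clusters: `R t` in the
subtree, and `(1 | 0)` outside of it, where the extension is by zero. -/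
def changeOfBasis (t : N) : Matrix (Fin k) (Dbl k) ℝ :=
  if ht : t ∈ T.subtree t₀ then localR csvd V t₀ X Bw rk ⟨t, ht⟩ else Matrix.fromCols 1 0

theorem newRep_transfer_root : (newRep csvd V t₀ X Bw rk).transfer t₀ =
    localR csvd V t₀ X Bw rk ⟨t₀, T.self_mem_subtree t₀⟩ *
      Matrix.fromRows (V.transfer t₀) (0 : Matrix (Fin k) (Fin k) ℝ) :=
  dif_pos rfl

/-- Outside of the subtree, the new basis is the projection of the old one. -/
theorem newRep_basis_of_notMem {t : N} (ht : t ∉ T.subtree t₀) :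
    (newRep csvd V t₀ X Bw rk).basis t =
      (1 - totalError csvd V t₀ X Bw rk t) * V.basis t := by
  induction t using T.sons_induction with
  | h t ih =>
    have h0 : localError csvd V t₀ X Bw rk t = 0 := dif_neg ht
    have hleaf : (newRep csvd V t₀ X Bw rk).leaf t = V.leaf t := dif_neg ht
    have hson : ∀ u : T.sons t, (newRep csvd V t₀ X Bw rk).basis u.1 *
        (newRep csvd V t₀ X Bw rk).transfer u.1 =
        V.basis u.1 * V.transfer u.1 - totalError csvd V t₀ X Bw rk u.1 * V.basis t := by
      intro u
      have hJ : totalError csvd V t₀ X Bw rk u.1 * V.basis t =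
          totalError csvd V t₀ X Bw rk u.1 * (V.basis u.1 * V.transfer u.1) := by
        rw [← ind_mul_basis_father V u.2, ← Matrix.mul_assoc, totalError_mul_ind]
      rw [hJ]
      by_cases hu : u.1 ∈ T.subtree t₀
      · have hu₀ : u.1 = t₀ := T.eq_of_mem_sons ht u.2 hu
        rw [hu₀, newRep_transfer_root,
          ← (newRep_orthonormal_and_localR csvd V t₀ X Bw rk (T.self_mem_subtree t₀)).2.1,
          totalError_eq_sub csvd V t₀ X Bw rk (T.self_mem_subtree t₀), extBasis,
          Matrix.mul_assoc, Matrix.fromCols_mul_fromRows, Matrix.mul_zero, add_zero,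
          Matrix.sub_mul, ← Matrix.mul_assoc (ind _), ind_mul_basis]
        simp only [Matrix.mul_assoc]
        abel
      · have htr : (newRep csvd V t₀ X Bw rk).transfer u.1 = V.transfer u.1 := by
          have hne : u.1 ≠ t₀ := fun h => hu (h ▸ T.self_mem_subtree _)
          exact (dif_neg hne).trans (dif_neg hu)
        rw [htr, ih u.1 u.2 hu, Matrix.sub_mul, Matrix.one_mul, Matrix.sub_mul, Matrix.mul_assoc]
    rw [basis_eq, hleaf, Finset.sum_congr rfl fun u _ => hson u, Finset.sum_sub_distrib,
      ← Matrix.sum_mul, totalError_eq, h0, zero_add, Matrix.sub_mul, Matrix.one_mul]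
    conv_rhs =>
      enter [1]
      rw [basis_eq]
    abel

/-- The formula for the projected bases that is common to all clusters. -/
theorem newRep_basis_mul_changeOfBasis (t : N) :
    (newRep csvd V t₀ X Bw rk).basis t * changeOfBasis csvd V t₀ X Bw rk t =
      (1 - totalError csvd V t₀ X Bw rk t) * extBasis V t₀ X t := by
  by_cases ht : t ∈ T.subtree t₀
  · rw [changeOfBasis, dif_pos ht,
      ← (newRep_orthonormal_and_localR csvd V t₀ X Bw rk ht).2.1,
      totalError_eq_sub csvd V t₀ X Bw rk ht, Matrix.sub_mul, Matrix.one_mul, Matrix.sub_mul,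
      ind_mul_extBasis, Matrix.mul_assoc]
    abel
  · rw [changeOfBasis, dif_neg ht, newRep_basis_of_notMem csvd V t₀ X Bw rk ht, extBasis,
      if_neg ht, mul_fromCols, mul_fromCols, Matrix.mul_one, Matrix.mul_zero, Matrix.mul_zero]

/-! ### The truncation error -/

/-- If `Bw r` has the Gram matrix of the blocks connected to `r` and its predecessors, the local
error is at most the error of any approximation of these blocks by a matrix of rank `rk r`. -/
theorem trace_localError_le {β : Type} {r : N} (hr : r ∈ T.subtree t₀) (hrk : rk r ≤ k)
    (blk : Finset β) (cols : β → Finset κ) (Z P : Matrix ι κ ℝ) (hP : P.rank ≤ rk r)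
    (hG : ind (T.label r) * (∑ b ∈ blk, Z * ind (cols b) * Zᵀ) * ind (T.label r) =
      extBasis V t₀ X r * (Bw ⟨r, hr⟩)ᵀ * (extBasis V t₀ X r * (Bw ⟨r, hr⟩)ᵀ)ᵀ) :
    (localError csvd V t₀ X Bw rk r * ∑ b ∈ blk, Z * ind (cols b) * Zᵀ).trace ≤
      ∑ b ∈ blk, ∑ i ∈ T.label r, ∑ j ∈ cols b, (Z i j - P i j) ^ 2 := by
  classical
  obtain ⟨-, -, ⟨d, hd, hgram⟩, hV⟩ := newRep_orthonormal_and_localR csvd V t₀ X Bw rk hr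
  set U := newSons csvd V t₀ X Bw rk r
  have hU : ind (T.label r) * U = U := ind_mul_sonsBasis T (ind_mul_basis _) r
  have hU' : Uᵀ * ind (T.label r) = Uᵀ := by
    rw [← ind_transpose, ← Matrix.transpose_mul, hU]
  -- The columns of `C` select the columns of all blocks.
  let C : Matrix κ (blk × κ) ℝ := Matrix.of fun j p => if j = p.2 ∧ j ∈ cols p.1 then 1 else 0
  have hmulC : ∀ (n : Type) (A : Matrix n κ ℝ) (i : n) (p : blk × κ),
      (A * C) i p = if p.2 ∈ cols p.1 then A i p.2 else 0 := by
    intro n A i p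
    rw [Matrix.mul_apply, Finset.sum_eq_single p.2]
    · simp [C]
    · intro j _ hj
      simp [C, hj]
    · simp
  have hCC : ∀ A : Matrix ι κ ℝ, A * C * (A * C)ᵀ = ∑ b ∈ blk, A * ind (cols b) * Aᵀ := by
    intro A
    ext i j
    rw [Matrix.mul_apply, Fintype.sum_prod_type, Matrix.sum_apply,
      ← Finset.sum_coe_sort blk fun b => (A * ind (cols b) * Aᵀ) i j]
    refine Finset.sum_congr rfl fun b _ => ?_
    rw [Matrix.mul_apply]
    refine Finset.sum_congr rfl fun c _ => ?_
    rw [Matrix.transpose_apply, hmulC, hmulC, mul_ind_apply, Matrix.transpose_apply]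
    split_ifs <;> simp
  have hA : Uᵀ * (Z * C) * (Uᵀ * (Z * C))ᵀ =
      localVhat csvd V t₀ X Bw rk ⟨r, hr⟩ * (Bw ⟨r, hr⟩)ᵀ *
        (localVhat csvd V t₀ X Bw rk ⟨r, hr⟩ * (Bw ⟨r, hr⟩)ᵀ)ᵀ := by
    have h1 : Uᵀ * (Z * C) * (Uᵀ * (Z * C))ᵀ = Uᵀ * (ind (T.label r) *
        (∑ b ∈ blk, Z * ind (cols b) * Zᵀ) * ind (T.label r)) * U := by
      have h2 : Uᵀ * (ind (T.label r) * (Z * C * (Z * C)ᵀ) * ind (T.label r)) * U =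
          Uᵀ * ind (T.label r) * (Z * C * (Z * C)ᵀ) * (ind (T.label r) * U) := by
        simp only [Matrix.mul_assoc]
      rw [← hCC, h2, hU, hU', Matrix.transpose_mul Uᵀ, Matrix.transpose_transpose]
      simp only [Matrix.mul_assoc]
    rw [h1, hG, ← hV]
    simp only [Matrix.transpose_mul, Matrix.transpose_transpose, Matrix.mul_assoc]
  have hrank : (Uᵀ * (P * C)).rank ≤ rk r :=
    ((Matrix.rank_mul_le_right _ _).trans (Matrix.rank_mul_le_left _ _)).trans hP
  have hEY := trace_sub_leftSingular_le hrk
    (localVhat csvd V t₀ X Bw rk ⟨r, hr⟩ * (Bw ⟨r, hr⟩)ᵀ) (Uᵀ * (Z * C)) (Uᵀ * (P * C)) hA hrank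
  have hleft : (localError csvd V t₀ X Bw rk r * ∑ b ∈ blk, Z * ind (cols b) * Zᵀ).trace =
      ((1 - localQ csvd V t₀ X Bw rk ⟨r, hr⟩ * (localQ csvd V t₀ X Bw rk ⟨r, hr⟩)ᵀ) *
        (Uᵀ * (Z * C) * (Uᵀ * (Z * C))ᵀ)).trace := by
    rw [localError, dif_pos hr, ← hCC, Matrix.mul_assoc, Matrix.mul_assoc U, Matrix.trace_mul_comm]
    simp only [Matrix.transpose_mul, Matrix.transpose_transpose, Matrix.mul_assoc]
    rfl
  have hright : frobSq (ind (T.label r) * ((Z - P) * C)) =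
      ∑ b ∈ blk, ∑ i ∈ T.label r, ∑ j ∈ cols b, (Z i j - P i j) ^ 2 := by
    have h1 : ∀ i, (∑ p, (ind (T.label r) * ((Z - P) * C)) i p ^ 2) =
        if i ∈ T.label r then ∑ b : blk, ∑ j ∈ cols b.1, (Z i j - P i j) ^ 2 else 0 := by
      intro i
      simp only [ind_mul_apply, hmulC]
      split_ifs
      · rw [Fintype.sum_prod_type]
        refine Finset.sum_congr rfl fun b _ => ?_
        rw [← Finset.sum_filter_of_ne (s := Finset.univ) (p := fun j => j ∈ cols b.1)]
        · rw [Finset.filter_mem_eq_inter, Finset.univ_inter]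
          exact Finset.sum_congr rfl fun j hj => by rw [if_pos hj, Matrix.sub_apply]
        · intro j _ hj
          by_contra h
          exact hj (by rw [if_neg h]; simp)
      · simp
    rw [frobSq, Finset.sum_congr rfl fun i _ => h1 i, ← Finset.sum_filter,
      Finset.filter_mem_eq_inter, Finset.univ_inter, Finset.sum_comm,
      Finset.sum_coe_sort blk fun b => ∑ i ∈ T.label r, ∑ j ∈ cols b, (Z i j - P i j) ^ 2]
  have hcon := frobSq_transpose_mul_le hd hgram (ind (T.label r) * ((Z - P) * C))
  rw [← Matrix.mul_assoc, hU'] at hcon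
  rw [hleft, localQ_eq, hA, ← hright]
  refine le_trans hEY (le_of_eq_of_le ?_ hcon)
  rw [Matrix.sub_mul, Matrix.mul_sub]
  rfl

end Truncation

/-! ### Total weights -/

section Weights

variable {T : ClusterTree ι N} {k : ℕ} (V : BasisRep T k) (t₀ : N)
  (X : Matrix (T.label t₀) (Fin k) ℝ)

theorem extendZero_gram (R : Matrix (Fin k) (Fin k) ℝ) :
    (extendZero R)ᵀ * extendZero R = extendZero (Rᵀ * R) := by
  simp [extendZero, Matrix.fromBlocks_transpose, Matrix.fromBlocks_multiply]

/-- The basis weights, completed by stored ones, have the Gram matrices of the extended basis. -/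
theorem completed_basisWeights_gram (cqr : ℕ) (w : N → Matrix (Fin k) (Fin k) ℝ)
    (hw : ∀ t, t ∉ T.subtree t₀ → (w t)ᵀ * w t = (V.basis t)ᵀ * V.basis t)
    {R : N → Matrix (Dbl k) (Dbl k) ℝ}
    (hR : R = fun t => if h : t ∈ T.subtree t₀ then (basisWeights cqr T V t₀ X).val ⟨t, h⟩
      else extendZero (w t)) (t : N) :
    (R t)ᵀ * R t = (extBasis V t₀ X t)ᵀ * extBasis V t₀ X t := by
  rw [hR]
  dsimp only
  split_ifs with h
  · exact basisWeights_gram V t₀ X cqr h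
  · rw [extendZero_gram, hw t h, extBasis, if_neg h, Matrix.transpose_fromCols,
      Matrix.fromRows_mul_fromCols, extendZero]
    simp

theorem totalWeights_val (cqr : ℕ) (adj : N → Finset M) (S : N → M → Matrix (Fin k) (Fin k) ℝ)
    (R : M → Matrix (Dbl k) (Dbl k) ℝ) (init : Matrix (Dbl k) (Dbl k) ℝ) (t : T.subtree t₀) :
    (totalWeights cqr T V t₀ adj S R init).val t = (Counted.qr cqr (Matrix.fromRows
      (stack fun s : adj t.1 => R s.1 * (extendOne (S t.1 s.1))ᵀ)
      ((if h : t.1 = t₀ then init else (totalWeights cqr T V t₀ adj S R init).val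
        ⟨T.father t.1, T.father_mem_subtree t.2 h⟩) * (extendOne (V.transfer t.1))ᵀ))).val := by
  conv_lhs => rw [totalWeights, sweepDown]
  dsimp only
  rw [sweepDownArg]
  rfl

/-- The total weights have the Gram matrices of the blocks connected to a cluster or to one of its
predecessors. -/
theorem totalWeights_gram_blocks {β : Type} (cqr : ℕ) (adj : N → Finset M)
    (S : N → M → Matrix (Fin k) (Fin k) ℝ) (R : M → Matrix (Dbl k) (Dbl k) ℝ)
    (init : Matrix (Dbl k) (Dbl k) ℝ) (blk : N → Finset β) (pair : N → M → β)
    (g : β → Matrix ι ι ℝ)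
    (hsum : ∀ t ∈ T.subtree t₀, t ≠ t₀ →
      ∑ b ∈ blk t, g b = ∑ b ∈ blk (T.father t), g b + ∑ s ∈ adj t, g (pair t s))
    (h₀ : ind (T.label t₀) * (∑ b ∈ blk t₀, g b) * ind (T.label t₀) =
      ind (T.label t₀) * (∑ s ∈ adj t₀, g (pair t₀ s)) * ind (T.label t₀) +
        (init * (extendOne (V.transfer t₀))ᵀ * (extBasis V t₀ X t₀)ᵀ)ᵀ *
          (init * (extendOne (V.transfer t₀))ᵀ * (extBasis V t₀ X t₀)ᵀ))
    (hadj : ∀ t ∈ T.subtree t₀, ∀ s ∈ adj t,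
      ind (T.label t) * g (pair t s) * ind (T.label t) =
        (R s * (extendOne (S t s))ᵀ * (extBasis V t₀ X t)ᵀ)ᵀ *
          (R s * (extendOne (S t s))ᵀ * (extBasis V t₀ X t)ᵀ))
    {t : N} (ht : t ∈ T.subtree t₀) :
    ind (T.label t) * (∑ b ∈ blk t, g b) * ind (T.label t) =
      extBasis V t₀ X t * ((totalWeights cqr T V t₀ adj S R init).val ⟨t, ht⟩)ᵀ *
        (extBasis V t₀ X t * ((totalWeights cqr T V t₀ adj S R init).val ⟨t, ht⟩)ᵀ)ᵀ := by
  have hgram : ∀ t (ht : t ∈ T.subtree t₀),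
      extBasis V t₀ X t * ((totalWeights cqr T V t₀ adj S R init).val ⟨t, ht⟩)ᵀ *
        (extBasis V t₀ X t * ((totalWeights cqr T V t₀ adj S R init).val ⟨t, ht⟩)ᵀ)ᵀ =
      ind (T.label t) * (∑ s ∈ adj t, g (pair t s)) * ind (T.label t) +
        ((if h : t = t₀ then init else (totalWeights cqr T V t₀ adj S R init).val
          ⟨T.father t, T.father_mem_subtree ht h⟩) * (extendOne (V.transfer t))ᵀ *
            (extBasis V t₀ X t)ᵀ)ᵀ *
        ((if h : t = t₀ then init else (totalWeights cqr T V t₀ adj S R init).val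
          ⟨T.father t, T.father_mem_subtree ht h⟩) * (extendOne (V.transfer t))ᵀ *
            (extBasis V t₀ X t)ᵀ) := by
    intro t ht
    rw [Matrix.transpose_mul (extBasis V t₀ X t), Matrix.transpose_transpose, Matrix.mul_assoc,
      ← Matrix.mul_assoc _ _ (extBasis V t₀ X t)ᵀ, totalWeights_val, qr_val_gram, fromRows_gram,
      stack_gram, Matrix.add_mul, Matrix.mul_add, Matrix.mul_sum, Matrix.sum_mul,
      ← Finset.sum_coe_sort (adj t), Matrix.sum_mul, Matrix.mul_sum]
    congr 1
    · refine Finset.sum_congr rfl fun s _ => ?_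
      rw [hadj t ht s.1 s.2]
      simp only [Matrix.transpose_mul, Matrix.transpose_transpose, Matrix.mul_assoc]
    · simp only [Matrix.transpose_mul, Matrix.transpose_transpose, Matrix.mul_assoc]
  suffices H : ∀ ht : t ∈ T.subtree t₀, ind (T.label t) * (∑ b ∈ blk t, g b) * ind (T.label t) =
      extBasis V t₀ X t * ((totalWeights cqr T V t₀ adj S R init).val ⟨t, ht⟩)ᵀ *
        (extBasis V t₀ X t * ((totalWeights cqr T V t₀ adj S R init).val ⟨t, ht⟩)ᵀ)ᵀ from H ht
  refine T.subtree_induction (p := fun t => ∀ ht : t ∈ T.subtree t₀,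
    ind (T.label t) * (∑ b ∈ blk t, g b) * ind (T.label t) =
      extBasis V t₀ X t * ((totalWeights cqr T V t₀ adj S R init).val ⟨t, ht⟩)ᵀ *
        (extBasis V t₀ X t * ((totalWeights cqr T V t₀ adj S R init).val ⟨t, ht⟩)ᵀ)ᵀ) ?_ ?_ ht
  · intro ht
    rw [hgram, h₀, dif_pos rfl]
  · intro t ht htt ih _
    have hf := T.father_mem_subtree ht htt
    have hson := T.mem_sons_father ht htt
    have hE : ind (T.label t) * extBasis V t₀ X (T.father t) =
        extBasis V t₀ X t * extendOne (V.transfer t) := by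
      rw [extBasis_eq V t₀ X hf]
      refine ind_mul_sum_sons
        (Ψ := fun u => extBasis V t₀ X u * extendOne (V.transfer u)) (fun u => ?_) ⟨t, hson⟩ _
      rw [← Matrix.mul_assoc, ind_mul_extBasis]
    have hind := ind_mul_ind_of_subset (T.label_son_subset hson)
    have hind' : ind (T.label t) * ind (T.label (T.father t)) = ind (T.label t) := by
      rw [← Matrix.transpose_inj, Matrix.transpose_mul, ind_transpose, ind_transpose, hind]
    have h1 : ind (T.label t) * (∑ b ∈ blk (T.father t), g b) * ind (T.label t) =
        ind (T.label t) * (ind (T.label (T.father t)) * (∑ b ∈ blk (T.father t), g b) *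
          ind (T.label (T.father t))) * ind (T.label t) := by
      have e : ind (T.label t) * (ind (T.label (T.father t)) * (∑ b ∈ blk (T.father t), g b) *
          ind (T.label (T.father t))) * ind (T.label t) =
          ind (T.label t) * ind (T.label (T.father t)) * (∑ b ∈ blk (T.father t), g b) *
            (ind (T.label (T.father t)) * ind (T.label t)) := by
        simp only [Matrix.mul_assoc]
      rw [e, hind, hind']
    rw [hgram, dif_neg htt, hsum t ht htt, Matrix.mul_add, Matrix.add_mul, add_comm, h1, ih hf]
    congr 1
    have hE' : (extBasis V t₀ X (T.father t))ᵀ * ind (T.label t) =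
        (extendOne (V.transfer t))ᵀ * (extBasis V t₀ X t)ᵀ := by
      rw [← Matrix.transpose_mul, ← hE, Matrix.transpose_mul, ind_transpose]
    simp only [Matrix.transpose_mul, Matrix.transpose_transpose, Matrix.mul_assoc, hE']
    rw [← Matrix.mul_assoc (ind (T.label t)), hE, Matrix.mul_assoc]

/-- The Gram matrix of the blocks connected to the predecessors of `t₀`, from the stored total
weight of the father of `t₀`. -/
theorem initial_weight_gram {β : Type} (h : t₀ ≠ T.root) (blk : Finset β) (cols : β → Finset κ)
    (Z Zt : Matrix ι κ ℝ) (R : Matrix (Fin k) (Fin k) ℝ)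
    (hR : IsTotalWeight (V.basis (T.father t₀)) (T.label (T.father t₀)) blk cols Z R)
    (hZ : ∀ b ∈ blk, ∀ i ∈ T.label t₀, ∀ j ∈ cols b, Zt i j = Z i j) :
    ind (T.label t₀) * (∑ b ∈ blk, Zt * ind (cols b) * Ztᵀ) * ind (T.label t₀) =
      (extendZero R * (extendOne (V.transfer t₀))ᵀ * (extBasis V t₀ X t₀)ᵀ)ᵀ *
        (extendZero R * (extendOne (V.transfer t₀))ᵀ * (extBasis V t₀ X t₀)ᵀ) := by
  obtain ⟨F, hF, hRF⟩ := hR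
  have hson : t₀ ∈ T.sons (T.father t₀) := T.mem_sons.2 ⟨h, rfl⟩
  have hblk : ∀ b ∈ blk, ind (T.label t₀) * Zt * ind (cols b) =
      V.basis t₀ * V.transfer t₀ * ((F b)ᵀ * ind (cols b)) := by
    intro b hb
    rw [← ind_mul_basis_father V hson, Matrix.mul_assoc (ind _) (V.basis _), ← Matrix.mul_assoc]
    ext i j
    rw [mul_ind_apply, ← Matrix.mul_assoc, Matrix.mul_assoc (ind _), mul_ind_apply, ind_mul_apply,
      ind_mul_apply]
    split_ifs with hj hi
    · rw [hZ b hb i hi j hj, hF b hb i (T.label_son_subset hson hi) j hj]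
    · rfl
    · rfl
  have hgram : Rᵀ * R = ∑ b ∈ blk, (F b)ᵀ * ind (cols b) * F b := by
    ext a c
    rw [hRF, Matrix.sum_apply]
    refine Finset.sum_congr rfl fun b _ => ?_
    rw [Matrix.mul_apply]
    simp only [mul_ind_apply, ite_mul, zero_mul, Matrix.transpose_apply]
    rw [← Finset.sum_filter, Finset.filter_mem_eq_inter, Finset.univ_inter]
  have hright : extendZero R * (extendOne (V.transfer t₀))ᵀ * (extBasis V t₀ X t₀)ᵀ =
      Matrix.fromRows (R * (V.basis t₀ * V.transfer t₀)ᵀ) 0 := by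
    rw [Matrix.mul_assoc, ← Matrix.transpose_mul, extBasis, fromCols_mul_extendOne,
      Matrix.transpose_fromCols, extendZero, Matrix.fromBlocks_mul_fromRows]
    simp
  rw [hright, fromRows_gram, Matrix.transpose_zero, Matrix.zero_mul, add_zero,
    Matrix.transpose_mul R, Matrix.transpose_transpose, ← Matrix.mul_assoc,
    Matrix.mul_assoc _ Rᵀ R, hgram, Matrix.mul_sum, Matrix.sum_mul, Matrix.mul_sum, Matrix.sum_mul]
  refine Finset.sum_congr rfl fun b hb => ?_
  have h1 : ind (T.label t₀) * (Zt * ind (cols b) * Ztᵀ) * ind (T.label t₀) =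
      ind (T.label t₀) * Zt * ind (cols b) * (ind (T.label t₀) * Zt * ind (cols b))ᵀ := by
    simp only [Matrix.transpose_mul, ind_transpose, Matrix.mul_assoc]
    rw [← Matrix.mul_assoc (ind (cols b)) (ind (cols b)), ind_mul_self]
  have h2 : ∀ A : Matrix κ ι ℝ, ind (cols b) * (ind (cols b) * A) = ind (cols b) * A := by
    intro A
    rw [← Matrix.mul_assoc, ind_mul_self]
  rw [h1, hblk b hb]
  simp only [Matrix.transpose_mul, ind_transpose, Matrix.mul_assoc, Matrix.transpose_transpose, h2]

theorem trace_totalError (csvd : ℕ) (Bw : T.subtree t₀ → Matrix (Dbl k) (Dbl k) ℝ) (rk : N → ℕ)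
    (Z : Matrix ι κ ℝ) (t : N) (c : Finset κ) :
    (totalError csvd V t₀ X Bw rk t *
      ((ind (T.label t) * Z * ind c) * (ind (T.label t) * Z * ind c)ᵀ)).trace =
      ∑ r ∈ T.subtree t, (localError csvd V t₀ X Bw rk r * (Z * ind c * Zᵀ)).trace := by
  have h1 : (totalError csvd V t₀ X Bw rk t *
      ((ind (T.label t) * Z * ind c) * (ind (T.label t) * Z * ind c)ᵀ)).trace =
      (ind (T.label t) * (totalError csvd V t₀ X Bw rk t * ind (T.label t)) *
        (Z * ind c * Zᵀ)).trace := by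
    rw [Matrix.mul_assoc (ind (T.label t)) (totalError csvd V t₀ X Bw rk t * _),
      Matrix.trace_mul_comm (ind (T.label t))]
    congr 1
    simp only [Matrix.transpose_mul, ind_transpose, Matrix.mul_assoc]
    rw [← Matrix.mul_assoc (ind c) (ind c), ind_mul_self]
  rw [h1, totalError_mul_ind, ind_mul_totalError, totalError, Matrix.sum_mul, Matrix.trace_sum]

end Weights

/-! ### The updated matrix -/

section Blocks

variable {TI : ClusterTree ι N} {TJ : ClusterTree κ M} (B : BlockTree TI TJ)

namespace BlockTree

theorem mem_row {t : N} {s : M} : s ∈ B.row t ↔ (t, s) ∈ B.admissible := by simp [row]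

theorem mem_col {t : N} {s : M} : t ∈ B.col s ↔ (t, s) ∈ B.admissible := by simp [col]

theorem mem_rowBlocks {t : N} {b : N × M} :
    b ∈ B.rowBlocks t ↔ b ∈ B.admissible ∧ t ∈ TI.subtree b.1 := by simp [rowBlocks]

theorem mem_colBlocks {s : M} {b : N × M} :
    b ∈ B.colBlocks s ↔ b ∈ B.admissible ∧ s ∈ TJ.subtree b.2 := by simp [colBlocks]

theorem sum_rowBlocks {α : Type} [AddCommMonoid α] (g : N × M → α) {t : N} (ht : t ≠ TI.root) :
    ∑ b ∈ B.rowBlocks t, g b =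
      ∑ b ∈ B.rowBlocks (TI.father t), g b + ∑ s ∈ B.row t, g (t, s) := by
  have h : B.rowBlocks t = B.rowBlocks (TI.father t) ∪ (B.row t).image (Prod.mk t) := by
    ext b
    simp only [mem_rowBlocks, Finset.mem_union, Finset.mem_image, mem_row,
      TI.mem_subtree_iff_father ht]
    constructor
    · rintro ⟨hb, rfl | h⟩
      · exact Or.inr ⟨b.2, hb, rfl⟩
      · exact Or.inl ⟨hb, h⟩
    · rintro (⟨hb, h⟩ | ⟨s, hs, rfl⟩)
      · exact ⟨hb, Or.inr h⟩
      · exact ⟨hs, Or.inl rfl⟩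
  rw [h, Finset.sum_union, Finset.sum_image fun _ _ _ _ h => (Prod.mk.inj h).2]
  rw [Finset.disjoint_left]
  intro b hb hb'
  obtain ⟨s, -, rfl⟩ := Finset.mem_image.1 hb'
  exact TI.father_notMem_subtree ht ((B.mem_rowBlocks).1 hb).2

theorem sum_rowBlocks_root {α : Type} [AddCommMonoid α] (g : N × M → α) :
    ∑ b ∈ B.rowBlocks TI.root, g b = ∑ s ∈ B.row TI.root, g (TI.root, s) := by
  have h : B.rowBlocks TI.root = (B.row TI.root).image (Prod.mk TI.root) := by
    ext b
    simp only [mem_rowBlocks, Finset.mem_image, mem_row, TI.root_mem_subtree]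
    constructor
    · rintro ⟨hb, h⟩
      exact ⟨b.2, h ▸ hb, by rw [← h]⟩
    · rintro ⟨s, hs, rfl⟩
      exact ⟨hs, rfl⟩
  rw [h, Finset.sum_image fun _ _ _ _ h => (Prod.mk.inj h).2]

theorem sum_colBlocks {α : Type} [AddCommMonoid α] (g : N × M → α) {s : M} (hs : s ≠ TJ.root) :
    ∑ b ∈ B.colBlocks s, g b =
      ∑ b ∈ B.colBlocks (TJ.father s), g b + ∑ t ∈ B.col s, g (t, s) := by
  have h : B.colBlocks s = B.colBlocks (TJ.father s) ∪ (B.col s).image fun t => (t, s) := by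
    ext b
    simp only [mem_colBlocks, Finset.mem_union, Finset.mem_image, mem_col,
      TJ.mem_subtree_iff_father hs]
    constructor
    · rintro ⟨hb, rfl | h⟩
      · exact Or.inr ⟨b.1, hb, rfl⟩
      · exact Or.inl ⟨hb, h⟩
    · rintro (⟨hb, h⟩ | ⟨t, ht, rfl⟩)
      · exact ⟨hb, Or.inr h⟩
      · exact ⟨ht, Or.inl rfl⟩
  rw [h, Finset.sum_union, Finset.sum_image fun _ _ _ _ h => (Prod.mk.inj h).1]
  rw [Finset.disjoint_left]
  intro b hb hb'
  obtain ⟨t, -, rfl⟩ := Finset.mem_image.1 hb'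
  exact TJ.father_notMem_subtree hs ((B.mem_colBlocks).1 hb).2

theorem sum_colBlocks_root {α : Type} [AddCommMonoid α] (g : N × M → α) :
    ∑ b ∈ B.colBlocks TJ.root, g b = ∑ t ∈ B.col TJ.root, g (t, TJ.root) := by
  have h : B.colBlocks TJ.root = (B.col TJ.root).image fun t => (t, TJ.root) := by
    ext b
    simp only [mem_colBlocks, Finset.mem_image, mem_col, TJ.root_mem_subtree]
    constructor
    · rintro ⟨hb, h⟩
      exact ⟨b.1, h ▸ hb, by rw [← h]⟩
    · rintro ⟨s, hs, rfl⟩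
      exact ⟨hs, rfl⟩
  rw [h, Finset.sum_image fun _ _ _ _ h => (Prod.mk.inj h).1]

/-- A matrix can be prescribed on the admissible leaves and on the rest independently. -/
theorem exists_matrix (F : N × M → Matrix ι κ ℝ) (C : Matrix ι κ ℝ) :
    ∃ Z : Matrix ι κ ℝ,
      (∀ b ∈ B.admissible, ∀ i ∈ TI.label b.1, ∀ j ∈ TJ.label b.2, Z i j = F b i j) ∧
      ∀ b ∈ B.inadmissible, ∀ i ∈ TI.label b.1, ∀ j ∈ TJ.label b.2, Z i j = C i j := by
  classical
  refine ⟨Matrix.of fun i j => if h : ∃ b ∈ B.admissible, i ∈ TI.label b.1 ∧ j ∈ TJ.label b.2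
    then F h.choose i j else C i j, fun b hb i hi j hj => ?_, fun b hb i hi j hj => ?_⟩
  · have h : ∃ b ∈ B.admissible, i ∈ TI.label b.1 ∧ j ∈ TJ.label b.2 := ⟨b, hb, hi, hj⟩
    have hc := h.choose_spec
    have heq : h.choose = b := B.leaf_unique (B.admissible_leaf _ hc.1).1
      (B.admissible_leaf _ hb).1 (B.admissible_leaf _ hc.1).2 (B.admissible_leaf _ hb).2
      hc.2.1 hc.2.2 hi hj
    rw [Matrix.of_apply, dif_pos h, heq]
  · rw [Matrix.of_apply, dif_neg]
    rintro ⟨c, hc, hic, hjc⟩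
    obtain ⟨hb1, hb2, hb3⟩ := B.mem_inadmissible.1 hb
    exact hb3 (B.leaf_unique (B.admissible_leaf _ hc).1 hb1 (B.admissible_leaf _ hc).2 hb2
      hic hjc hi hj ▸ hc)

end BlockTree

theorem zeroExtend_mul_apply_eq_zero {k : ℕ} {a : Finset ι} {c : Finset κ}
    (X : Matrix a (Fin k) ℝ) (Y : Matrix c (Fin k) ℝ) {i : ι} {j : κ} (h : i ∉ a ∨ j ∉ c) :
    (zeroExtend X * (zeroExtend Y)ᵀ) i j = 0 := by
  rw [Matrix.mul_apply]
  refine Finset.sum_eq_zero fun x _ => ?_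
  rcases h with h | h <;> simp [zeroExtend, h]

variable {B} {k : ℕ} (G : HTwoRep B k) {t₀ : N} {s₀ : M} (X : Matrix (TI.label t₀) (Fin k) ℝ)
  (Y : Matrix (TJ.label s₀) (Fin k) ℝ)

/-- The low-rank matrix only affects leaves with both clusters in the subtrees. -/
theorem lowRank_apply_eq_zero (h₀ : (t₀, s₀) ∈ B.blocks) {b : N × M} (hb : b ∈ B.blocks) (hleaf : B.sons b = ∅)
    (hns : ¬(b.1 ∈ TI.subtree t₀ ∧ b.2 ∈ TJ.subtree s₀)) {i : ι} {j : κ}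
    (hi : i ∈ TI.label b.1) (hj : j ∈ TJ.label b.2) :
    (zeroExtend X * (zeroExtend Y)ᵀ) i j = 0 := by
  refine zeroExtend_mul_apply_eq_zero X Y ?_
  by_contra! h
  exact hns (BlockTree.mem_subtree_of_reflTransGen B
    (B.reflTransGen_leaf h₀ hb hleaf h.1 h.2 hi hj))

/-- The extended bases represent the admissible blocks of the sum. -/
theorem ind_mul_add_lowRank (h₀ : (t₀, s₀) ∈ B.blocks) {Z : Matrix ι κ ℝ} (hG : G.Represents Z) {b : N × M}
    (hb : b ∈ B.admissible) :
    ind (TI.label b.1) * (Z + zeroExtend X * (zeroExtend Y)ᵀ) * ind (TJ.label b.2) =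
      extBasis G.row t₀ X b.1 * extendOne (G.coupling b.1 b.2) *
        (extBasis G.col s₀ Y b.2)ᵀ := by
  obtain ⟨hbl, hleaf⟩ := B.admissible_leaf b hb
  have h1 : extBasis G.row t₀ X b.1 * extendOne (G.coupling b.1 b.2) *
      (extBasis G.col s₀ Y b.2)ᵀ =
      G.row.basis b.1 * G.coupling b.1 b.2 * (G.col.basis b.2)ᵀ +
      (if b.1 ∈ TI.subtree t₀ then ind (TI.label b.1) * zeroExtend X else 0) *
      (if b.2 ∈ TJ.subtree s₀ then ind (TJ.label b.2) * zeroExtend Y else 0)ᵀ := by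
    rw [extBasis, fromCols_mul_extendOne, extBasis, Matrix.transpose_fromCols,
      Matrix.fromCols_mul_fromRows]
  have h2 : (if b.1 ∈ TI.subtree t₀ then ind (TI.label b.1) * zeroExtend X else 0) *
      (if b.2 ∈ TJ.subtree s₀ then ind (TJ.label b.2) * zeroExtend Y else 0)ᵀ =
      ind (TI.label b.1) * (zeroExtend X * (zeroExtend Y)ᵀ) * ind (TJ.label b.2) := by
    by_cases hin : b.1 ∈ TI.subtree t₀ ∧ b.2 ∈ TJ.subtree s₀
    · rw [if_pos hin.1, if_pos hin.2, Matrix.transpose_mul, ind_transpose]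
      simp only [Matrix.mul_assoc]
    · have hz : ind (TI.label b.1) * (zeroExtend X * (zeroExtend Y)ᵀ) * ind (TJ.label b.2) = 0 := by
        ext i j
        rw [mul_ind_apply, ind_mul_apply]
        split_ifs with hj hi
        · exact lowRank_apply_eq_zero X Y h₀ hbl hleaf hin hi hj
        · rfl
        · rfl
      rw [hz]
      rcases not_and_or.1 hin with h | h <;> simp [h]
  rw [h1, h2, Matrix.mul_add, Matrix.add_mul]
  congr 1
  ext i j
  rw [mul_ind_apply, ind_mul_apply]
  have h3 : ind (TI.label b.1) * (G.row.basis b.1 * G.coupling b.1 b.2 * (G.col.basis b.2)ᵀ) *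
      ind (TJ.label b.2) = G.row.basis b.1 * G.coupling b.1 b.2 * (G.col.basis b.2)ᵀ := by
    rw [← Matrix.mul_assoc, ← Matrix.mul_assoc, ind_mul_basis, Matrix.mul_assoc _ _ (ind _),
      ← ind_transpose, ← Matrix.transpose_mul, ind_mul_basis]
  rw [← h3, mul_ind_apply, ind_mul_apply]
  split_ifs with hj hi
  · exact hG.1 b hb i hi j hj
  · rfl
  · rfl

end Blocks

section Update

variable {TI : ClusterTree ι N} {TJ : ClusterTree κ M} {B : BlockTree TI TJ} {k : ℕ}
  (csvd : ℕ) (G : HTwoRep B k) {t₀ : N} {s₀ : M} (X : Matrix (TI.label t₀) (Fin k) ℝ)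
  (Y : Matrix (TJ.label s₀) (Fin k) ℝ) (BV : TI.subtree t₀ → Matrix (Dbl k) (Dbl k) ℝ)
  (BW : TJ.subtree s₀ → Matrix (Dbl k) (Dbl k) ℝ) (rkI : N → ℕ) (rkJ : M → ℕ)

/-- The result of the update for arbitrary total weight matrices. -/
def updated : HTwoRep B k where
  row := newRep csvd G.row t₀ X BV rkI
  col := newRep csvd G.col s₀ Y BW rkJ
  coupling t s := (newCoupling G t₀ s₀ (localR csvd G.row t₀ X BV rkI)
    (localR csvd G.col s₀ Y BW rkJ) t s).val
  near t s := (newNear G t₀ s₀ X Y t s).val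

theorem extendOne_mul_fromCols_transpose (S : Matrix (Fin k) (Fin k) ℝ) :
    extendOne S * (Matrix.fromCols (1 : Matrix (Fin k) (Fin k) ℝ) (0 : Matrix (Fin k) (Fin k) ℝ))ᵀ =
      Matrix.fromRows S 0 := by
  rw [extendOne, Matrix.transpose_fromCols, Matrix.fromBlocks_mul_fromRows]
  simp

/-- The four cases of the update of the coupling matrices in one formula. -/
theorem updated_coupling {t : N} {s : M} (h : (t, s) ∈ B.admissible) :
    (updated csvd G X Y BV BW rkI rkJ).coupling t s =
      changeOfBasis csvd G.row t₀ X BV rkI t * extendOne (G.coupling t s) *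
        (changeOfBasis csvd G.col s₀ Y BW rkJ s)ᵀ := by
  simp only [updated, newCoupling, if_pos h, changeOfBasis]
  split_ifs with ht hs hs
  · rfl
  · rw [Matrix.mul_assoc, extendOne_mul_fromCols_transpose]
    rfl
  · rw [fromCols_mul_extendOne, Matrix.one_mul]
    rfl
  · rw [Matrix.mul_assoc, extendOne_mul_fromCols_transpose, Matrix.fromCols_mul_fromRows]
    simp
    rfl

/-- On an admissible block, the update is the projection of the sum from both sides. -/
theorem updated_block (h₀ : (t₀, s₀) ∈ B.blocks) {Z : Matrix ι κ ℝ} (hG : G.Represents Z)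
    {b : N × M} (hb : b ∈ B.admissible) :
    (updated csvd G X Y BV BW rkI rkJ).row.basis b.1 *
        (updated csvd G X Y BV BW rkI rkJ).coupling b.1 b.2 *
        ((updated csvd G X Y BV BW rkI rkJ).col.basis b.2)ᵀ =
      (1 - totalError csvd G.row t₀ X BV rkI b.1) *
        (ind (TI.label b.1) * (Z + zeroExtend X * (zeroExtend Y)ᵀ) * ind (TJ.label b.2)) *
        (1 - totalError csvd G.col s₀ Y BW rkJ b.2) := by
  have h1 := newRep_basis_mul_changeOfBasis csvd G.row t₀ X BV rkI b.1
  have h2 := congrArg Matrix.transpose (newRep_basis_mul_changeOfBasis csvd G.col s₀ Y BW rkJ b.2)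
  rw [Matrix.transpose_mul, Matrix.transpose_mul, Matrix.transpose_sub, Matrix.transpose_one,
    totalError_transpose] at h2
  rw [ind_mul_add_lowRank G X Y h₀ hG hb, updated_coupling csvd G X Y BV BW rkI rkJ hb]
  simp only [Matrix.mul_assoc] at h1 h2 ⊢
  rw [← h2, ← Matrix.mul_assoc (1 - totalError csvd G.row t₀ X BV rkI b.1), ← h1]
  simp only [Matrix.mul_assoc]
  rfl

/-- The nearfield is exact. -/
theorem updated_near (h₀ : (t₀, s₀) ∈ B.blocks) {Z : Matrix ι κ ℝ} (hG : G.Represents Z)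
    {b : N × M} (hb : b ∈ B.inadmissible) (i : TI.label b.1) (j : TJ.label b.2) :
    (updated csvd G X Y BV BW rkI rkJ).near b.1 b.2 i j =
      (Z + zeroExtend X * (zeroExtend Y)ᵀ) i j := by
  obtain ⟨hbl, hleaf, -⟩ := B.mem_inadmissible.1 hb
  rw [Matrix.add_apply, hG.2 b hb i j]
  simp only [updated, newNear]
  split_ifs with h
  · simp [Counted.addMul, Matrix.mul_apply]
  · rw [lowRank_apply_eq_zero X Y h₀ hbl hleaf (fun h' => h ⟨hb, h'⟩) i.2 j.2, add_zero]
    rfl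

theorem totalError_apply_eq_zero {T : ClusterTree ι N} (V : BasisRep T k) {t₁ : N}
    (X : Matrix (T.label t₁) (Fin k) ℝ) (Bw : T.subtree t₁ → Matrix (Dbl k) (Dbl k) ℝ)
    (rk : N → ℕ) (t : N) {i : ι} (hi : i ∉ T.label t₁) (j : ι) :
    totalError csvd V t₁ X Bw rk t i j = 0 :=
  apply_eq_zero_of_ind_mul (ind_root_mul_totalError csvd V t₁ X Bw rk t) hi j

/-- The matrix represented by the updated data, and its error in terms of the local projection
errors in the row and the column clusters. -/
theorem exists_updated_matrix (h₀ : (t₀, s₀) ∈ B.blocks) {Z : Matrix ι κ ℝ}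
    (hG : G.Represents Z) :
    ∃ Z' : Matrix ι κ ℝ, (updated csvd G X Y BV BW rkI rkJ).Represents Z' ∧
      IsHTwoMatrix B (updated csvd G X Y BV BW rkI rkJ).row.basis
        (updated csvd G X Y BV BW rkI rkJ).col.basis Z' ∧
      (∀ i j, i ∉ TI.label t₀ → j ∉ TJ.label s₀ → Z' i j = Z i j) ∧
      (∀ b ∈ B.inadmissible, ∀ i ∈ TI.label b.1, ∀ j ∈ TJ.label b.2,
        Z' i j = (Z + zeroExtend X * (zeroExtend Y)ᵀ) i j) ∧
      ∑ i, ∑ j, (Z' i j - (Z + zeroExtend X * (zeroExtend Y)ᵀ) i j) ^ 2 ≤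
        (∑ t ∈ TI.subtree t₀, (localError csvd G.row t₀ X BV rkI t * ∑ b ∈ B.rowBlocks t,
          (Z + zeroExtend X * (zeroExtend Y)ᵀ) * ind (TJ.label b.2) *
            (Z + zeroExtend X * (zeroExtend Y)ᵀ)ᵀ).trace) +
        ∑ s ∈ TJ.subtree s₀, (localError csvd G.col s₀ Y BW rkJ s * ∑ b ∈ B.colBlocks s,
          (Z + zeroExtend X * (zeroExtend Y)ᵀ)ᵀ * ind (TI.label b.1) *
            (Z + zeroExtend X * (zeroExtend Y)ᵀ)ᵀᵀ).trace := by
  set Zt := Z + zeroExtend X * (zeroExtend Y)ᵀ with hZt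
  set U := updated csvd G X Y BV BW rkI rkJ with hU
  obtain ⟨Z', hadm, hinadm⟩ := B.exists_matrix
    (fun b => U.row.basis b.1 * U.coupling b.1 b.2 * (U.col.basis b.2)ᵀ) Zt
  refine ⟨Z', ⟨hadm, fun b hb i j => ?_⟩, ⟨isClusterBasis_basis _, isClusterBasis_basis _,
    fun b hb => ⟨_, hadm b hb⟩⟩, ?_, hinadm, ?_⟩
  · rw [hinadm b hb i i.2 j j.2, hU, updated_near csvd G X Y BV BW rkI rkJ h₀ hG hb]
  · intro i j hi hj
    have hz : Zt i j = Z i j := by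
      rw [hZt, Matrix.add_apply, zeroExtend_mul_apply_eq_zero X Y (Or.inl hi), add_zero]
    rcases B.exists_admissible_or_inadmissible i j with ⟨b, hb, hib, hjb⟩ | ⟨b, hb, hib, hjb⟩
    · rw [hadm b hb i hib j hjb, hU, updated_block csvd G X Y BV BW rkI rkJ h₀ hG hb, ← hZt]
      have hleft : ∀ A : Matrix ι κ ℝ,
          ((1 - totalError csvd G.row t₀ X BV rkI b.1) * A : Matrix ι κ ℝ) i j = A i j := by
        intro A
        rw [Matrix.sub_mul, Matrix.one_mul, Matrix.sub_apply, Matrix.mul_apply,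
          Finset.sum_eq_zero, sub_zero]
        intro x _
        rw [totalError_apply_eq_zero csvd G.row X BV rkI b.1 hi, zero_mul]
      have hright : ∀ A : Matrix ι κ ℝ,
          (A * (1 - totalError csvd G.col s₀ Y BW rkJ b.2) : Matrix ι κ ℝ) i j = A i j := by
        intro A
        rw [Matrix.mul_sub, Matrix.mul_one, Matrix.sub_apply, Matrix.mul_apply,
          Finset.sum_eq_zero, sub_zero]
        intro x _
        rw [← totalError_transpose, Matrix.transpose_apply,
          totalError_apply_eq_zero csvd G.col Y BW rkJ b.2 hj, mul_zero]
      rw [hright, hleft, mul_ind_apply, if_pos hjb, ind_mul_apply, if_pos hib, hz]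
    · rw [hinadm b hb i hib j hjb, hz]
  · -- Each entry is charged to the leaf that contains it; inadmissible leaves are exact.
    have hcover : ∀ p : ι × κ, (Z' p.1 p.2 - Zt p.1 p.2) ^ 2 ≤
        ∑ b ∈ B.admissible, if p.1 ∈ TI.label b.1 ∧ p.2 ∈ TJ.label b.2 then
          (Z' p.1 p.2 - Zt p.1 p.2) ^ 2 else 0 := by
      rintro ⟨i, j⟩
      have hnn : ∀ b ∈ B.admissible, 0 ≤ if i ∈ TI.label b.1 ∧ j ∈ TJ.label b.2 then
          (Z' i j - Zt i j) ^ 2 else 0 := by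
        intro b _
        split_ifs
        · exact sq_nonneg _
        · exact le_rfl
      rcases B.exists_admissible_or_inadmissible i j with ⟨b, hb, hij⟩ | ⟨b, hb, hib, hjb⟩
      · refine le_trans (le_of_eq ?_) (Finset.single_le_sum hnn hb)
        rw [if_pos hij]
      · dsimp only
        rw [hinadm b hb i hib j hjb, sub_self, zero_pow two_ne_zero]
        exact Finset.sum_nonneg fun b _ => by split_ifs <;> simp
    have hblock : ∀ b ∈ B.admissible, (∑ p : ι × κ, if p.1 ∈ TI.label b.1 ∧ p.2 ∈ TJ.label b.2
        then (Z' p.1 p.2 - Zt p.1 p.2) ^ 2 else 0) ≤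
        (∑ t ∈ TI.subtree b.1, (localError csvd G.row t₀ X BV rkI t *
          (Zt * ind (TJ.label b.2) * Ztᵀ)).trace) +
        ∑ s ∈ TJ.subtree b.2, (localError csvd G.col s₀ Y BW rkJ s *
          (Ztᵀ * ind (TI.label b.1) * Ztᵀᵀ)).trace := by
      intro b hb
      have h1 := frobSq_two_sided_le (totalError csvd G.row t₀ X BV rkI b.1)
        (totalError csvd G.col s₀ Y BW rkJ b.2) (totalError_transpose _ _ _ _ _ _ _)
        (totalError_mul_self _ _ _ _ _ _ _) (totalError_transpose _ _ _ _ _ _ _)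
        (totalError_mul_self _ _ _ _ _ _ _) (ind (TI.label b.1) * Zt * ind (TJ.label b.2))
      have h2 := trace_totalError G.col s₀ Y csvd BW rkJ Ztᵀ b.2 (TI.label b.1)
      have h3 : ind (TJ.label b.2) * Ztᵀ * ind (TI.label b.1) =
          (ind (TI.label b.1) * Zt * ind (TJ.label b.2))ᵀ := by
        simp only [Matrix.transpose_mul, ind_transpose, Matrix.mul_assoc]
      rw [h3, Matrix.transpose_transpose (ind _ * _ * _)] at h2
      rw [trace_totalError G.row t₀ X csvd BV rkI Zt b.1 (TJ.label b.2), h2] at h1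
      refine le_trans ?_ h1
      rw [frobSq, Fintype.sum_prod_type]
      refine Finset.sum_le_sum fun i _ => Finset.sum_le_sum fun j _ => ?_
      dsimp only
      split_ifs with hij
      · rw [Matrix.sub_apply, ← updated_block csvd G X Y BV BW rkI rkJ h₀ hG hb, ← hU,
          hadm b hb i hij.1 j hij.2, mul_ind_apply, if_pos hij.2, ind_mul_apply, if_pos hij.1]
      · exact sq_nonneg _
    have hrow : ∑ b ∈ B.admissible, ∑ t ∈ TI.subtree b.1, (localError csvd G.row t₀ X BV rkI t *
          (Zt * ind (TJ.label b.2) * Ztᵀ)).trace =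
        ∑ t ∈ TI.subtree t₀, (localError csvd G.row t₀ X BV rkI t * ∑ b ∈ B.rowBlocks t,
          Zt * ind (TJ.label b.2) * Ztᵀ).trace := by
      rw [Finset.sum_comm' (t' := Finset.univ) (s' := fun t => B.rowBlocks t)
        (fun b t => by simp [B.mem_rowBlocks]),
        ← Finset.sum_subset (Finset.subset_univ (TI.subtree t₀))]
      · simp only [Matrix.mul_sum, Matrix.trace_sum]
      · intro t _ ht
        simp [localError, ht]
    have hcol : ∑ b ∈ B.admissible, ∑ s ∈ TJ.subtree b.2, (localError csvd G.col s₀ Y BW rkJ s *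
          (Ztᵀ * ind (TI.label b.1) * Ztᵀᵀ)).trace =
        ∑ s ∈ TJ.subtree s₀, (localError csvd G.col s₀ Y BW rkJ s * ∑ b ∈ B.colBlocks s,
          Ztᵀ * ind (TI.label b.1) * Ztᵀᵀ).trace := by
      rw [Finset.sum_comm' (t' := Finset.univ) (s' := fun s => B.colBlocks s)
        (fun b s => by simp [B.mem_colBlocks]),
        ← Finset.sum_subset (Finset.subset_univ (TJ.subtree s₀))]
      · simp only [Matrix.mul_sum, Matrix.trace_sum]
      · intro s _ hs
        simp [localError, hs]
    rw [← hrow, ← hcol, ← Finset.sum_add_distrib, ← Fintype.sum_prod_type'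
      (f := fun i j => (Z' i j - Zt i j) ^ 2)]
    refine (Finset.sum_le_sum fun p _ => hcover p).trans ?_
    rw [Finset.sum_comm]
    exact Finset.sum_le_sum hblock

end Update

/-! ### The error estimate -/

section Error

variable (cqr csvd : ℕ) {TI : ClusterTree ι N} {TJ : ClusterTree κ M} {B : BlockTree TI TJ}
  {k : ℕ} (G : HTwoRep B k) (w : StoredWeights N M k) (t₀ : N) (s₀ : M)
  (X : Matrix (TI.label t₀) (Fin k) ℝ) (Y : Matrix (TJ.label s₀) (Fin k) ℝ)
  (rkI : N → ℕ) (rkJ : M → ℕ)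

/-- The total weight matrices of the row clusters used in the update. -/
def rowWeights : TI.subtree t₀ → Matrix (Dbl k) (Dbl k) ℝ :=
  (totalWeights cqr TI G.row t₀ B.row G.coupling
    (fun s => if h : s ∈ TJ.subtree s₀ then (basisWeights cqr TJ G.col s₀ Y).val ⟨s, h⟩
      else extendZero (w.colBasis s))
    (if t₀ = TI.root then 0 else extendZero (w.rowTotal (TI.father t₀)))).val

/-- The total weight matrices of the column clusters used in the update. -/
def colWeights : TJ.subtree s₀ → Matrix (Dbl k) (Dbl k) ℝ :=
  (totalWeights cqr TJ G.col s₀ B.col (fun s t => (G.coupling t s)ᵀ)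
    (fun t => if h : t ∈ TI.subtree t₀ then (basisWeights cqr TI G.row t₀ X).val ⟨t, h⟩
      else extendZero (w.rowBasis t))
    (if s₀ = TJ.root then 0 else extendZero (w.colTotal (TJ.father s₀)))).val

theorem localUpdate_val : (localUpdate cqr csvd G w t₀ s₀ X Y rkI rkJ).val =
    updated csvd G X Y (rowWeights cqr G w t₀ s₀ Y) (colWeights cqr G w t₀ s₀ X) rkI rkJ := rfl

variable {w t₀ s₀}

/-- The Gram matrix of a block in terms of a basis weight matrix of its other cluster. -/
theorem block_gram {T : ClusterTree ι N} (A : Matrix ι κ ℝ) (t : N) (c : Finset κ)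
    (E : Matrix ι (Dbl k) ℝ) (S R : Matrix (Dbl k) (Dbl k) ℝ) (F : Matrix κ (Dbl k) ℝ)
    (hA : ind (T.label t) * A * ind c = E * S * Fᵀ) (hR : Rᵀ * R = Fᵀ * F) :
    ind (T.label t) * (A * ind c * Aᵀ) * ind (T.label t) = (R * Sᵀ * Eᵀ)ᵀ * (R * Sᵀ * Eᵀ) := by
  have h1 : ind (T.label t) * (A * ind c * Aᵀ) * ind (T.label t) =
      ind (T.label t) * A * ind c * (ind (T.label t) * A * ind c)ᵀ := by
    simp only [Matrix.transpose_mul, ind_transpose, Matrix.mul_assoc]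
    rw [← Matrix.mul_assoc (ind c) (ind c), ind_mul_self]
  rw [h1, hA]
  simp only [Matrix.transpose_mul, Matrix.transpose_transpose, Matrix.mul_assoc]
  rw [← Matrix.mul_assoc Fᵀ F, ← hR, Matrix.mul_assoc]

/-- Valid stored weights make the row weights represent all blocks connected to a cluster. -/
theorem rowWeights_gram (h₀ : (t₀, s₀) ∈ B.blocks) {Z : Matrix ι κ ℝ} (hG : G.Represents Z)
    (hw : w.Valid G Z t₀ s₀) {t : N} (ht : t ∈ TI.subtree t₀) :
    ind (TI.label t) * (∑ b ∈ B.rowBlocks t, (Z + zeroExtend X * (zeroExtend Y)ᵀ) *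
      ind (TJ.label b.2) * (Z + zeroExtend X * (zeroExtend Y)ᵀ)ᵀ) * ind (TI.label t) =
      extBasis G.row t₀ X t * (rowWeights cqr G w t₀ s₀ Y ⟨t, ht⟩)ᵀ *
        (extBasis G.row t₀ X t * (rowWeights cqr G w t₀ s₀ Y ⟨t, ht⟩)ᵀ)ᵀ := by
  rw [rowWeights]
  generalize hRdef : (fun s => if h : s ∈ TJ.subtree s₀ then (basisWeights cqr TJ G.col s₀ Y).val ⟨s, h⟩
      else extendZero (w.colBasis s)) = R
  have hR := completed_basisWeights_gram G.col s₀ Y cqr w.colBasis hw.colBasis hRdef.symm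
  refine totalWeights_gram_blocks G.row t₀ X cqr B.row G.coupling R _ B.rowBlocks Prod.mk
    (fun b => (Z + zeroExtend X * (zeroExtend Y)ᵀ) *
      ind (TJ.label b.2) * (Z + zeroExtend X * (zeroExtend Y)ᵀ)ᵀ) ?_ ?_ ?_ ht
  · exact fun t ht htt => B.sum_rowBlocks _ (TI.ne_root_of_mem_subtree ht htt)
  · by_cases hr : t₀ = TI.root
    · subst hr
      rw [B.sum_rowBlocks_root, if_pos rfl]
      simp
    · rw [if_neg hr, B.sum_rowBlocks _ hr, Matrix.mul_add, Matrix.add_mul, add_comm]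
      congr 1
      refine initial_weight_gram G.row t₀ X hr (B.rowBlocks (TI.father t₀))
        (fun b : N × M => TJ.label b.2) Z (Z + zeroExtend X * (zeroExtend Y)ᵀ) _ (hw.rowTotal hr) ?_
      intro b hb i hi j hj
      obtain ⟨hb, hf⟩ := B.mem_rowBlocks.1 hb
      obtain ⟨hbl, hleaf⟩ := B.admissible_leaf b hb
      rw [Matrix.add_apply, lowRank_apply_eq_zero X Y h₀ hbl hleaf ?_
        (TI.label_subset (TI.mem_subtree_iff_father hr |>.2 (Or.inr hf)) hi) hj, add_zero]
      exact fun h => TI.father_notMem_subtree hr (TI.mem_subtree_trans hf h.1)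
  · intro t ht s hs
    have hts := B.mem_row.1 hs
    refine block_gram _ t _ _ _ _ (extBasis G.col s₀ Y s) ?_ (hR s)
    simpa only using ind_mul_add_lowRank G X Y h₀ hG hts

theorem colWeights_gram (h₀ : (t₀, s₀) ∈ B.blocks) {Z : Matrix ι κ ℝ} (hG : G.Represents Z)
    (hw : w.Valid G Z t₀ s₀) {s : M} (hs : s ∈ TJ.subtree s₀) :
    ind (TJ.label s) * (∑ b ∈ B.colBlocks s, (Z + zeroExtend X * (zeroExtend Y)ᵀ)ᵀ *
      ind (TI.label b.1) * (Z + zeroExtend X * (zeroExtend Y)ᵀ)ᵀᵀ) * ind (TJ.label s) =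
      extBasis G.col s₀ Y s * (colWeights cqr G w t₀ s₀ X ⟨s, hs⟩)ᵀ *
        (extBasis G.col s₀ Y s * (colWeights cqr G w t₀ s₀ X ⟨s, hs⟩)ᵀ)ᵀ := by
  rw [colWeights]
  generalize hRdef : (fun t => if h : t ∈ TI.subtree t₀ then (basisWeights cqr TI G.row t₀ X).val ⟨t, h⟩
      else extendZero (w.rowBasis t)) = R
  have hR := completed_basisWeights_gram G.row t₀ X cqr w.rowBasis hw.rowBasis hRdef.symm
  refine totalWeights_gram_blocks G.col s₀ Y cqr B.col (fun s t => (G.coupling t s)ᵀ) R _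
    B.colBlocks (fun s t => (t, s)) (fun b => (Z + zeroExtend X * (zeroExtend Y)ᵀ)ᵀ *
      ind (TI.label b.1) * (Z + zeroExtend X * (zeroExtend Y)ᵀ)ᵀᵀ) ?_ ?_ ?_ hs
  · exact fun s hs hss => B.sum_colBlocks _ (TJ.ne_root_of_mem_subtree hs hss)
  · by_cases hr : s₀ = TJ.root
    · subst hr
      rw [B.sum_colBlocks_root, if_pos rfl]
      simp
    · rw [if_neg hr, B.sum_colBlocks _ hr, Matrix.mul_add, Matrix.add_mul, add_comm]
      congr 1
      refine initial_weight_gram G.col s₀ Y hr (B.colBlocks (TJ.father s₀))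
        (fun b : N × M => TI.label b.1) Zᵀ (Z + zeroExtend X * (zeroExtend Y)ᵀ)ᵀ _ (hw.colTotal hr) ?_
      intro b hb j hj i hi
      obtain ⟨hb, hf⟩ := B.mem_colBlocks.1 hb
      obtain ⟨hbl, hleaf⟩ := B.admissible_leaf b hb
      rw [Matrix.transpose_apply, Matrix.transpose_apply, Matrix.add_apply,
        lowRank_apply_eq_zero X Y h₀ hbl hleaf ?_ hi
          (TJ.label_subset (TJ.mem_subtree_iff_father hr |>.2 (Or.inr hf)) hj), add_zero]
      exact fun h => TJ.father_notMem_subtree hr (TJ.mem_subtree_trans hf h.2)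
  · intro s hs t ht
    have hts := B.mem_col.1 ht
    refine block_gram _ s _ _ _ _ (extBasis G.row t₀ X t) ?_ (hR t)
    have h := congrArg Matrix.transpose (ind_mul_add_lowRank G X Y h₀ hG hts)
    simp only [Matrix.transpose_mul, ind_transpose, Matrix.transpose_transpose] at h
    have hS : extendOne (G.coupling t s)ᵀ = (extendOne (G.coupling t s))ᵀ := by
      simp [extendOne, Matrix.fromBlocks_transpose]
    rw [hS, Matrix.mul_assoc, h, Matrix.mul_assoc]

theorem exists_localUpdate_matrix (h₀ : (t₀, s₀) ∈ B.blocks) (hI : ∀ t, rkI t ≤ k)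
    (hJ : ∀ s, rkJ s ≤ k) (Z : Matrix ι κ ℝ) (hG : G.Represents Z) :
    ∃ Z' : Matrix ι κ ℝ,
      (localUpdate cqr csvd G w t₀ s₀ X Y rkI rkJ).val.Represents Z' ∧
      IsHTwoMatrix B
        (localUpdate cqr csvd G w t₀ s₀ X Y rkI rkJ).val.row.basis
        (localUpdate cqr csvd G w t₀ s₀ X Y rkI rkJ).val.col.basis Z' ∧
      (∀ t ∈ TI.subtree t₀, HasOrthonormalColumns
        ((localUpdate cqr csvd G w t₀ s₀ X Y rkI rkJ).val.row.basis t)) ∧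
      (∀ s ∈ TJ.subtree s₀, HasOrthonormalColumns
        ((localUpdate cqr csvd G w t₀ s₀ X Y rkI rkJ).val.col.basis s)) ∧
      (∀ i j, i ∉ TI.label t₀ → j ∉ TJ.label s₀ → Z' i j = Z i j) ∧
      (∀ b ∈ B.inadmissible, ∀ i ∈ TI.label b.1, ∀ j ∈ TJ.label b.2,
        Z' i j = (Z + zeroExtend X * (zeroExtend Y)ᵀ) i j) ∧
      (w.Valid G Z t₀ s₀ →
        ∀ (P : N → Matrix ι κ ℝ) (P' : M → Matrix ι κ ℝ),
          (∀ t ∈ TI.subtree t₀, (P t).rank ≤ rkI t) →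
          (∀ s ∈ TJ.subtree s₀, (P' s).rank ≤ rkJ s) →
          ∑ i, ∑ j, (Z' i j - (Z + zeroExtend X * (zeroExtend Y)ᵀ) i j) ^ 2 ≤
            (∑ t ∈ TI.subtree t₀, ∑ b ∈ B.rowBlocks t,
              ∑ i ∈ TI.label t, ∑ j ∈ TJ.label b.2,
                ((Z + zeroExtend X * (zeroExtend Y)ᵀ) i j - P t i j) ^ 2) +
            ∑ s ∈ TJ.subtree s₀, ∑ b ∈ B.colBlocks s,
              ∑ i ∈ TI.label b.1, ∑ j ∈ TJ.label s,
                ((Z + zeroExtend X * (zeroExtend Y)ᵀ) i j - P' s i j) ^ 2) := by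
  rw [localUpdate_val]
  obtain ⟨Z', h1, h2, h3, h4, h5⟩ := exists_updated_matrix csvd G X Y
    (rowWeights cqr G w t₀ s₀ Y) (colWeights cqr G w t₀ s₀ X) rkI rkJ h₀ hG
  refine ⟨Z', h1, h2,
    fun t ht => (newRep_orthonormal_and_localR csvd G.row t₀ X _ rkI ht).1,
    fun s hs => (newRep_orthonormal_and_localR csvd G.col s₀ Y _ rkJ hs).1, h3, h4, ?_⟩
  intro hw P P' hP hP'
  refine h5.trans (add_le_add (Finset.sum_le_sum fun t ht => ?_)
    (Finset.sum_le_sum fun s hs => ?_))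
  · exact trace_localError_le csvd G.row t₀ X (rowWeights cqr G w t₀ s₀ Y) rkI ht (hI t)
      (B.rowBlocks t) (fun b : N × M => TJ.label b.2) (Z + zeroExtend X * (zeroExtend Y)ᵀ) (P t)
      (hP t ht) (rowWeights_gram cqr G X Y h₀ hG hw ht)
  · refine (trace_localError_le csvd G.col s₀ Y (colWeights cqr G w t₀ s₀ X) rkJ hs (hJ s)
      (B.colBlocks s) (fun b : N × M => TI.label b.1) (Z + zeroExtend X * (zeroExtend Y)ᵀ)ᵀ (P' s)ᵀ (by rw [Matrix.rank_transpose]; exact hP' s hs)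
      (colWeights_gram cqr G X Y h₀ hG hw hs)).trans (le_of_eq ?_)
    refine Finset.sum_congr rfl fun b _ => ?_
    rw [Finset.sum_comm]
    rfl

end Error

/-! ### Operation counts -/

theorem decompCost_le (c m n : ℕ) : decompCost c m n ≤ c * (m * n * n) :=
  Nat.mul_le_mul_left c (Nat.mul_le_mul_left _ (min_le_right m n))

section OneSided

variable (T : ClusterTree ι N) {k : ℕ} (V : BasisRep T k) (t₀ : N)
  (X : Matrix (T.label t₀) (Fin k) ℝ)

theorem sum_card_sons_le : ∑ t : T.subtree t₀, (T.sons t.1).card ≤ (T.subtree t₀).card := by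
  have h := T.sum_card_sons t₀
  rw [Finset.sum_coe_sort (T.subtree t₀) fun t => (T.sons t).card]
  omega

/-- Costs per cluster that are linear in the number of sons and in the number of rows of leaves. -/
theorem sum_cost_le (f : T.subtree t₀ → ℕ) (a c d : ℕ)
    (hf : ∀ t, f t ≤ a * (T.sons t.1).card + c * Fintype.card (T.LeafIdx t.1) + d) :
    ∑ t, f t ≤ (a + d) * (T.subtree t₀).card + c * (T.label t₀).card := by
  refine (Finset.sum_le_sum fun t _ => hf t).trans ?_
  rw [Finset.sum_add_distrib, Finset.sum_add_distrib, ← Finset.mul_sum, ← Finset.mul_sum,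
    Finset.sum_const, Finset.card_univ, Fintype.card_coe, smul_eq_mul,
    Finset.sum_coe_sort (T.subtree t₀) fun t => Fintype.card (T.LeafIdx t)]
  have h1 := Nat.mul_le_mul_left a (sum_card_sons_le T t₀)
  have h2 := Nat.mul_le_mul_left c (T.sum_card_leafIdx_le t₀)
  linarith

theorem basisWeights_ops_le (cqr : ℕ) : (basisWeights cqr T V t₀ X).ops ≤
    (16 + 8 * cqr) * (k ^ 3 * (T.subtree t₀).card) +
      4 * cqr * (k ^ 2 * (T.label t₀).card) := by
  have hstep : (basisWeights cqr T V t₀ X).ops = ∑ t : T.subtree t₀,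
      ((∑ _u : T.sons t.1, 2 * (Fintype.card (Dbl k) * Fintype.card (Dbl k) *
        Fintype.card (Dbl k))) +
        decompCost cqr (Fintype.card (T.LeafIdx t.1 ⊕ (T.sons t.1 × Dbl k))) (k + k)) := rfl
  rw [hstep]
  refine (sum_cost_le T t₀ _ ((16 + 8 * cqr) * k ^ 3) (4 * cqr * k ^ 2) 0 fun t => ?_).trans
    (le_of_eq (by ring))
  have h := decompCost_le cqr (Fintype.card (T.LeafIdx t.1 ⊕ (T.sons t.1 × Dbl k))) (k + k)
  simp only [Fintype.card_sum, Fintype.card_prod, Fintype.card_fin, Fintype.card_coe,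
    Finset.sum_const, Finset.card_univ, smul_eq_mul] at h ⊢
  refine (Nat.add_le_add_left h _).trans (le_of_eq (by ring))

theorem totalWeights_ops_le (cqr Csp : ℕ) (adj : N → Finset M)
    (S : N → M → Matrix (Fin k) (Fin k) ℝ) (R : M → Matrix (Dbl k) (Dbl k) ℝ)
    (init : Matrix (Dbl k) (Dbl k) ℝ) (hadj : ∀ t, (adj t).card ≤ Csp) :
    (totalWeights cqr T V t₀ adj S R init).ops ≤
      (Csp + 1) * (16 + 8 * cqr) * (k ^ 3 * (T.subtree t₀).card) := by
  have hstep : (totalWeights cqr T V t₀ adj S R init).ops = ∑ t : T.subtree t₀,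
      ((∑ _s : adj t.1, 2 * (Fintype.card (Dbl k) * Fintype.card (Dbl k) *
        Fintype.card (Dbl k))) +
      (2 * (Fintype.card (Dbl k) * Fintype.card (Dbl k) * Fintype.card (Dbl k)) +
        decompCost cqr (Fintype.card ((adj t.1 × Dbl k) ⊕ Dbl k)) (k + k))) := rfl
  rw [hstep]
  refine (sum_cost_le T t₀ _ 0 0 ((Csp + 1) * (16 + 8 * cqr) * k ^ 3) fun t => ?_).trans
    (le_of_eq (by ring))
  have h := decompCost_le cqr (Fintype.card ((adj t.1 × Dbl k) ⊕ Dbl k)) (k + k)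
  simp only [Fintype.card_sum, Fintype.card_prod, Fintype.card_fin, Fintype.card_coe,
    Finset.sum_const, Finset.card_univ, smul_eq_mul] at h ⊢
  have h2 := Nat.mul_le_mul_right ((16 + 8 * cqr) * k ^ 3) (Nat.add_le_add_right (hadj t.1) 1)
  calc _ ≤ _ := Nat.add_le_add_left (Nat.add_le_add_left h _) _
    _ = ((adj t.1).card + 1) * ((16 + 8 * cqr) * k ^ 3) := by ring
    _ ≤ _ := h2
    _ = _ := by ring

theorem newBasis_ops_le (csvd : ℕ) (Bw : T.subtree t₀ → Matrix (Dbl k) (Dbl k) ℝ) (rk : N → ℕ) :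
    (newBasis csvd T V t₀ X Bw rk).ops ≤
      (20 + 4 * csvd) * (k ^ 3 * (T.subtree t₀).card) +
        (12 + 4 * csvd) * (k ^ 2 * (T.label t₀).card) := by
  have hstep : (newBasis csvd T V t₀ X Bw rk).ops = ∑ t : T.subtree t₀,
      ((∑ _u : T.sons t.1, 2 * (Fintype.card (Fin k) * Fintype.card (Dbl k) *
        Fintype.card (Dbl k))) +
      (2 * (Fintype.card (LocalRow T k t.1) * Fintype.card (Dbl k) * Fintype.card (Dbl k)) +
      (decompCost csvd (Fintype.card (LocalRow T k t.1)) (Fintype.card (Dbl k)) +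
      (2 * (Fintype.card (Fin k) * Fintype.card (LocalRow T k t.1) * Fintype.card (Dbl k)) +
        0)))) := rfl
  rw [hstep]
  refine (sum_cost_le T t₀ _ ((20 + 4 * csvd) * k ^ 3) ((12 + 4 * csvd) * k ^ 2) 0
    fun t => ?_).trans (le_of_eq (by ring))
  have h := decompCost_le csvd (Fintype.card (LocalRow T k t.1)) (Fintype.card (Dbl k))
  simp only [Fintype.card_sum, Fintype.card_prod, Fintype.card_fin, Fintype.card_coe,
    Finset.sum_const, Finset.card_univ, smul_eq_mul] at h ⊢
  exact (Nat.add_le_add_left (Nat.add_le_add_left (Nat.add_le_add_right h _) _) _).trans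
    (le_of_eq (by ring))

theorem replaceBasis_ops_le
    (Q : ∀ t : T.subtree t₀, Matrix (LocalRow T k t.1) (Fin k) ℝ × Matrix (Fin k) (Dbl k) ℝ) :
    (replaceBasis T V t₀ Q).ops ≤ 4 * (k ^ 3 * (T.subtree t₀).card) := by
  have hstep : (replaceBasis T V t₀ Q).ops =
      2 * (Fintype.card (Fin k) * Fintype.card (Dbl k) * Fintype.card (Fin k)) + 0 := rfl
  have h1 : 1 ≤ (T.subtree t₀).card := Finset.card_pos.2 ⟨t₀, T.self_mem_subtree t₀⟩
  rw [hstep]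
  simp only [Fintype.card_sum, Fintype.card_fin]
  calc _ = 4 * (k ^ 3 * 1) := by ring
    _ ≤ _ := Nat.mul_le_mul_left _ (Nat.mul_le_mul_left _ h1)

end OneSided

section Update

variable {TI : ClusterTree ι N} {TJ : ClusterTree κ M} {B : BlockTree TI TJ} {k : ℕ}
  (G : HTwoRep B k) (t₀ : N) (s₀ : M)

theorem card_row_le {Csp : ℕ} (h : B.IsSparse Csp) (t : N) : (B.row t).card ≤ Csp := by
  refine (Finset.card_le_card fun s hs => ?_).trans (h.1 t)
  exact Finset.mem_filter.2 ⟨Finset.mem_univ _, (B.admissible_leaf _ (B.mem_row.1 hs)).1⟩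

theorem card_col_le {Csp : ℕ} (h : B.IsSparse Csp) (s : M) : (B.col s).card ≤ Csp := by
  refine (Finset.card_le_card fun t ht => ?_).trans (h.2 s)
  exact Finset.mem_filter.2 ⟨Finset.mem_univ _, (B.admissible_leaf _ (B.mem_col.1 ht)).1⟩

theorem newCoupling_ops_le (RI : TI.subtree t₀ → Matrix (Fin k) (Dbl k) ℝ)
    (RJ : TJ.subtree s₀ → Matrix (Fin k) (Dbl k) ℝ) (t : N) (s : M) :
    (newCoupling G t₀ s₀ RI RJ t s).ops ≤
      (if t ∈ TI.subtree t₀ ∧ s ∈ B.row t then 12 * k ^ 3 else 0) +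
        if s ∈ TJ.subtree s₀ ∧ t ∈ B.col s then 12 * k ^ 3 else 0 := by
  by_cases hb : (t, s) ∈ B.admissible
  · by_cases ht : t ∈ TI.subtree t₀
    · by_cases hs : s ∈ TJ.subtree s₀
      · have e : (newCoupling G t₀ s₀ RI RJ t s).ops =
            2 * (Fintype.card (Fin k) * Fintype.card (Dbl k) * Fintype.card (Dbl k)) +
            2 * (Fintype.card (Fin k) * Fintype.card (Dbl k) * Fintype.card (Fin k)) := by
          rw [newCoupling, if_pos hb, dif_pos ht, dif_pos hs]
          rfl
        rw [e, if_pos ⟨ht, B.mem_row.2 hb⟩]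
        refine le_add_right (le_of_eq ?_)
        simp only [Fintype.card_sum, Fintype.card_fin]
        ring
      · have e : (newCoupling G t₀ s₀ RI RJ t s).ops =
            2 * (Fintype.card (Fin k) * Fintype.card (Dbl k) * Fintype.card (Fin k)) := by
          rw [newCoupling, if_pos hb, dif_pos ht, dif_neg hs]
          rfl
        rw [e, if_pos ⟨ht, B.mem_row.2 hb⟩]
        refine le_add_right ?_
        simp only [Fintype.card_sum, Fintype.card_fin]
        nlinarith [Nat.zero_le (k ^ 3)]
    · by_cases hs : s ∈ TJ.subtree s₀
      · have e : (newCoupling G t₀ s₀ RI RJ t s).ops =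
            2 * (Fintype.card (Fin k) * Fintype.card (Dbl k) * Fintype.card (Fin k)) := by
          rw [newCoupling, if_pos hb, dif_neg ht, dif_pos hs]
          rfl
        refine le_add_left ?_
        rw [e, if_pos ⟨hs, B.mem_col.2 hb⟩]
        simp only [Fintype.card_sum, Fintype.card_fin]
        nlinarith [Nat.zero_le (k ^ 3)]
      · have e : (newCoupling G t₀ s₀ RI RJ t s).ops = 0 := by
          rw [newCoupling, if_pos hb, dif_neg ht, dif_neg hs]
          rfl
        rw [e]
        exact Nat.zero_le _
  · have e : (newCoupling G t₀ s₀ RI RJ t s).ops = 0 := by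
      rw [newCoupling, if_neg hb]
      rfl
    rw [e]
    exact Nat.zero_le _

theorem sum_newCoupling_ops_le {Csp : ℕ} (h : B.IsSparse Csp)
    (RI : TI.subtree t₀ → Matrix (Fin k) (Dbl k) ℝ)
    (RJ : TJ.subtree s₀ → Matrix (Fin k) (Dbl k) ℝ) :
    ∑ t : N, ∑ s : M, (newCoupling G t₀ s₀ RI RJ t s).ops ≤
      12 * Csp * (k ^ 3 * (TI.subtree t₀).card) + 12 * Csp * (k ^ 3 * (TJ.subtree s₀).card) := by
  refine (Finset.sum_le_sum fun t _ => Finset.sum_le_sum fun s _ =>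
    newCoupling_ops_le G t₀ s₀ RI RJ t s).trans ?_
  simp only [Finset.sum_add_distrib]
  have key : ∀ {N M : Type} [Fintype N] [DecidableEq N] [Fintype M] [DecidableEq M]
      (A : Finset N) (R : N → Finset M),
      (∀ t, (R t).card ≤ Csp) → ∑ t : N, ∑ s : M, (if t ∈ A ∧ s ∈ R t then 12 * k ^ 3 else 0) ≤
        12 * Csp * (k ^ 3 * A.card) := by
    intro N M _ _ _ _ A R hR
    have e : ∀ t, ∑ s : M, (if t ∈ A ∧ s ∈ R t then 12 * k ^ 3 else 0) ≤
        if t ∈ A then 12 * Csp * k ^ 3 else 0 := by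
      intro t
      by_cases ht : t ∈ A
      · simp only [ht, true_and, if_true]
        rw [← Finset.sum_filter, Finset.sum_const, Finset.filter_mem_eq_inter, Finset.univ_inter,
          smul_eq_mul]
        calc _ ≤ Csp * (12 * k ^ 3) := Nat.mul_le_mul_right _ (hR t)
          _ = _ := by ring
      · simp [ht]
    refine (Finset.sum_le_sum fun t _ => e t).trans (le_of_eq ?_)
    rw [← Finset.sum_filter, Finset.sum_const, Finset.filter_mem_eq_inter, Finset.univ_inter,
      smul_eq_mul]
    ring
  refine Nat.add_le_add (key _ _ (card_row_le h)) ?_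
  rw [Finset.sum_comm]
  exact key _ _ (card_col_le h)

theorem sum_newNear_ops (X : Matrix (TI.label t₀) (Fin k) ℝ) (Y : Matrix (TJ.label s₀) (Fin k) ℝ) :
    ∑ t : N, ∑ s : M, (newNear G t₀ s₀ X Y t s).ops =
      2 * k * ∑ b ∈ B.inadmissible with b.1 ∈ TI.subtree t₀ ∧ b.2 ∈ TJ.subtree s₀,
        (TI.label b.1).card * (TJ.label b.2).card := by
  have e : ∀ t s, (newNear G t₀ s₀ X Y t s).ops =
      if (t, s) ∈ B.inadmissible ∧ t ∈ TI.subtree t₀ ∧ s ∈ TJ.subtree s₀ then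
        2 * k * ((TI.label t).card * (TJ.label s).card) else 0 := by
    intro t s
    unfold newNear
    split_ifs
    · simp only [Counted.addMul, Fintype.card_coe, Fintype.card_fin]
      ring
    · rfl
  simp only [e]
  rw [← Fintype.sum_prod_type' (f := fun t s =>
    if (t, s) ∈ B.inadmissible ∧ t ∈ TI.subtree t₀ ∧ s ∈ TJ.subtree s₀ then
        2 * k * ((TI.label t).card * (TJ.label s).card) else 0), Finset.mul_sum, Finset.sum_filter,
    ← Finset.sum_filter_of_ne (p := fun b => b ∈ B.inadmissible), Finset.filter_mem_eq_inter,
    Finset.univ_inter]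
  · refine Finset.sum_congr rfl fun b hb => ?_
    simp only [Prod.mk.eta, hb, true_and]
  · intro b _ hb
    by_contra h
    exact hb (if_neg fun h' => h h'.1)

theorem localUpdate_ops_le (cqr csvd Csp : ℕ) (h : B.IsSparse Csp) (w : StoredWeights N M k)
    (X : Matrix (TI.label t₀) (Fin k) ℝ) (Y : Matrix (TJ.label s₀) (Fin k) ℝ)
    (rkI : N → ℕ) (rkJ : M → ℕ) :
    (localUpdate cqr csvd G w t₀ s₀ X Y rkI rkJ).ops ≤
      (40 + 8 * cqr + 4 * csvd + (Csp + 1) * (16 + 8 * cqr) + 12 * Csp) *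
        (k ^ 3 * (TI.subtree t₀).card + k ^ 3 * (TJ.subtree s₀).card) +
      (12 + 4 * cqr + 4 * csvd) *
        (k ^ 2 * (TI.label t₀).card + k ^ 2 * (TJ.label s₀).card) +
      2 * k * ∑ b ∈ B.inadmissible with b.1 ∈ TI.subtree t₀ ∧ b.2 ∈ TJ.subtree s₀,
        (TI.label b.1).card * (TJ.label b.2).card := by
  have hstep : (localUpdate cqr csvd G w t₀ s₀ X Y rkI rkJ).ops =
      (basisWeights cqr TI G.row t₀ X).ops + ((basisWeights cqr TJ G.col s₀ Y).ops +
      ((totalWeights cqr TI G.row t₀ B.row G.coupling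
        (fun s => if h : s ∈ TJ.subtree s₀ then (basisWeights cqr TJ G.col s₀ Y).val ⟨s, h⟩
          else extendZero (w.colBasis s))
        (if t₀ = TI.root then 0 else extendZero (w.rowTotal (TI.father t₀)))).ops +
      ((totalWeights cqr TJ G.col s₀ B.col (fun s t => (G.coupling t s)ᵀ)
        (fun t => if h : t ∈ TI.subtree t₀ then (basisWeights cqr TI G.row t₀ X).val ⟨t, h⟩
          else extendZero (w.rowBasis t))
        (if s₀ = TJ.root then 0 else extendZero (w.colTotal (TJ.father s₀)))).ops +
      ((newBasis csvd TI G.row t₀ X (rowWeights cqr G w t₀ s₀ Y) rkI).ops +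
      ((newBasis csvd TJ G.col s₀ Y (colWeights cqr G w t₀ s₀ X) rkJ).ops +
      ((replaceBasis TI G.row t₀
        (newBasis csvd TI G.row t₀ X (rowWeights cqr G w t₀ s₀ Y) rkI).val).ops +
      ((replaceBasis TJ G.col s₀
        (newBasis csvd TJ G.col s₀ Y (colWeights cqr G w t₀ s₀ X) rkJ).val).ops +
      (∑ t : N, ∑ s : M, (newCoupling G t₀ s₀
        (localR csvd G.row t₀ X (rowWeights cqr G w t₀ s₀ Y) rkI)
        (localR csvd G.col s₀ Y (colWeights cqr G w t₀ s₀ X) rkJ) t s).ops +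
      (∑ t : N, ∑ s : M, (newNear G t₀ s₀ X Y t s).ops + 0))))))))) := rfl
  rw [hstep, sum_newNear_ops]
  have a1 := basisWeights_ops_le TI G.row t₀ X cqr
  have a2 := basisWeights_ops_le TJ G.col s₀ Y cqr
  have a3 := totalWeights_ops_le TI G.row t₀ cqr Csp B.row G.coupling
    (fun s => if h : s ∈ TJ.subtree s₀ then (basisWeights cqr TJ G.col s₀ Y).val ⟨s, h⟩
      else extendZero (w.colBasis s))
    (if t₀ = TI.root then 0 else extendZero (w.rowTotal (TI.father t₀))) (card_row_le h)
  have a4 := totalWeights_ops_le TJ G.col s₀ cqr Csp B.col (fun s t => (G.coupling t s)ᵀ)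
    (fun t => if h : t ∈ TI.subtree t₀ then (basisWeights cqr TI G.row t₀ X).val ⟨t, h⟩
      else extendZero (w.rowBasis t))
    (if s₀ = TJ.root then 0 else extendZero (w.colTotal (TJ.father s₀))) (card_col_le h)
  have a5 := newBasis_ops_le TI G.row t₀ X csvd (rowWeights cqr G w t₀ s₀ Y) rkI
  have a6 := newBasis_ops_le TJ G.col s₀ Y csvd (colWeights cqr G w t₀ s₀ X) rkJ
  have a7 := replaceBasis_ops_le TI G.row t₀
    (newBasis csvd TI G.row t₀ X (rowWeights cqr G w t₀ s₀ Y) rkI).val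
  have a8 := replaceBasis_ops_le TJ G.col s₀
    (newBasis csvd TJ G.col s₀ Y (colWeights cqr G w t₀ s₀ X) rkJ).val
  have a9 := sum_newCoupling_ops_le G t₀ s₀ h
    (localR csvd G.row t₀ X (rowWeights cqr G w t₀ s₀ Y) rkI)
    (localR csvd G.col s₀ Y (colWeights cqr G w t₀ s₀ X) rkJ)
  linarith

end Update

end HTwo

end

theorem mainTheorem3 (cqr csvd Csp : ℕ) (Ctree Cnear : ℝ) :
    ∃ C : ℝ,
      ∀ (ι κ N M : Type) [Fintype ι] [DecidableEq ι] [Fintype κ] [DecidableEq κ]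
        [Fintype N] [DecidableEq N] [Fintype M] [DecidableEq M]
        (TI : HTwo.ClusterTree ι N) (TJ : HTwo.ClusterTree κ M) (B : HTwo.BlockTree TI TJ)
        (k : ℕ) (G : HTwo.HTwoRep B k) (w : HTwo.StoredWeights N M k) (t₀ : N) (s₀ : M)
        (X : Matrix (TI.label t₀) (Fin k) ℝ) (Y : Matrix (TJ.label s₀) (Fin k) ℝ)
        (rkI : N → ℕ) (rkJ : M → ℕ),
        (t₀, s₀) ∈ B.blocks →
        B.IsSparse Csp →
        (k : ℝ) ^ 3 * (TI.subtree t₀).card ≤ Ctree * ((k : ℝ) ^ 2 * (TI.label t₀).card) →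
        (k : ℝ) ^ 3 * (TJ.subtree s₀).card ≤ Ctree * ((k : ℝ) ^ 2 * (TJ.label s₀).card) →
        (∑ b ∈ B.inadmissible with b.1 ∈ TI.subtree t₀ ∧ b.2 ∈ TJ.subtree s₀,
            ((TI.label b.1).card : ℝ) * (TJ.label b.2).card)
          ≤ Cnear * (k * ((TI.label t₀).card + (TJ.label s₀).card)) →
        (∀ t, rkI t ≤ k) → (∀ s, rkJ s ≤ k) →
        ((HTwo.localUpdate cqr csvd G w t₀ s₀ X Y rkI rkJ).ops : ℝ)
            ≤ C * (((TI.label t₀).card + (TJ.label s₀).card) * (k : ℝ) ^ 2) ∧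
        ∀ Z : Matrix ι κ ℝ, G.Represents Z →
          ∃ Z' : Matrix ι κ ℝ,
            (HTwo.localUpdate cqr csvd G w t₀ s₀ X Y rkI rkJ).val.Represents Z' ∧
            HTwo.IsHTwoMatrix B
              (HTwo.localUpdate cqr csvd G w t₀ s₀ X Y rkI rkJ).val.row.basis
              (HTwo.localUpdate cqr csvd G w t₀ s₀ X Y rkI rkJ).val.col.basis Z' ∧
            (∀ t ∈ TI.subtree t₀, HTwo.HasOrthonormalColumns
              ((HTwo.localUpdate cqr csvd G w t₀ s₀ X Y rkI rkJ).val.row.basis t)) ∧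
            (∀ s ∈ TJ.subtree s₀, HTwo.HasOrthonormalColumns
              ((HTwo.localUpdate cqr csvd G w t₀ s₀ X Y rkI rkJ).val.col.basis s)) ∧
            (∀ i j, i ∉ TI.label t₀ → j ∉ TJ.label s₀ → Z' i j = Z i j) ∧
            (∀ b ∈ B.inadmissible, ∀ i ∈ TI.label b.1, ∀ j ∈ TJ.label b.2,
              Z' i j = (Z + HTwo.zeroExtend X * (HTwo.zeroExtend Y)ᵀ) i j) ∧
            (w.Valid G Z t₀ s₀ →
              ∀ (P : N → Matrix ι κ ℝ) (P' : M → Matrix ι κ ℝ),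
                (∀ t ∈ TI.subtree t₀, (P t).rank ≤ rkI t) →
                (∀ s ∈ TJ.subtree s₀, (P' s).rank ≤ rkJ s) →
                ∑ i, ∑ j, (Z' i j - (Z + HTwo.zeroExtend X * (HTwo.zeroExtend Y)ᵀ) i j) ^ 2 ≤
                  (∑ t ∈ TI.subtree t₀, ∑ b ∈ B.rowBlocks t,
                    ∑ i ∈ TI.label t, ∑ j ∈ TJ.label b.2,
                      ((Z + HTwo.zeroExtend X * (HTwo.zeroExtend Y)ᵀ) i j - P t i j) ^ 2) +
                  ∑ s ∈ TJ.subtree s₀, ∑ b ∈ B.colBlocks s,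
                    ∑ i ∈ TI.label b.1, ∑ j ∈ TJ.label s,
                      ((Z + HTwo.zeroExtend X * (HTwo.zeroExtend Y)ᵀ) i j - P' s i j) ^ 2) := by
  refine ⟨((40 + 8 * cqr + 4 * csvd + (Csp + 1) * (16 + 8 * cqr) + 12 * Csp : ℕ) : ℝ) * Ctree +
    ((12 + 4 * cqr + 4 * csvd : ℕ) : ℝ) + 2 * Cnear, ?_⟩
  intro ι κ N M _ _ _ _ _ _ _ _ TI TJ B k G w t₀ s₀ X Y rkI rkJ h₀ hsp hI hJ hnear hrI hrJ
  refine ⟨?_, fun Z hG =>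
    HTwo.exists_localUpdate_matrix cqr csvd G X Y rkI rkJ h₀ hrI hrJ Z hG⟩
  have hops : ((HTwo.localUpdate cqr csvd G w t₀ s₀ X Y rkI rkJ).ops : ℝ) ≤ _ :=
    Nat.cast_le.2 (HTwo.localUpdate_ops_le G t₀ s₀ cqr csvd Csp hsp w X Y rkI rkJ)
  generalize 40 + 8 * cqr + 4 * csvd + (Csp + 1) * (16 + 8 * cqr) + 12 * Csp = c₁ at hops ⊢
  generalize 12 + 4 * cqr + 4 * csvd = c₂ at hops ⊢
  push_cast at hops
  have h1 := mul_le_mul_of_nonneg_left (add_le_add hI hJ) (Nat.cast_nonneg (α := ℝ) c₁)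
  have h2 := mul_le_mul_of_nonneg_left hnear
    (mul_nonneg zero_le_two (Nat.cast_nonneg (α := ℝ) k))
  refine hops.trans ((add_le_add (add_le_add_left h1 _) h2).trans (le_of_eq ?_))
  ring
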